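/- Theorem 5.2. Let $\Omega\subset\mathbb{R}^2$ be a bounded polygonal domain with Lipschitz boundary (all that is used: $\Omega=\operatorname{int}\overline\Omega$, and $\overline\Omega$ is triangulated by the meshes below). Let $\alpha,\sigma\in[0,\infty]$, $\gamma,M>0$, $\kappa\in\mathbb{N}$, put $\rho=\min(1,\alpha,\sigma/2)$, and let $h^\infty=0$ for $0<h<1$. There is a constant $C$, depending only on $\Omega,\alpha,\sigma,\gamma,M,\kappa$, such that the following holds for every $0<h<1$ and every conforming triangulation $\mathcal{T}_h$ of $\overline\Omega$ with mesh size $h=\max_{\tau}\operatorname{diam}\tau$ which is shape regular (every $\tau\in\mathcal{T}_h$ contains a disc of radius $\gamma^{-1}\operatorname{diam}\tau$) and satisfies the following $(\alpha,\sigma)$-condition: 1. the set of interior edges is a disjoint union $\mathcal{E}_1\uplus\mathcal{E}_2$ such that for each $e\in\mathcal{E}_1$ the lengths of opposite sides of the quadrilateral $\tau\cup\tau'$ formed by the two elements sharing $e$ differ by at most $Mh^{1+\alpha}$, while $\sum_{e\in\mathcal{E}_2}(|\tau|+|\tau'|)\le Mh^\sigma$; 2. the set of boundary vertices is a disjoint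 union $\mathcal{P}_1\uplus\mathcal{P}_2$ with $|\mathcal{P}_2|\le\kappa$, and for each $x\in\mathcal{P}_1$ the two boundary edges $e,e'$ meeting at $x$, with their elements $\tau\supset e$, $\tau'\supset e'$, satisfy: going counterclockwise around $\tau$ from $e$ and around $\tau'$ from $e'$, the lengths of corresponding edges differ by at most $Mh^{1+\alpha}$, and the counterclockwise unit tangents of $e$ and $e'$ differ by at most $Mh^\alpha$. For a vector field $\boldsymbol q$ let $\Pi_h\boldsymbol q$ be its lowest order Raviart–Thomas interpolant: on each $\tau$ it has the form $\boldsymbol a+c\,\boldsymbol x$ with $\boldsymbol a\in\mathbb{R}^2$, $c\in\mathbb{R}$, and $\int_e\Pi_h\boldsymbol q\cdot\boldsymbol n=\int_e\boldsymbol q\cdot\boldsymbol n$ for each edge $e$ of $\tau$. For a field $\boldsymbol q_h$ which is piecewise of this form let $G_h\boldsymbol q_h$ be the vector field that is affine on each element and has the following values at the midpoints of the edges: at the midpoint $\boldsymbol m$ of an interior edge shared by $\tau$ and $\tau'$, $$G_h\boldsymbol q_h(\boldsymbol m)=\tfrac12\bigl(\boldsymbol q_h|_\tau(\boldsymbol m)+\boldsymbol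 q_h|_{\tau'}(\boldsymbol m)\bigr);$$ at the midpoint $\boldsymbol m$ of a boundary edge $e$ of an element $\tau$, $$G_h\boldsymbol q_h(\boldsymbol m)=2\,G_h\boldsymbol q_h(\boldsymbol m')-G_h\boldsymbol q_h(\boldsymbol m''),$$ where $\boldsymbol m',\boldsymbol m''$ are the midpoints of $e',e''$, $e'$ is an edge that $\tau$ shares with an element $\tau'$, and $e''$ is the edge of $\tau'$ that does not meet $e$; it is assumed that for every boundary edge the element $\tau'$ can be, and has been, chosen such that $e''$ is an interior edge. Then, for every such choice and every $\boldsymbol q\in H^2(\Omega)^2\cap W^{1,\infty}(\Omega)^2$, $$\|\boldsymbol q-G_h\Pi_h\boldsymbol q\|_{0,\Omega}\le C\,h^{1+\rho}\left(\|\nabla\boldsymbol q\|_{1,\Omega}+|\boldsymbol q|_{1,\infty,\Omega}\right).$$ -/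

import Mathlib

open MeasureTheory Set
open scoped ENNReal ContDiff

namespace RTRecovery

noncomputable section

/-- The plane with its Euclidean norm. -/
abbrev Plane := EuclideanSpace ℝ (Fin 2)

/-! ### Sobolev regularity on a planar open set -/

/-- `g` is the weak partial derivative of `f` on the open set `Ω` in the `j`-th coordinate. -/
def IsWeakPartial (Ω : Set Plane) (j : Fin 2) (f g : Plane → ℝ) : Prop :=
  LocallyIntegrableOn f Ω volume ∧ LocallyIntegrableOn g Ω volume ∧
    ∀ φ : Plane → ℝ, ContDiff ℝ ∞ φ → HasCompactSupport φ → tsupport φ ⊆ Ω →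
      ∫ x in Ω, f x * fderiv ℝ φ x (EuclideanSpace.single j 1) = - ∫ x in Ω, g x * φ x

/-- `q` belongs to `H²(Ω)² ∩ W^{1,∞}(Ω)²`, with weak first derivatives `D i j = ∂ⱼ qᵢ` and weak
second derivatives `H i j k = ∂ₖ ∂ⱼ qᵢ`. -/
structure IsH2W1Infty (Ω : Set Plane) (q : Plane → Plane) (D : Fin 2 → Fin 2 → Plane → ℝ)
    (H : Fin 2 → Fin 2 → Fin 2 → Plane → ℝ) : Prop where
  weak_first : ∀ i j, IsWeakPartial Ω j (fun x => q x i) (D i j)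
  weak_second : ∀ i j k, IsWeakPartial Ω k (D i j) (H i j k)
  memLp_two : ∀ i, MemLp (fun x => q x i) 2 (volume.restrict Ω)
  memLp_top : ∀ i, MemLp (fun x => q x i) ⊤ (volume.restrict Ω)
  first_memLp_two : ∀ i j, MemLp (D i j) 2 (volume.restrict Ω)
  first_memLp_top : ∀ i j, MemLp (D i j) ⊤ (volume.restrict Ω)
  second_memLp_two : ∀ i j k, MemLp (H i j k) 2 (volume.restrict Ω)

/-- `‖∇q‖_{1,Ω}`, written with the first and second derivatives of `q`. -/
def gradH1Norm (Ω : Set Plane) (D : Fin 2 → Fin 2 → Plane → ℝ)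
    (H : Fin 2 → Fin 2 → Fin 2 → Plane → ℝ) : ℝ :=
  Real.sqrt ((∑ i, ∑ j, ∫ x in Ω, (D i j x) ^ 2) + ∑ i, ∑ j, ∑ k, ∫ x in Ω, (H i j k x) ^ 2)

/-- `|q|_{1,∞,Ω}`: the largest essential supremum of a first derivative. -/
def gradSupNorm (Ω : Set Plane) (D : Fin 2 → Fin 2 → Plane → ℝ) : ℝ :=
  (⨆ i, ⨆ j, eLpNorm (D i j) ⊤ (volume.restrict Ω)).toReal

/-! ### Triangulations -/

/-- A (conforming, finite) triangulation of `Ω`: a finite simplicial complex all of whose faces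
are faces of triangles and whose triangles cover the closure of `Ω`. Triangles and edges are
represented by their sets of vertices. -/
structure Triangulation (Ω : Set Plane) extends Geometry.SimplicialComplex ℝ Plane where
  finite_faces : faces.Finite
  pure : ∀ s ∈ faces, ∃ t ∈ faces, s ⊆ t ∧ t.card = 3
  cover : toSimplicialComplex.space = closure Ω

/-- The closed triangle (or edge) with the given vertices. -/
def hull (s : Finset Plane) : Set Plane := convexHull ℝ (s : Set Plane)

/-- The area of a triangle. -/
def area (t : Finset Plane) : ℝ := volume.real (hull t)

/-- The elements of a triangulation. -/
def Triangulation.elems {Ω : Set Plane} (T : Triangulation Ω) : Finset (Finset Plane) :=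
  T.finite_faces.toFinset.filter (fun t => t.card = 3)

open Classical in
/-- The elements which have the edge `e` as an edge. -/
def Triangulation.star {Ω : Set Plane} (T : Triangulation Ω) (e : Finset Plane) :
    Finset (Finset Plane) :=
  T.elems.filter (fun t => e ⊆ t)

/-- Interior edges: the edges shared by two elements. -/
def Triangulation.IsInteriorEdge {Ω : Set Plane} (T : Triangulation Ω) (e : Finset Plane) : Prop :=
  e.card = 2 ∧ (T.star e).card = 2

/-- Boundary edges: the edges that belong to one element only. -/
def Triangulation.IsBoundaryEdge {Ω : Set Plane} (T : Triangulation Ω) (e : Finset Plane) : Prop :=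
  e.card = 2 ∧ (T.star e).card = 1

/-- Boundary vertices: the end points of boundary edges. -/
def Triangulation.IsBoundaryVertex {Ω : Set Plane} (T : Triangulation Ω) (x : Plane) : Prop :=
  ∃ e, T.IsBoundaryEdge e ∧ x ∈ e

/-- `h` is the mesh size: the largest diameter of an element. -/
def Triangulation.IsMeshSize {Ω : Set Plane} (T : Triangulation Ω) (h : ℝ) : Prop :=
  IsGreatest ((fun t => Metric.diam (hull t)) '' (T.elems : Set (Finset Plane))) h

/-- Shape regularity: every element contains a disc whose radius is at least `1 / γ` times the
diameter of the element. -/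
def Triangulation.ShapeRegular {Ω : Set Plane} (T : Triangulation Ω) (γ : ℝ) : Prop :=
  ∀ t ∈ T.elems, ∃ x : Plane, Metric.closedBall x (Metric.diam (hull t) / γ) ⊆ hull t

/-! ### The `(α, σ)`-condition -/

/-- `h ^ s` for an exponent `s ∈ [0, ∞]`, with `h ^ ∞ = 0` (used for `0 < h < 1`). -/
def hpow (h : ℝ) (s : ℝ≥0∞) : ℝ := if s = ⊤ then 0 else h ^ s.toReal

open Classical in
/-- The two elements sharing the interior edge `e` form an approximate parallelogram: the lengths of
opposite sides of their union differ by at most `δ`. -/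
def Triangulation.ApproxParallelogram {Ω : Set Plane} (T : Triangulation Ω) (δ : ℝ)
    (e : Finset Plane) : Prop :=
  ∀ a b c d : Plane, e = {a, b} → c ≠ d → {a, b, c} ∈ T.elems → {a, b, d} ∈ T.elems →
    |dist a c - dist b d| ≤ δ ∧ |dist b c - dist a d| ≤ δ

/-- The points `a, b, c` are the vertices of a triangle in counterclockwise order. -/
def Ccw (a b c : Plane) : Prop :=
  0 < (b 0 - a 0) * (c 1 - a 1) - (b 1 - a 1) * (c 0 - a 0)

/-- The unit vector pointing from `a` to `b`. -/
def unitTangent (a b : Plane) : Plane := (dist a b)⁻¹ • (b - a)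

open Classical in
/-- The two boundary elements `{a, b, c}` and `{a', b', c'}` whose boundary edges `{a, b}` and
`{a', b'}` meet at the boundary vertex `x` form an approximate parallelogram: going around both
elements counterclockwise from these edges, the lengths of corresponding edges differ by at
most `δ`, and the counterclockwise unit tangents of the two boundary edges differ by at
most `ε`. -/
def Triangulation.BoundaryApproxParallelogram {Ω : Set Plane} (T : Triangulation Ω) (δ ε : ℝ)
    (x : Plane) : Prop :=
  ∀ a b c a' b' c' : Plane, {a, b, c} ∈ T.elems → {a', b', c'} ∈ T.elems →
    Ccw a b c → Ccw a' b' c' →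
    T.IsBoundaryEdge {a, b} → T.IsBoundaryEdge {a', b'} →
    ({a, b} : Finset Plane) ≠ {a', b'} →
    x ∈ ({a, b} : Finset Plane) → x ∈ ({a', b'} : Finset Plane) →
    |dist a b - dist a' b'| ≤ δ ∧ |dist b c - dist b' c'| ≤ δ ∧ |dist c a - dist c' a'| ≤ δ ∧
      ‖unitTangent a b - unitTangent a' b'‖ ≤ ε

/-- The `(α, σ)`-condition at mesh size `h`, with implied constant `M` and with at most `κ`
exceptional boundary vertices. `E₂` is the set of exceptional interior edges and `P₂` that of
exceptional boundary vertices. -/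
def Triangulation.AlphaSigma {Ω : Set Plane} (T : Triangulation Ω) (h : ℝ) (α σ : ℝ≥0∞)
    (M : ℝ) (κ : ℕ) : Prop :=
  (∃ E₂ : Finset (Finset Plane), (∀ e ∈ E₂, T.IsInteriorEdge e) ∧
    (∀ e, T.IsInteriorEdge e → e ∉ E₂ → T.ApproxParallelogram (M * hpow h (1 + α)) e) ∧
    ∑ e ∈ E₂, ∑ t ∈ T.star e, area t ≤ M * hpow h σ) ∧
  (∃ P₂ : Finset Plane, (∀ x ∈ P₂, T.IsBoundaryVertex x) ∧ P₂.card ≤ κ ∧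
    ∀ x, T.IsBoundaryVertex x → x ∉ P₂ →
      T.BoundaryApproxParallelogram (M * hpow h (1 + α)) (M * hpow h α) x)

/-! ### The lowest order Raviart–Thomas interpolant -/

/-- The local space `{a + c x}`. -/
def RT0 : Set (Plane → Plane) := {r | ∃ (a : Plane) (c : ℝ), ∀ x, r x = a + c • x}

/-- The flux `∫ v · n` through the segment from `a` to `b`, where `n` is the unit normal pointing to
the right of the direction of travel. For an edge of a triangle traversed counterclockwise, `n` is
the outward normal. -/
def edgeFlux (v : Plane → Plane) (a b : Plane) : ℝ :=
  ∫ s in (0 : ℝ)..1, (v (AffineMap.lineMap a b s) 0 * (b 1 - a 1)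
    - v (AffineMap.lineMap a b s) 1 * (b 0 - a 0))

open Classical in
/-- The continuous representative of `q` on the closed set `S` (if there is none: `q`). It provides
the trace on the edges of the closed triangle `S` of a function given up to null sets. -/
def contRep (S : Set Plane) (q : Plane → Plane) : Plane → Plane :=
  if hq : ∃ g : Plane → Plane, ContinuousOn g S ∧ g =ᵐ[volume.restrict S] q then hq.choose else q

/-- The Raviart–Thomas interpolant `Π_h q`, given by its restrictions to the elements `t`: the
element of `RT0` which has the same normal fluxes through the edges of `t` as `q`. (Reversing an
edge changes the sign of both fluxes.) -/
def rtInterp (q : Plane → Plane) (t : Finset Plane) : Plane → Plane :=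
  Classical.epsilon fun r : Plane → Plane =>
    r ∈ RT0 ∧ ∀ a ∈ t, ∀ b ∈ t, edgeFlux r a b = edgeFlux (contRep (hull t) q) a b

/-! ### The recovery operator -/

open Classical in
/-- The choice made at the boundary in the definition of the recovery operator. For every boundary
edge `e` of an element `τ`, `ext e = (e', e'')` where `e'` is an edge that `τ` shares with another
element `τ'`, and `e''` is the edge of `τ'` that does not meet `e`; this edge is shared by `τ'` and
a further element. -/
def Triangulation.IsBoundaryChoice {Ω : Set Plane} (T : Triangulation Ω)
    (ext : Finset Plane → Finset Plane × Finset Plane) : Prop :=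
  ∀ e, T.IsBoundaryEdge e → ∃ a b c d : Plane, e = {a, b} ∧ d ≠ a ∧
    {a, b, c} ∈ T.elems ∧ {b, c, d} ∈ T.elems ∧ T.IsInteriorEdge {c, d} ∧
    ext e = ({b, c}, {c, d})

/-- The midpoint of an edge. -/
def edgeMid (e : Finset Plane) : Plane := (1 / 2 : ℝ) • ∑ v ∈ e, v

/-- The mean of the two values at the midpoint of an interior edge of a piecewise function, given
by its restrictions `p t` to the elements `t`. -/
def Triangulation.avg {Ω : Set Plane} (T : Triangulation Ω) (p : Finset Plane → Plane → Plane)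
    (e : Finset Plane) : Plane :=
  (1 / 2 : ℝ) • ∑ t ∈ T.star e, p t (edgeMid e)

open Classical in
/-- The value of the recovered function at the midpoint of an edge: the mean on interior edges, and
a linear extrapolation of the recovered values at two interior edges on boundary edges. -/
def Triangulation.recoveredValue {Ω : Set Plane} (T : Triangulation Ω)
    (ext : Finset Plane → Finset Plane × Finset Plane) (p : Finset Plane → Plane → Plane)
    (e : Finset Plane) : Plane :=
  if T.IsInteriorEdge e then T.avg p e
  else (2 : ℝ) • T.avg p (ext e).1 - T.avg p (ext e).2

/-- The restriction of the recovered function to the element `t`: the vector valued affine function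
with the recovered values at the three midpoints of the edges of `t`. -/
def Triangulation.recoverOn {Ω : Set Plane} (T : Triangulation Ω)
    (ext : Finset Plane → Finset Plane × Finset Plane) (p : Finset Plane → Plane → Plane)
    (t : Finset Plane) : Plane →ᵃ[ℝ] Plane :=
  Classical.epsilon fun g : Plane →ᵃ[ℝ] Plane =>
    ∀ e ⊆ t, e.card = 2 → g (edgeMid e) = T.recoveredValue ext p e

open Classical in
/-- The recovery operator `G_h`: the piecewise affine function on `Ω` (set to zero on the null set of
points in no open element). -/
def Triangulation.recover {Ω : Set Plane} (T : Triangulation Ω)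
    (ext : Finset Plane → Finset Plane × Finset Plane) (p : Finset Plane → Plane → Plane)
    (x : Plane) : Plane :=
  if hx : ∃ t ∈ T.elems, x ∈ interior (hull t) then T.recoverOn ext p hx.choose x else 0

/-- `ρ = min (1, α, σ / 2)`. -/
def rho (α σ : ℝ≥0∞) : ℝ := (min 1 (min α (σ / 2))).toReal

end

end RTRecovery

/-! Everything happens on a patch: two elements `abc`, `abd` sharing an interior edge `ab`, of
length `ℓ`. Write `L` for the bound on the first derivatives of `q`.

Approximation. In the plane `H²` controls the sup norm. In scaled form there is an affine field `P`
on the patch with `sup |q - P| ≤ C ℓ ‖D²q‖`, the `L²` norm being over the patch, whose gradient has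
entries bounded by `L` (`IsPatch.exists_affine_approx_contRep`). `P` is a limit point of Taylor
polynomials of mollifications of `q`, averaged over a small copy of `abc`. The union of the two
triangles need not be convex, but it is star-shaped with respect to that copy
(`IsPatch.star_shaped`), and this is all that averaging needs.

Cancellation. At the midpoint `m` of `ab` the Raviart–Thomas interpolant of an affine field has the
exact normal component, so its error is a multiple of `b - a` (`rtField_affField_mid`). The multiple
is a quotient `N / J`, where `N` is even in `c - m` and `J` is twice the signed area. In a
parallelogram `d - m = -(c - m)`, so `N` is the same on both sides while `J` changes sign, and the
mean of the two interpolants is exact. In general its error is at most `C L Δ`, with `Δ` a bound for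
the coordinates of `c + d - a - b` (`IsPatch.abs_mean_sub_le`). Almost equal opposite sides make `Δ`
of the order of their difference (`IsPatch.abs_diag_le`); otherwise `Δ` is of order `ℓ`.

Boundary. If the element `abc` has boundary edge `ab` and neighbour `bcd`, then `2 m_bc - m_cd -
m_ab = (b + c - a - d) / 2`. Extrapolating an affine field therefore costs again `L Δ`, for the
interior edge `bc` (`Triangulation.abs_recoveredValue_sub_le`). As an affine function is controlled
by its values at the midpoints, the error on each element is bounded in the sup norm by a sum of `X
e = ℓ_e ‖D²q‖ + L Δ_e` over a bounded number of nearby interior edges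
(`Triangulation.ae_abs_sub_recover_le`).

Summation. Shape regularity gives finite overlap and comparable areas, so the squared `L²` error is
at most a constant times `h⁴ ‖D²q‖² + L² (h^(2+2α) |Ω| + h² h^σ)`. The last two terms come from the
good edges and from the exceptional edges, whose patches have total area of order `h^σ`. Each power
is at most `h^(2(1+ρ))`. -/

namespace RTRecovery

noncomputable section

open Metric Filter Topology
open scoped Convolution

/-! ### Mollification -/

/-- The mollification of `G` with the normalised bump function `φ`. -/
def mol (φ : ContDiffBump (0 : Plane)) (G : Plane → ℝ) (z : Plane) : ℝ :=
  ∫ w, φ.normed volume (z - w) * G w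

lemma mol_eq_convolution (φ : ContDiffBump (0 : Plane)) (G : Plane → ℝ) :
    mol φ G = (φ.normed volume ⋆[ContinuousLinearMap.lsmul ℝ ℝ, volume] G) := by
  funext z
  rw [convolution_eq_swap]
  rfl

lemma contDiff_mol (φ : ContDiffBump (0 : Plane)) {G : Plane → ℝ}
    (hG : LocallyIntegrable G volume) : ContDiff ℝ ∞ (mol φ G) := by
  rw [mol_eq_convolution]
  exact φ.hasCompactSupport_normed.contDiff_convolution_left _ φ.contDiff_normed hG

lemma fderiv_mol (φ : ContDiffBump (0 : Plane)) {G : Plane → ℝ}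
    (hG : LocallyIntegrable G volume) (z e : Plane) :
    fderiv ℝ (mol φ G) z e = ∫ w, fderiv ℝ (φ.normed volume) (z - w) e * G w := by
  have h1 : ContDiff ℝ 1 (φ.normed (volume : Measure Plane)) := φ.contDiff_normed
  have h := φ.hasCompactSupport_normed.hasFDerivAt_convolution_left
    (ContinuousLinearMap.lsmul ℝ ℝ) h1 hG z
  rw [mol_eq_convolution, h.fderiv, convolution_eq_swap, ContinuousLinearMap.integral_apply]
  · rfl
  · have := (φ.hasCompactSupport_normed.fderiv ℝ).convolutionExists_left
      ((ContinuousLinearMap.lsmul ℝ ℝ).precompL Plane) (h1.continuous_fderiv (by simp)) hG z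
    exact this.integrable_swap

lemma integral_mul_indicator {Ω : Set Plane} (hΩ : MeasurableSet Ω) (K f : Plane → ℝ) :
    ∫ w, K w * Ω.indicator f w = ∫ w in Ω, K w * f w := by
  rw [← integral_indicator hΩ]
  congr 1
  funext w
  by_cases hw : w ∈ Ω <;> simp [hw]

/-- The translated kernel `w ↦ φ (z - w)` is an admissible test function because its support lies in
`Ω`. The sign in the definition of the weak derivative cancels the one from differentiating in `w`
instead of `z`. -/
lemma fderiv_mol_of_isWeakPartial (φ : ContDiffBump (0 : Plane)) {Ω : Set Plane}
    (hΩ : MeasurableSet Ω) {j : Fin 2} {f g : Plane → ℝ} (h : IsWeakPartial Ω j f g)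
    (hf : LocallyIntegrable (Ω.indicator f) volume) {z : Plane}
    (hz : closedBall z φ.rOut ⊆ Ω) :
    fderiv ℝ (mol φ (Ω.indicator f)) z (EuclideanSpace.single j 1) =
      mol φ (Ω.indicator g) z := by
  have h1 : ContDiff ℝ ∞ (φ.normed (volume : Measure Plane)) := φ.contDiff_normed
  set ψ : Plane → ℝ := fun w => φ.normed volume (z - w) with hψ
  have hψs : tsupport ψ ⊆ closedBall z φ.rOut := by
    apply closure_minimal _ isClosed_closedBall
    intro w hw
    have : z - w ∈ Function.support (φ.normed (volume : Measure Plane)) := hw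
    rw [φ.support_normed_eq] at this
    rw [mem_closedBall, dist_comm, dist_eq_norm]
    simpa using (mem_ball_zero_iff.1 this).le
  have hψc : HasCompactSupport ψ :=
    (isCompact_closedBall z φ.rOut).of_isClosed_subset (isClosed_tsupport _) hψs
  have hψd : ContDiff ℝ ∞ ψ := h1.comp (contDiff_const.sub contDiff_id)
  have hder : ∀ w e, fderiv ℝ ψ w e = - fderiv ℝ (φ.normed (volume : Measure Plane)) (z - w) e := by
    intro w e
    have h2 : HasFDerivAt (φ.normed (volume : Measure Plane))
        (fderiv ℝ (φ.normed (volume : Measure Plane)) (z - w)) (z - w) :=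
      ((h1.differentiable (by simp)) _).hasFDerivAt
    have h3 : HasFDerivAt (fun w : Plane => z - w) (-ContinuousLinearMap.id ℝ Plane) w :=
      (hasFDerivAt_id w).const_sub z
    have := (h2.comp w h3).fderiv
    rw [hψ]
    change (fderiv ℝ ((φ.normed volume) ∘ fun w => z - w) w) e = _
    rw [this]
    simp
  have key := h.2.2 ψ hψd hψc (hψs.trans hz)
  rw [fderiv_mol φ hf, mol, integral_mul_indicator hΩ, integral_mul_indicator hΩ]
  simp only [hder, mul_neg, integral_neg, neg_inj] at key
  simp only [mul_comm _ (f _), mul_comm _ (g _)]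
  exact key

lemma normed_sub_nonneg (φ : ContDiffBump (0 : Plane)) (z w : Plane) :
    0 ≤ φ.normed volume (z - w) := φ.nonneg_normed _

lemma integral_normed_sub (φ : ContDiffBump (0 : Plane)) (z : Plane) :
    ∫ w, φ.normed (volume : Measure Plane) (z - w) = 1 := by
  rw [integral_sub_left_eq_self (fun w => φ.normed (volume : Measure Plane) w) volume z]
  exact φ.integral_normed

lemma continuous_normed_sub (φ : ContDiffBump (0 : Plane)) (z : Plane) :
    Continuous fun w => φ.normed (volume : Measure Plane) (z - w) :=
  φ.continuous_normed.comp (by fun_prop)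

lemma hasCompactSupport_normed_sub (φ : ContDiffBump (0 : Plane)) (z : Plane) :
    HasCompactSupport fun w => φ.normed (volume : Measure Plane) (z - w) :=
  φ.hasCompactSupport_normed.comp_homeomorph (Homeomorph.subLeft z)

lemma integrable_normed_sub (φ : ContDiffBump (0 : Plane)) (z : Plane) :
    Integrable fun w => φ.normed (volume : Measure Plane) (z - w) :=
  (continuous_normed_sub φ z).integrable_of_hasCompactSupport (hasCompactSupport_normed_sub φ z)

lemma normed_sub_eq_zero (φ : ContDiffBump (0 : Plane)) {z w : Plane}
    (h : w ∉ ball z φ.rOut) : φ.normed (volume : Measure Plane) (z - w) = 0 := by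
  by_contra hne
  have : z - w ∈ Function.support (φ.normed (volume : Measure Plane)) := hne
  rw [φ.support_normed_eq, mem_ball_zero_iff] at this
  exact h (by rwa [mem_ball, dist_comm, dist_eq_norm])

lemma integrable_normed_sub_mul (φ : ContDiffBump (0 : Plane)) {G : Plane → ℝ}
    (hG : LocallyIntegrable G volume) (z : Plane) :
    Integrable fun w => φ.normed (volume : Measure Plane) (z - w) * G w :=
  hG.integrable_smul_left_of_hasCompactSupport (continuous_normed_sub φ z)
    (hasCompactSupport_normed_sub φ z)

/-- A mollification is close to a number to which the function is close. -/
lemma abs_mol_sub_le (φ : ContDiffBump (0 : Plane)) {G : Plane → ℝ}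
    (hG : LocallyIntegrable G volume) {z : Plane} {r ε : ℝ}
    (h : ∀ᵐ w, w ∈ ball z φ.rOut → |G w - r| ≤ ε) : |mol φ G z - r| ≤ ε := by
  have h1 : mol φ G z - r = ∫ w, φ.normed volume (z - w) * (G w - r) := by
    simp only [mul_sub]
    rw [integral_sub (integrable_normed_sub_mul φ hG z) ((integrable_normed_sub φ z).mul_const r),
      integral_mul_const, integral_normed_sub, one_mul]
    rfl
  have h2 : ε = ∫ w, φ.normed volume (z - w) * ε := by
    rw [integral_mul_const, integral_normed_sub, one_mul]
  rw [h1, ← Real.norm_eq_abs]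
  conv_rhs => rw [h2]
  apply norm_integral_le_of_norm_le ((integrable_normed_sub φ z).mul_const ε)
  filter_upwards [h] with w hw
  rw [norm_mul, Real.norm_of_nonneg (normed_sub_nonneg φ z w), Real.norm_eq_abs]
  by_cases hm : w ∈ ball z φ.rOut
  · exact mul_le_mul_of_nonneg_left (hw hm) (normed_sub_nonneg φ z w)
  · simp [normed_sub_eq_zero φ hm]

/-- Jensen's inequality for squares: the kernel is the density of a probability measure, and
Cauchy–Schwarz against the constant `1` is applied in that measure. -/
lemma enorm_mol_sq_le (φ : ContDiffBump (0 : Plane)) {G : Plane → ℝ}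
    (hG : AEMeasurable G volume) (z : Plane) :
    ‖mol φ G z‖ₑ ^ 2 ≤
      ∫⁻ w, ENNReal.ofReal (φ.normed volume (z - w)) * ‖G w‖ₑ ^ 2 := by
  set K : Plane → ℝ≥0∞ := fun w => ENNReal.ofReal (φ.normed volume (z - w)) with hK
  have hKm : Measurable K := (continuous_normed_sub φ z).measurable.ennreal_ofReal
  have hK1 : ∫⁻ w, K w = 1 := by
    rw [hK, ← ofReal_integral_eq_lintegral_ofReal (integrable_normed_sub φ z)
      (Eventually.of_forall (normed_sub_nonneg φ z)), integral_normed_sub, ENNReal.ofReal_one]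
  have h0 : ‖mol φ G z‖ₑ ≤ ∫⁻ w, ‖G w‖ₑ ∂(volume.withDensity K) := by
    refine (enorm_integral_le_lintegral_enorm _).trans_eq ?_
    rw [lintegral_withDensity_eq_lintegral_mul₀ hKm.aemeasurable hG.enorm]
    refine lintegral_congr fun w => ?_
    rw [enorm_mul, Real.enorm_of_nonneg (normed_sub_nonneg φ z w)]
    rfl
  have hG' : AEMeasurable (fun w => ‖G w‖ₑ) (volume.withDensity K) :=
    hG.enorm.mono_ac (withDensity_absolutelyContinuous _ _)
  have h1 := ENNReal.lintegral_mul_le_Lp_mul_Lq (volume.withDensity K)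
    (Real.HolderConjugate.two_two) hG' (aemeasurable_const (b := (1 : ℝ≥0∞)))
  simp only [Pi.mul_apply, mul_one, ENNReal.one_rpow, lintegral_const,
    withDensity_apply _ MeasurableSet.univ, Measure.restrict_univ, hK1] at h1
  calc ‖mol φ G z‖ₑ ^ 2 ≤ (((∫⁻ w, ‖G w‖ₑ ^ (2 : ℝ) ∂(volume.withDensity K)) ^ (1 / 2 : ℝ))) ^ 2 := by
        gcongr
        exact h0.trans h1
    _ = ∫⁻ w, ‖G w‖ₑ ^ (2 : ℝ) ∂(volume.withDensity K) := by
        rw [← ENNReal.rpow_natCast, ← ENNReal.rpow_mul]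
        norm_num
    _ = _ := by
        rw [lintegral_withDensity_eq_lintegral_mul₀ hKm.aemeasurable (hG.enorm.pow_const _)]
        refine lintegral_congr fun w => ?_
        simp [hK]

/-- Mollification does not increase the norm in `L²`, locally. -/
lemma lintegral_mol_sq_le (φ : ContDiffBump (0 : Plane)) {G : Plane → ℝ}
    (hG : AEMeasurable G volume) {A A' : Set Plane} (hA : MeasurableSet A)
    (hA' : MeasurableSet A') (hAA : ∀ z ∈ A, ball z φ.rOut ⊆ A') :
    ∫⁻ z in A, ‖mol φ G z‖ₑ ^ 2 ≤ ∫⁻ w in A', ‖G w‖ₑ ^ 2 := by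
  have hm : AEMeasurable (Function.uncurry fun (z w : Plane) =>
      ENNReal.ofReal (φ.normed volume (z - w)) * ‖G w‖ₑ ^ 2)
      ((volume.restrict A).prod (volume.restrict A')) := by
    have h1 : Continuous fun p : Plane × Plane => φ.normed volume (p.1 - p.2) :=
      φ.continuous_normed.comp (continuous_fst.sub continuous_snd)
    have h2 : AEMeasurable (fun p : Plane × Plane => ‖G p.2‖ₑ ^ 2)
        ((volume.restrict A).prod (volume.restrict A')) :=
      ((hG.restrict (s := A')).enorm.pow_const 2).comp_quasiMeasurePreserving
        Measure.quasiMeasurePreserving_snd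
    exact h1.measurable.ennreal_ofReal.aemeasurable.mul h2
  calc ∫⁻ z in A, ‖mol φ G z‖ₑ ^ 2
      ≤ ∫⁻ z in A, ∫⁻ w in A', ENNReal.ofReal (φ.normed volume (z - w)) * ‖G w‖ₑ ^ 2 := by
        refine setLIntegral_mono' hA fun z hz => (enorm_mol_sq_le φ hG z).trans_eq ?_
        rw [← lintegral_indicator hA']
        refine lintegral_congr fun w => ?_
        by_cases hw : w ∈ A'
        · simp [hw]
        · simp [hw, normed_sub_eq_zero φ fun h => hw (hAA z hz h)]
    _ = ∫⁻ w in A', ∫⁻ z in A, ENNReal.ofReal (φ.normed volume (z - w)) * ‖G w‖ₑ ^ 2 :=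
        lintegral_lintegral_swap hm
    _ ≤ ∫⁻ w in A', ‖G w‖ₑ ^ 2 := by
        refine lintegral_mono fun w => ?_
        rw [lintegral_mul_const' _ _ (by finiteness)]
        have : ∫⁻ z in A, ENNReal.ofReal (φ.normed volume (z - w)) ≤ 1 := by
          refine (setLIntegral_le_lintegral _ _).trans ?_
          rw [lintegral_sub_right_eq_self (fun z => ENNReal.ofReal (φ.normed volume z)) w,
            ← ofReal_integral_eq_lintegral_ofReal φ.integrable_normed
            (Eventually.of_forall φ.nonneg_normed), φ.integral_normed, ENNReal.ofReal_one]
        calc _ ≤ 1 * ‖G w‖ₑ ^ 2 := by gcongr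
          _ = _ := one_mul _

/-- The second derivatives of a mollification are the mollifications of the weak ones. -/
lemma fderiv_fderiv_mol (φ : ContDiffBump (0 : Plane)) {Ω : Set Plane}
    (hΩ : IsOpen Ω) {j k : Fin 2} {f g r : Plane → ℝ} (h : IsWeakPartial Ω j f g)
    (h' : IsWeakPartial Ω k g r)
    (hf : LocallyIntegrable (Ω.indicator f) volume) (hg : LocallyIntegrable (Ω.indicator g) volume)
    {z : Plane} {ε : ℝ} (hε : φ.rOut < ε) (hz : ball z ε ⊆ Ω) :
    fderiv ℝ (fun y => fderiv ℝ (mol φ (Ω.indicator f)) y (EuclideanSpace.single j 1)) z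
      (EuclideanSpace.single k 1) = mol φ (Ω.indicator r) z := by
  have hz' : closedBall z φ.rOut ⊆ Ω := (closedBall_subset_ball hε).trans hz
  rw [← fderiv_mol_of_isWeakPartial φ hΩ.measurableSet h' hg hz']
  congr 1
  -- A second differentiation needs the formula for the first derivative on a neighbourhood of `z`;
  -- the room between `φ.rOut` and `ε` provides it.
  apply Filter.EventuallyEq.fderiv_eq
  filter_upwards [ball_mem_nhds z (sub_pos.2 hε)] with y hy
  apply fderiv_mol_of_isWeakPartial φ hΩ.measurableSet h hf
  refine Subset.trans (fun w hw => ?_) hz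
  rw [mem_closedBall] at hw
  rw [mem_ball] at hy ⊢
  linarith [dist_triangle w y z]

/-! ### Taylor polynomials averaged over a set -/

/-- The partial derivative in the `j`-th coordinate. -/
def pd (j : Fin 2) (u : Plane → ℝ) (x : Plane) : ℝ := fderiv ℝ u x (EuclideanSpace.single j 1)

lemma contDiff_pd {u : Plane → ℝ} (hu : ContDiff ℝ ∞ u) (j : Fin 2) : ContDiff ℝ ∞ (pd j u) := by
  unfold pd
  exact (hu.fderiv_right (m := ∞) (by simp)).clm_apply contDiff_const

lemma fderiv_apply_eq_pd (u : Plane → ℝ) (x v : Plane) :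
    fderiv ℝ u x v = v 0 * pd 0 u x + v 1 * pd 1 u x := by
  have hv : v = v 0 • EuclideanSpace.single (0 : Fin 2) (1 : ℝ)
      + v 1 • EuclideanSpace.single (1 : Fin 2) (1 : ℝ) := by
    ext i; fin_cases i <;> simp
  conv_lhs => rw [hv]
  simp [pd]

lemma hasDerivAt_comp_line {u : Plane → ℝ} (hu : ContDiff ℝ ∞ u) (y v : Plane) (t : ℝ) :
    HasDerivAt (fun t : ℝ => u (y + t • v))
      (v 0 * pd 0 u (y + t • v) + v 1 * pd 1 u (y + t • v)) t := by
  have h1 : HasFDerivAt u (fderiv ℝ u (y + t • v)) (y + t • v) :=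
    ((hu.differentiable (by simp)) _).hasFDerivAt
  have h2 : HasDerivAt (fun t : ℝ => y + t • v) v t := by
    simpa using ((hasDerivAt_id t).smul_const v).const_add y
  rw [← fderiv_apply_eq_pd]
  exact h1.comp_hasDerivAt t h2

/-- The sum of the absolute values of the second derivatives. -/
def hessSum (u : Plane → ℝ) (x : Plane) : ℝ :=
  |pd 0 (pd 0 u) x| + |pd 1 (pd 0 u) x| + |pd 0 (pd 1 u) x| + |pd 1 (pd 1 u) x|

lemma continuous_hessSum {u : Plane → ℝ} (hu : ContDiff ℝ ∞ u) : Continuous (hessSum u) := by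
  have h := fun j k => (contDiff_pd (contDiff_pd hu j) k).continuous
  unfold hessSum
  exact (((h 0 0).abs.add (h 0 1).abs).add (h 1 0).abs).add (h 1 1).abs

lemma abs_apply_le_norm (v : Plane) (i : Fin 2) : |v i| ≤ ‖v‖ := by
  rw [← Real.norm_eq_abs]; exact PiLp.norm_apply_le v i

/-- Integral form of the remainder along the segment from `y` to `x`. The weight `1 - t` must be
kept: it later cancels the singular factor produced by averaging over `y`. -/
lemma taylor_remainder {u : Plane → ℝ} (hu : ContDiff ℝ ∞ u) (x y : Plane) {d : ℝ}
    (hd : dist x y ≤ d) :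
    ‖u x - (u y + ((x 0 - y 0) * pd 0 u y + (x 1 - y 1) * pd 1 u y))‖ₑ ≤
      ∫⁻ t in Ioo (0 : ℝ) 1, ENNReal.ofReal (d ^ 2 * (1 - t)) *
        ENNReal.ofReal (hessSum u (y + t • (x - y))) := by
  set v : Plane := x - y with hv
  have hd0 : 0 ≤ d := dist_nonneg.trans hd
  have hvd : ∀ i, |v i| ≤ d := fun i => (abs_apply_le_norm v i).trans (by rwa [hv, ← dist_eq_norm])
  -- `G t` is the value at `x` of the Taylor polynomial centred at `y + t • v`; it runs from the
  -- polynomial centred at `y` to `u x`, and its derivative contains second derivatives only.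
  set G : ℝ → ℝ := fun t => u (y + t • v) +
    (1 - t) * (v 0 * pd 0 u (y + t • v) + v 1 * pd 1 u (y + t • v)) with hG
  set G' : ℝ → ℝ := fun t => (1 - t) *
    (v 0 * (v 0 * pd 0 (pd 0 u) (y + t • v) + v 1 * pd 1 (pd 0 u) (y + t • v)) +
     v 1 * (v 0 * pd 0 (pd 1 u) (y + t • v) + v 1 * pd 1 (pd 1 u) (y + t • v))) with hG'
  have hder : ∀ t, HasDerivAt G (G' t) t := by
    intro t
    have h0 := hasDerivAt_comp_line hu y v t
    have h1 := hasDerivAt_comp_line (contDiff_pd hu 0) y v t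
    have h2 := hasDerivAt_comp_line (contDiff_pd hu 1) y v t
    have h3 : HasDerivAt (fun t : ℝ => 1 - t) (-1) t := by
      simpa using (hasDerivAt_id t).const_sub 1
    have := h0.add (h3.mul ((h1.const_mul (v 0)).add (h2.const_mul (v 1))))
    refine HasDerivAt.congr_deriv this ?_
    simp only [hG', Pi.add_apply]
    ring
  have hcont : Continuous G' := by
    have h := fun j k => (contDiff_pd (contDiff_pd hu j) k).continuous
    have hl : Continuous fun t : ℝ => y + t • v := by fun_prop
    have h' := fun j k => (h j k).comp hl
    exact (continuous_const.sub continuous_id).mul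
      ((continuous_const.mul ((continuous_const.mul (h' 0 0)).add (continuous_const.mul (h' 0 1)))).add
      (continuous_const.mul ((continuous_const.mul (h' 1 0)).add (continuous_const.mul (h' 1 1)))))
  have hint : ∫ t in (0 : ℝ)..1, G' t = G 1 - G 0 :=
    intervalIntegral.integral_eq_sub_of_hasDerivAt (fun t _ => hder t)
      (hcont.intervalIntegrable _ _)
  have hLHS : u x - (u y + ((x 0 - y 0) * pd 0 u y + (x 1 - y 1) * pd 1 u y)) =
      ∫ t in (0 : ℝ)..1, G' t := by
    rw [hint]
    simp [hG, hv]
  rw [hLHS, intervalIntegral.integral_of_le zero_le_one, integral_Ioc_eq_integral_Ioo]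
  refine (enorm_integral_le_lintegral_enorm _).trans ?_
  refine setLIntegral_mono' measurableSet_Ioo fun t ht => ?_
  rw [← ENNReal.ofReal_mul (by nlinarith [ht.2, sq_nonneg d]), Real.enorm_eq_ofReal_abs]
  apply ENNReal.ofReal_le_ofReal
  have h1t : 0 ≤ 1 - t := by linarith [ht.2]
  have hvv : ∀ i j, |v i * v j| ≤ d ^ 2 := fun i j => by
    rw [abs_mul, sq]; exact mul_le_mul (hvd i) (hvd j) (abs_nonneg _) hd0
  have key : ∀ (i j : Fin 2) (r : ℝ), |v i * (v j * r)| ≤ d ^ 2 * |r| := fun i j r => by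
    rw [← mul_assoc, abs_mul]; exact mul_le_mul_of_nonneg_right (hvv i j) (abs_nonneg _)
  rw [mul_comm (d ^ 2), mul_assoc]
  simp only [hG']
  rw [abs_mul, abs_of_nonneg h1t]
  refine mul_le_mul_of_nonneg_left ?_ h1t
  simp only [mul_add]
  refine (abs_add_le _ _).trans ((add_le_add (abs_add_le _ _) (abs_add_le _ _)).trans ?_)
  have := key 0 0 (pd 0 (pd 0 u) (y + t • v))
  have := key 0 1 (pd 1 (pd 0 u) (y + t • v))
  have := key 1 0 (pd 0 (pd 1 u) (y + t • v))
  have := key 1 1 (pd 1 (pd 1 u) (y + t • v))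
  unfold hessSum
  linarith

/-- The substitution is the homothety of ratio `s` about `x`, with Jacobian `s ^ 2` in the plane. -/
lemma lintegral_comp_homothety (g : Plane → ℝ≥0∞) (hg : Measurable g) (x : Plane) {s : ℝ}
    (hs : 0 < s) :
    ∫⁻ y, g (y + (1 - s) • (x - y)) = ENNReal.ofReal ((s ^ 2)⁻¹) * ∫⁻ y, g y := by
  have h1 : ∀ y : Plane, y + (1 - s) • (x - y) = s • y + (1 - s) • x := fun y => by
    module
  simp only [h1]
  have h2 : ∫⁻ y : Plane, g (s • y + (1 - s) • x) =
      ∫⁻ y, g (y + (1 - s) • x) ∂(Measure.map (fun y : Plane => s • y) volume) := by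
    have h4 : Measurable fun y : Plane => g (y + (1 - s) • x) :=
      hg.comp (measurable_id.add_const _)
    rw [lintegral_map h4 (measurable_const_smul s)]
  have h3 := Measure.map_addHaar_smul (volume : Measure Plane) hs.ne'
  rw [h2, h3, lintegral_smul_measure, lintegral_add_right_eq_self]
  simp [abs_of_pos hs]

lemma setLIntegral_le_sqrt (μ : Measure Plane) {g : Plane → ℝ≥0∞} (hg : AEMeasurable g μ)
    {K b : ℝ} (hK : 0 ≤ K) (hb : 0 ≤ b) (h1 : ∫⁻ y, g y ^ 2 ∂μ ≤ ENNReal.ofReal (K ^ 2))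
    (h2 : μ univ ≤ ENNReal.ofReal (b ^ 2)) : ∫⁻ y, g y ∂μ ≤ ENNReal.ofReal (K * b) := by
  have h := ENNReal.lintegral_mul_le_Lp_mul_Lq μ Real.HolderConjugate.two_two hg
    (aemeasurable_const (b := (1 : ℝ≥0∞)))
  simp only [Pi.mul_apply, mul_one, lintegral_const, one_mul, one_pow,
    ENNReal.rpow_ofNat] at h
  refine h.trans ?_
  rw [ENNReal.ofReal_mul hK]
  have hs : ∀ r : ℝ, 0 ≤ r → (ENNReal.ofReal (r ^ 2)) ^ (1 / 2 : ℝ) = ENNReal.ofReal r := by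
    intro r hr
    rw [ENNReal.ofReal_rpow_of_nonneg (by positivity) (by norm_num), ← Real.sqrt_eq_rpow,
      Real.sqrt_sq hr]
  rw [← hs K hK, ← hs b hb]
  gcongr

/-- The averaged Taylor polynomial of degree one approximates a smooth function uniformly on a set
which is star-shaped with respect to the set `B` over which the average is taken. -/
lemma exists_affine_approx {u : Plane → ℝ} (hu : ContDiff ℝ ∞ u) {S B : Set Plane}
    (hS : MeasurableSet S) (hB : MeasurableSet B) (hBS : B ⊆ S) (hBb : Bornology.IsBounded B)
    (hstar : ∀ x ∈ S, ∀ y ∈ B, ∀ t ∈ Icc (0 : ℝ) 1, y + t • (x - y) ∈ S) {d L E β : ℝ}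
    (hd : ∀ x ∈ S, ∀ y ∈ B, dist x y ≤ d) (hL : ∀ j, ∀ x ∈ S, |pd j u x| ≤ L)
    (hβ : 0 < β) (hBβ : volume.real B = β ^ 2) (hE0 : 0 ≤ E)
    (hE : ∫⁻ x in S, ENNReal.ofReal (hessSum u x) ^ 2 ≤ ENNReal.ofReal (E ^ 2)) :
    ∃ c l₀ l₁ : ℝ, |l₀| ≤ L ∧ |l₁| ≤ L ∧
      ∀ x ∈ S, |u x - (c + l₀ * x 0 + l₁ * x 1)| ≤ d ^ 2 * E / β := by
  have hBfin : volume B ≠ ⊤ := hBb.measure_lt_top.ne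
  have hBvol : volume B = ENNReal.ofReal (β ^ 2) := by
    rw [← hBβ, ofReal_measureReal hBfin]
  have hint : ∀ g : Plane → ℝ, Continuous g → IntegrableOn g B volume := fun g hg =>
    (hg.locallyIntegrable.integrableOn_isCompact
      hBb.isCompact_closure).mono_set subset_closure
  have hp : ∀ j, Continuous (pd j u) := fun j => (contDiff_pd hu j).continuous
  have hβ2 : 0 < β ^ 2 := by positivity
  have hlbound : ∀ j, |(β ^ 2)⁻¹ * ∫ y in B, pd j u y| ≤ L := by
    intro j
    have := norm_setIntegral_le_of_norm_le_const (μ := volume) (s := B) (f := pd j u) (C := L)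
      hBb.measure_lt_top (fun x hx => hL j x (hBS hx))
    rw [Real.norm_eq_abs, hBβ] at this
    rw [abs_mul, abs_of_pos (inv_pos.2 hβ2), inv_mul_le_iff₀ hβ2]
    linarith
  -- The coefficients of the mean over `y ∈ B` of the Taylor polynomials at `y`. The gradient is a
  -- mean of gradients, so it inherits the bound `L`.
  refine ⟨(β ^ 2)⁻¹ * ∫ y in B, (u y - y 0 * pd 0 u y - y 1 * pd 1 u y),
    (β ^ 2)⁻¹ * ∫ y in B, pd 0 u y, (β ^ 2)⁻¹ * ∫ y in B, pd 1 u y, hlbound 0, hlbound 1, ?_⟩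
  intro x hx
  have hc0 : Continuous fun y : Plane => y 0 := by fun_prop
  have hc1 : Continuous fun y : Plane => y 1 := by fun_prop
  set R : Plane → ℝ := fun y => u x - (u y + ((x 0 - y 0) * pd 0 u y + (x 1 - y 1) * pd 1 u y))
    with hR
  have hI : u x - ((β ^ 2)⁻¹ * (∫ y in B, (u y - y 0 * pd 0 u y - y 1 * pd 1 u y)) +
      (β ^ 2)⁻¹ * (∫ y in B, pd 0 u y) * x 0 + (β ^ 2)⁻¹ * (∫ y in B, pd 1 u y) * x 1) =
      (β ^ 2)⁻¹ * ∫ y in B, R y := by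
    have e1 : ∀ y, R y = u x - ((u y - y 0 * pd 0 u y - y 1 * pd 1 u y) + (pd 0 u y * x 0 +
        pd 1 u y * x 1)) := fun y => by simp only [hR]; ring
    have i1 : IntegrableOn (fun y => u y - y 0 * pd 0 u y - y 1 * pd 1 u y) B volume :=
      hint _ ((hu.continuous.sub (hc0.mul (hp 0))).sub (hc1.mul (hp 1)))
    have i2 : IntegrableOn (fun y => pd 0 u y * x 0) B volume :=
      hint _ ((hp 0).mul continuous_const)
    have i3 : IntegrableOn (fun y => pd 1 u y * x 1) B volume :=
      hint _ ((hp 1).mul continuous_const)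
    have i23 : IntegrableOn (fun y => pd 0 u y * x 0 + pd 1 u y * x 1) B volume := i2.add i3
    have i123 : IntegrableOn (fun y => (u y - y 0 * pd 0 u y - y 1 * pd 1 u y) +
        (pd 0 u y * x 0 + pd 1 u y * x 1)) B volume := i1.add i23
    simp only [e1]
    rw [integral_sub (hint _ continuous_const) i123, integral_add i1 i23, integral_add i2 i3,
      setIntegral_const, integral_mul_const, integral_mul_const, hBβ]
    simp only [smul_eq_mul]
    field_simp
    ring
  rw [hI, abs_mul, abs_of_pos (inv_pos.2 hβ2), inv_mul_le_iff₀ hβ2]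
  have hW := continuous_hessSum hu
  have hd0 : 0 ≤ d ^ 2 := sq_nonneg d
  have hmeas : Measurable fun p : Plane × ℝ =>
      ENNReal.ofReal (d ^ 2 * (1 - p.2)) * ENNReal.ofReal (hessSum u (p.1 + p.2 • (x - p.1))) := by
    have h1 : Continuous fun p : Plane × ℝ => p.1 + p.2 • (x - p.1) := by fun_prop
    have h2 : Continuous fun p : Plane × ℝ => d ^ 2 * (1 - p.2) := by fun_prop
    exact h2.measurable.ennreal_ofReal.mul (hW.comp h1).measurable.ennreal_ofReal
  have hmain : ∫⁻ y in B, ‖R y‖ₑ ≤ ENNReal.ofReal (d ^ 2 * (E * β)) := by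
    calc ∫⁻ y in B, ‖R y‖ₑ
        ≤ ∫⁻ y in B, ∫⁻ t in Ioo (0 : ℝ) 1, ENNReal.ofReal (d ^ 2 * (1 - t)) *
          ENNReal.ofReal (hessSum u (y + t • (x - y))) :=
          setLIntegral_mono' hB fun y hy => taylor_remainder hu x y (hd x hx y hy)
      _ = ∫⁻ t in Ioo (0 : ℝ) 1, ∫⁻ y in B, ENNReal.ofReal (d ^ 2 * (1 - t)) *
          ENNReal.ofReal (hessSum u (y + t • (x - y))) :=
          lintegral_lintegral_swap hmeas.aemeasurable
      _ ≤ ∫⁻ _ in Ioo (0 : ℝ) 1, ENNReal.ofReal (d ^ 2 * (E * β)) := by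
          refine setLIntegral_mono' measurableSet_Ioo fun t ht => ?_
          have ht1 : 0 < 1 - t := by linarith [ht.2]
          rw [lintegral_const_mul' _ _ ENNReal.ofReal_ne_top]
          -- For fixed `t`, Cauchy–Schwarz on `B` followed by the substitution `z = y + t (x - y)`,
          -- which stays in `S` by star-shapedness. The Jacobian `(1 - t) ^ 2` enters under a square
          -- root, so it costs only `(1 - t)⁻¹`, exactly the weight in the remainder. This is where
          -- dimension two is used.
          have hle : ∫⁻ y in B, ENNReal.ofReal (hessSum u (y + t • (x - y))) ≤
              ENNReal.ofReal ((1 - t)⁻¹ * E * β) := by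
            have hl : Continuous fun y : Plane => y + t • (x - y) := by fun_prop
            refine setLIntegral_le_sqrt _ (hW.comp hl).measurable.ennreal_ofReal.aemeasurable
              (by positivity) hβ.le ?_ (by simp [hBvol])
            set g : Plane → ℝ≥0∞ := S.indicator fun z => ENNReal.ofReal (hessSum u z) ^ 2 with hg
            have hgm : Measurable g := (hW.measurable.ennreal_ofReal.pow_const 2).indicator hS
            have hh := lintegral_comp_homothety g hgm x ht1
            rw [sub_sub_cancel, hg, lintegral_indicator hS] at hh
            calc _ ≤ ∫⁻ y in B, g (y + t • (x - y)) := by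
                  refine setLIntegral_mono' hB fun y hy => ?_
                  rw [hg, indicator_of_mem (hstar x hx y hy t ⟨ht.1.le, ht.2.le⟩)]
                  rfl
              _ ≤ ∫⁻ y, g (y + t • (x - y)) := setLIntegral_le_lintegral _ _
              _ ≤ ENNReal.ofReal (((1 - t) ^ 2)⁻¹) * ENNReal.ofReal (E ^ 2) := by
                  rw [hh]; gcongr
              _ = _ := by
                  rw [← ENNReal.ofReal_mul (by positivity)]
                  congr 1
                  rw [mul_pow, inv_pow]
          calc _ ≤ ENNReal.ofReal (d ^ 2 * (1 - t)) * ENNReal.ofReal ((1 - t)⁻¹ * E * β) := by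
                gcongr
            _ = _ := by
                rw [← ENNReal.ofReal_mul (by positivity)]
                congr 1
                field_simp
      _ = _ := by simp
  have hfin : |∫ y in B, R y| ≤ d ^ 2 * (E * β) := by
    have := (enorm_integral_le_lintegral_enorm (μ := volume.restrict B) R).trans hmain
    rw [Real.enorm_eq_ofReal_abs] at this
    exact (ENNReal.ofReal_le_ofReal_iff (by positivity)).1 this
  refine hfin.trans_eq ?_
  field_simp

/-! ### Functions with bounded first and square integrable second weak derivatives -/

/-- `f` has weak first derivatives `D j`, bounded by `L`, and weak second derivatives `H j k`, all
of them square integrable. -/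
structure IsScalarH2 (Ω : Set Plane) (f : Plane → ℝ) (D : Fin 2 → Plane → ℝ)
    (H : Fin 2 → Fin 2 → Plane → ℝ) (L : ℝ) : Prop where
  isOpen : IsOpen Ω
  nonneg : 0 ≤ L
  weak_first : ∀ j, IsWeakPartial Ω j f (D j)
  weak_second : ∀ j k, IsWeakPartial Ω k (D j) (H j k)
  memLp : MemLp f 2 (volume.restrict Ω)
  first_memLp : ∀ j, MemLp (D j) 2 (volume.restrict Ω)
  second_memLp : ∀ j k, MemLp (H j k) 2 (volume.restrict Ω)
  bound : ∀ j, ∀ᵐ x ∂(volume.restrict Ω), |D j x| ≤ L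

/-- A sequence of bump functions with shrinking supports. -/
def bump (n : ℕ) : ContDiffBump (0 : Plane) where
  -- The bounded ratio `rOut = 2 * rIn` is what makes the mollifications converge at almost every
  -- point.
  rIn := 1 / (2 * (n + 1))
  rOut := 1 / (n + 1)
  rIn_pos := by positivity
  rIn_lt_rOut := by
    apply one_div_lt_one_div_of_lt <;> nlinarith [(Nat.cast_nonneg n : (0 : ℝ) ≤ n)]

lemma tendsto_bump_rOut : Tendsto (fun n => (bump n).rOut) atTop (𝓝 0) :=
  tendsto_one_div_add_atTop_nhds_zero_nat

/-- The points of `Ω` at which the mollifications of `f` converge to `f`. -/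
def regPts (Ω : Set Plane) (f : Plane → ℝ) : Set Plane :=
  {x ∈ Ω | Tendsto (fun n => mol (bump n) (Ω.indicator f) x) atTop (𝓝 (f x))}

lemma locallyIntegrable_indicator {Ω : Set Plane} (hΩ : MeasurableSet Ω) {f : Plane → ℝ}
    (hf : MemLp f 2 (volume.restrict Ω)) : LocallyIntegrable (Ω.indicator f) volume :=
  ((memLp_indicator_iff_restrict hΩ).2 hf).locallyIntegrable one_le_two

lemma ae_mem_regPts {Ω : Set Plane} (hΩ : MeasurableSet Ω) {f : Plane → ℝ}
    (hf : MemLp f 2 (volume.restrict Ω)) : ∀ᵐ x, x ∈ Ω → x ∈ regPts Ω f := by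
  have h := ContDiffBump.ae_convolution_tendsto_right_of_locallyIntegrable (K := 2)
    tendsto_bump_rOut (Eventually.of_forall fun n => ?_) (locallyIntegrable_indicator hΩ hf)
  · filter_upwards [h] with x hx hxΩ
    refine ⟨hxΩ, ?_⟩
    simp only [mol_eq_convolution]
    simpa [hxΩ] using hx
  · simp only [bump]
    apply le_of_eq
    field_simp

/-- A property that holds almost everywhere holds somewhere on a nonempty open set. -/
lemma exists_mem_of_ae {P : Plane → Prop} (h : ∀ᵐ x, P x) {O : Set Plane} (hO : IsOpen O)
    (hne : O.Nonempty) : ∃ x ∈ O, P x := by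
  obtain ⟨x, hx, hP⟩ := (Measure.dense_of_ae h).inter_open_nonempty O hO hne
  exact ⟨x, hx, hP⟩

namespace IsScalarH2

variable {Ω : Set Plane} {f : Plane → ℝ} {D : Fin 2 → Plane → ℝ} {H : Fin 2 → Fin 2 → Plane → ℝ}
  {L : ℝ}

lemma abs_pd_mol_le (h : IsScalarH2 Ω f D H L) (φ : ContDiffBump (0 : Plane)) {z : Plane}
    (hz : closedBall z φ.rOut ⊆ Ω) (j : Fin 2) : |pd j (mol φ (Ω.indicator f)) z| ≤ L := by
  have hm := h.isOpen.measurableSet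
  rw [pd, fderiv_mol_of_isWeakPartial φ hm (h.weak_first j)
    (locallyIntegrable_indicator hm h.memLp) hz]
  have := abs_mol_sub_le φ (locallyIntegrable_indicator hm (h.first_memLp j)) (z := z) (r := 0)
    (ε := L) ?_
  · simpa using this
  · filter_upwards [(ae_restrict_iff' hm).1 (h.bound j)] with x hx _
    by_cases hxΩ : x ∈ Ω
    · simpa [hxΩ] using hx hxΩ
    · simpa [hxΩ] using h.nonneg

lemma contDiff_mol (h : IsScalarH2 Ω f D H L) (φ : ContDiffBump (0 : Plane)) :
    ContDiff ℝ ∞ (mol φ (Ω.indicator f)) :=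
  RTRecovery.contDiff_mol φ (locallyIntegrable_indicator h.isOpen.measurableSet h.memLp)

/-- The mollifications have both partial derivatives bounded by `L` near the segment from `x` to
`y`, hence are `2 L`-Lipschitz along it, and they converge to `f` at both ends. Convexity of `C`
keeps the segment inside `Ω`. -/
lemma lipschitz_regPts (h : IsScalarH2 Ω f D H L) {C : Set Plane} (hC : IsOpen C)
    (hCc : Convex ℝ C) (hCΩ : C ⊆ Ω) {x y : Plane} (hx : x ∈ regPts Ω f) (hxC : x ∈ C)
    (hy : y ∈ regPts Ω f) (hyC : y ∈ C) : |f x - f y| ≤ 2 * L * dist x y := by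
  have hseg : segment ℝ x y ⊆ C := hCc.segment_subset hxC hyC
  have hcomp : IsCompact (segment ℝ x y) := by
    rw [← convexHull_pair (𝕜 := ℝ)]
    exact (Set.toFinite ({x, y} : Set Plane)).isCompact_convexHull ℝ
  obtain ⟨δ, hδ, hδC⟩ := hcomp.exists_cthickening_subset_open hC hseg
  have hlim := ((hx.2.sub hy.2).abs)
  refine le_of_tendsto hlim ?_
  filter_upwards [tendsto_bump_rOut.eventually (gt_mem_nhds hδ)] with n hn
  have hb : ∀ z ∈ segment ℝ x y, ‖fderiv ℝ (mol (bump n) (Ω.indicator f)) z‖ ≤ 2 * L := by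
    intro z hz
    have hzb : closedBall z (bump n).rOut ⊆ Ω :=
      (closedBall_subset_closedBall hn.le).trans
        ((closedBall_subset_cthickening hz δ).trans (hδC.trans hCΩ))
    refine ContinuousLinearMap.opNorm_le_bound _ (by linarith [h.nonneg]) fun v => ?_
    rw [fderiv_apply_eq_pd, Real.norm_eq_abs]
    have h0 := h.abs_pd_mol_le (bump n) hzb 0
    have h1 := h.abs_pd_mol_le (bump n) hzb 1
    refine (abs_add_le _ _).trans ?_
    rw [abs_mul, abs_mul]
    have e0 := mul_le_mul (abs_apply_le_norm v 0) h0 (abs_nonneg _) (norm_nonneg _)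
    have e1 := mul_le_mul (abs_apply_le_norm v 1) h1 (abs_nonneg _) (norm_nonneg _)
    linarith
  have hcs : Convex ℝ (segment ℝ x y) := convex_segment x y
  have := hcs.norm_image_sub_le_of_norm_fderiv_le (𝕜 := ℝ)
    (fun z _ => ((h.contDiff_mol (bump n)).differentiable (by simp)) z) hb
    (right_mem_segment ℝ x y) (left_mem_segment ℝ x y)
  rwa [Real.norm_eq_abs, ← dist_eq_norm] at this

/-- The Lipschitz bound at regular points extends to the whole plane. This gives the trace on the
edges of an element without a trace theorem. -/
lemma exists_continuous_extension (h : IsScalarH2 Ω f D H L) {C : Set Plane} (hC : IsOpen C)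
    (hCc : Convex ℝ C) (hCΩ : C ⊆ Ω) :
    ∃ g : Plane → ℝ, Continuous g ∧ ∀ x ∈ regPts Ω f, x ∈ C → g x = f x := by
  have hl : LipschitzOnWith (Real.toNNReal (2 * L)) f (regPts Ω f ∩ C) := by
    apply LipschitzOnWith.of_dist_le_mul
    intro x hx y hy
    rw [Real.coe_toNNReal _ (by linarith [h.nonneg])]
    exact h.lipschitz_regPts hC hCc hCΩ hx.1 hx.2 hy.1 hy.2
  obtain ⟨g, hg, hgf⟩ := hl.extend_real
  exact ⟨g, hg.continuous, fun x hx hxC => (hgf ⟨hx, hxC⟩).symm⟩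

/-- Lipschitz bounds are available only on convex pieces of `Ω`. A point `w` of the ball around `z`
is therefore joined to `x` through a regular point `w'` lying both in the ball and in `interior K`:
the first leg stays in the ball and has length at most `2 * φ.rOut`, the second stays in `interior
K`. -/
lemma abs_mol_sub_le (h : IsScalarH2 Ω f D H L) (φ : ContDiffBump (0 : Plane)) {K : Set Plane}
    (hK : Convex ℝ K) (hKΩ : interior K ⊆ Ω) {x z : Plane} (hx : x ∈ regPts Ω f)
    (hxK : x ∈ interior K) (hzK : z ∈ interior K) (hz : closedBall z φ.rOut ⊆ Ω) :
    |mol φ (Ω.indicator f) z - f x| ≤ 2 * L * (3 * φ.rOut + dist z x) := by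
  have hm := h.isOpen.measurableSet
  have hr := φ.rOut_pos
  have hball : ball z φ.rOut ⊆ Ω := ball_subset_closedBall.trans hz
  obtain ⟨w', hw', hw'N⟩ := exists_mem_of_ae (ae_mem_regPts hm h.memLp)
    (isOpen_ball.inter isOpen_interior) ⟨z, mem_ball_self φ.rOut_pos, hzK⟩
  have hw'R := hw'N (hball hw'.1)
  apply RTRecovery.abs_mol_sub_le φ (locallyIntegrable_indicator hm h.memLp)
  filter_upwards [ae_mem_regPts hm h.memLp] with w hw hwz
  have hwΩ := hball hwz
  rw [indicator_of_mem hwΩ]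
  have h1 := h.lipschitz_regPts isOpen_ball (convex_ball z φ.rOut) hball (hw hwΩ) hwz hw'R hw'.1
  have h2 := h.lipschitz_regPts isOpen_interior hK.interior hKΩ hw'R hw'.2 hx hxK
  have h3 := abs_sub_le (f w) (f w') (f x)
  have h4 := dist_triangle_right w w' z
  have h5 := dist_triangle w' z x
  have h6 := mem_ball.1 hwz
  have h7 := mem_ball.1 hw'.1
  have hL := h.nonneg
  calc |f w - f x| ≤ 2 * L * (dist w w' + dist w' x) := by linarith
    _ ≤ _ := mul_le_mul_of_nonneg_left (by linarith) (by linarith)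

end IsScalarH2

/-- Compactness: the slopes are bounded by hypothesis, and the estimate at a single point of `X`
then bounds the constant terms, so a subsequence of the coefficients converges. -/
lemma exists_affine_limit {X : Set Plane} {f : Plane → ℝ} {L A : ℝ} {err : ℕ → ℝ}
    (herr : Tendsto err atTop (𝓝 A))
    (h : ∀ n, ∃ c l₀ l₁ : ℝ, |l₀| ≤ L ∧ |l₁| ≤ L ∧
      ∀ x ∈ X, |f x - (c + l₀ * x 0 + l₁ * x 1)| ≤ err n) :
    ∃ c l₀ l₁ : ℝ, |l₀| ≤ L ∧ |l₁| ≤ L ∧ ∀ x ∈ X, |f x - (c + l₀ * x 0 + l₁ * x 1)| ≤ A := by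
  rcases X.eq_empty_or_nonempty with rfl | ⟨x₀, hx₀⟩
  · obtain ⟨c, l₀, l₁, h0, h1, -⟩ := h 0
    exact ⟨c, l₀, l₁, h0, h1, by simp⟩
  choose c l₀ l₁ h0 h1 hx using h
  obtain ⟨M, hM⟩ := herr.bddAbove_range
  set R : ℝ := |f x₀| + M + L * |x₀ 0| + L * |x₀ 1| with hR
  have hc : ∀ n, |c n| ≤ R := by
    intro n
    have e1 := (hx n x₀ hx₀).trans (hM ⟨n, rfl⟩)
    have e2 : |l₀ n * x₀ 0| ≤ L * |x₀ 0| := by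
      rw [abs_mul]; exact mul_le_mul_of_nonneg_right (h0 n) (abs_nonneg _)
    have e3 : |l₁ n * x₀ 1| ≤ L * |x₀ 1| := by
      rw [abs_mul]; exact mul_le_mul_of_nonneg_right (h1 n) (abs_nonneg _)
    rw [hR]
    rw [abs_le] at e1 e2 e3 ⊢
    have := abs_le.1 (le_refl |f x₀|)
    constructor <;> linarith
  have hK : IsCompact (Icc (-R) R ×ˢ (Icc (-L) L ×ˢ Icc (-L) L)) :=
    isCompact_Icc.prod (isCompact_Icc.prod isCompact_Icc)
  obtain ⟨p, hp, φ, hφ, hlim⟩ := hK.tendsto_subseq (x := fun n => (c n, l₀ n, l₁ n))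
    (fun n => ⟨abs_le.1 (hc n), abs_le.1 (h0 n), abs_le.1 (h1 n)⟩)
  refine ⟨p.1, p.2.1, p.2.2, abs_le.2 hp.2.1, abs_le.2 hp.2.2, fun x hxX => ?_⟩
  have hcont : Continuous fun p : ℝ × ℝ × ℝ => |f x - (p.1 + p.2.1 * x 0 + p.2.2 * x 1)| := by
    fun_prop
  exact le_of_tendsto_of_tendsto ((hcont.tendsto p).comp hlim) (herr.comp hφ.tendsto_atTop)
    (Eventually.of_forall fun n => hx (φ n) x hxX)

lemma abs_affine_sub_le {c l₀ l₁ L : ℝ} (h0 : |l₀| ≤ L) (h1 : |l₁| ≤ L) (x z : Plane) :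
    |(c + l₀ * z 0 + l₁ * z 1) - (c + l₀ * x 0 + l₁ * x 1)| ≤ 2 * L * dist z x := by
  have e : (c + l₀ * z 0 + l₁ * z 1) - (c + l₀ * x 0 + l₁ * x 1) =
      l₀ * (z 0 - x 0) + l₁ * (z 1 - x 1) := by ring
  rw [e, dist_eq_norm]
  refine (abs_add_le _ _).trans ?_
  rw [abs_mul, abs_mul]
  have hz : ∀ i, |z i - x i| ≤ ‖z - x‖ := fun i => abs_apply_le_norm (z - x) i
  have e0 := mul_le_mul h0 (hz 0) (abs_nonneg _) ((abs_nonneg _).trans h0)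
  have e1 := mul_le_mul h1 (hz 1) (abs_nonneg _) ((abs_nonneg _).trans h0)
  linarith

namespace IsScalarH2

variable {Ω : Set Plane} {f : Plane → ℝ} {D : Fin 2 → Plane → ℝ} {H : Fin 2 → Fin 2 → Plane → ℝ}
  {L : ℝ}

/-- Second derivatives of the mollification are mollified weak derivatives, and mollification
contracts `L²` once `A` is enlarged to `S`. The factor `2` comes from `(a + b + c + e)² ≤ 4 (a² + b²
+ c² + e²)`. -/
lemma lintegral_hessSum_mol_le (h : IsScalarH2 Ω f D H L) (φ : ContDiffBump (0 : Plane))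
    {A S : Set Plane} (hA : IsCompact A) (hS : IsOpen S) (hSΩ : S ⊆ Ω) {δ : ℝ}
    (hφ : φ.rOut < δ) (hAS : cthickening δ A ⊆ S) {E : ℝ}
    (hE : ∫⁻ x in S, ENNReal.ofReal (∑ j, ∑ k, H j k x ^ 2) ≤ ENNReal.ofReal (E ^ 2)) :
    ∫⁻ z in A, ENNReal.ofReal (hessSum (mol φ (Ω.indicator f)) z) ^ 2 ≤
      ENNReal.ofReal ((2 * E) ^ 2) := by
  have hm := h.isOpen.measurableSet
  have hmG : ∀ j k, AEMeasurable (Ω.indicator (H j k)) volume := fun j k =>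
    ((memLp_indicator_iff_restrict hm).2 (h.second_memLp j k)).1.aemeasurable
  set u := mol φ (Ω.indicator f) with hu
  set v : Fin 2 → Fin 2 → Plane → ℝ := fun j k => mol φ (Ω.indicator (H j k)) with hv
  have hball : ∀ z ∈ A, ball z δ ⊆ S := fun z hz =>
    ball_subset_closedBall.trans ((closedBall_subset_cthickening hz δ).trans hAS)
  have hpd : ∀ z ∈ A, ∀ j k, pd k (pd j u) z = v j k z := fun z hz j k =>
    fderiv_fderiv_mol φ h.isOpen (h.weak_first j) (h.weak_second j k)
      (locallyIntegrable_indicator hm h.memLp) (locallyIntegrable_indicator hm (h.first_memLp j))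
      hφ ((hball z hz).trans hSΩ)
  have hvm : ∀ j k, Measurable fun z => ‖v j k z‖ₑ ^ 2 := fun j k =>
    (RTRecovery.contDiff_mol φ (locallyIntegrable_indicator hm
      (h.second_memLp j k))).continuous.measurable.enorm.pow_const 2
  calc ∫⁻ z in A, ENNReal.ofReal (hessSum u z) ^ 2
      ≤ ∫⁻ z in A, 4 * ∑ j, ∑ k, ‖v j k z‖ₑ ^ 2 := by
        refine setLIntegral_mono' hA.measurableSet fun z hz => ?_
        simp only [hessSum, hpd z hz, Fin.sum_univ_two, Real.enorm_eq_ofReal_abs]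
        rw [← ENNReal.ofReal_ofNat, ← ENNReal.ofReal_pow (by positivity)]
        simp only [← ENNReal.ofReal_pow (abs_nonneg _)]
        rw [← ENNReal.ofReal_add (by positivity) (by positivity),
          ← ENNReal.ofReal_add (by positivity) (by positivity),
          ← ENNReal.ofReal_add (by positivity) (by positivity),
          ← ENNReal.ofReal_mul (by positivity)]
        apply ENNReal.ofReal_le_ofReal
        generalize |v 0 0 z| = a
        generalize |v 0 1 z| = b
        generalize |v 1 0 z| = c
        generalize |v 1 1 z| = e
        nlinarith [sq_nonneg (a - b), sq_nonneg (a - c), sq_nonneg (a - e), sq_nonneg (b - c),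
          sq_nonneg (b - e), sq_nonneg (c - e)]
    _ = 4 * ∑ j, ∑ k, ∫⁻ z in A, ‖v j k z‖ₑ ^ 2 := by
        rw [lintegral_const_mul' _ _ (by simp), lintegral_finsetSum _
          (fun j _ => Finset.measurable_sum _ fun k _ => hvm j k)]
        congr 1
        refine Finset.sum_congr rfl fun j _ => ?_
        rw [lintegral_finsetSum _ fun k _ => hvm j k]
    _ ≤ 4 * ∑ j, ∑ k, ∫⁻ w in S, ‖Ω.indicator (H j k) w‖ₑ ^ 2 := by
        refine mul_le_mul_right (Finset.sum_le_sum fun j _ => Finset.sum_le_sum fun k _ => ?_) _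
        exact lintegral_mol_sq_le φ (hmG j k) hA.measurableSet hS.measurableSet fun z hz =>
          (ball_subset_ball hφ.le).trans (hball z hz)
    _ = 4 * ∫⁻ w in S, ENNReal.ofReal (∑ j, ∑ k, H j k w ^ 2) := by
        have hGm : ∀ j k, AEMeasurable (fun w => ‖Ω.indicator (H j k) w‖ₑ ^ 2)
            (volume.restrict S) := fun j k => ((hmG j k).restrict (s := S)).enorm.pow_const 2
        congr 1
        have e1 : ∀ j, ∑ k, ∫⁻ w in S, ‖Ω.indicator (H j k) w‖ₑ ^ 2 =
            ∫⁻ w in S, ∑ k, ‖Ω.indicator (H j k) w‖ₑ ^ 2 := fun j =>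
          (lintegral_finsetSum' _ fun k _ => hGm j k).symm
        simp only [e1]
        rw [← lintegral_finsetSum' _ fun j _ => Finset.aemeasurable_fun_sum _ fun k _ => hGm j k]
        refine setLIntegral_congr_fun hS.measurableSet fun w hw => ?_
        simp only [indicator_of_mem (hSΩ hw), Real.enorm_eq_ofReal_abs,
          ← ENNReal.ofReal_pow (abs_nonneg _), sq_abs]
        rw [ENNReal.ofReal_sum_of_nonneg fun j _ => Finset.sum_nonneg fun k _ => sq_nonneg _]
        refine Finset.sum_congr rfl fun j _ => ?_
        rw [ENNReal.ofReal_sum_of_nonneg fun k _ => sq_nonneg _]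
    _ ≤ 4 * ENNReal.ofReal (E ^ 2) := by gcongr
    _ = _ := by
        rw [← ENNReal.ofReal_ofNat, ← ENNReal.ofReal_mul (by positivity)]
        congr 1
        ring

/-- Approximation by an affine function on a set which is star-shaped with respect to a
nondegenerate set. -/
lemma exists_affine_approx (h : IsScalarH2 Ω f D H L) {S B : Set Plane} {m : Plane}
    (hS : IsCompact S) (hSΩ : interior S ⊆ Ω) (hB : IsCompact B) (hBS : B ⊆ S)
    (hstar : ∀ x ∈ S, ∀ y ∈ B, ∀ t ∈ Icc (0 : ℝ) 1, y + t • (x - y) ∈ S)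
    (hm : m ∈ S)
    (hshrink : ∀ x ∈ S, ∀ s ∈ Ioo (0 : ℝ) 1, AffineMap.homothety m s x ∈ interior S)
    {d E β : ℝ} (hd : ∀ x ∈ S, ∀ y ∈ S, dist x y ≤ d) (hβ : 0 < β)
    (hBβ : volume.real B = β ^ 2) (hE0 : 0 ≤ E)
    (hE : ∫⁻ x in interior S, ENNReal.ofReal (∑ j, ∑ k, H j k x ^ 2) ≤ ENNReal.ofReal (E ^ 2)) :
    ∃ c l₀ l₁ : ℝ, |l₀| ≤ L ∧ |l₁| ≤ L ∧
      ∀ x ∈ {x | x ∈ regPts Ω f ∧ ∃ K, Convex ℝ K ∧ m ∈ K ∧ K ⊆ S ∧ x ∈ interior K},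
        |f x - (c + l₀ * x 0 + l₁ * x 1)| ≤ d ^ 2 * (2 * E) / β := by
  -- Ratios in `(0, 1)` tending to `1`. The copy of `S` shrunk towards `m` is compact in `interior
  -- S`, which leaves room to mollify; then `s n → 1`.
  set s : ℕ → ℝ := fun n => 1 - 1 / ((n : ℝ) + 2) with hs
  have hpos : ∀ n : ℕ, (0 : ℝ) < 1 / ((n : ℝ) + 2) := fun n => by positivity
  have hlt : ∀ n : ℕ, 1 / ((n : ℝ) + 2) < 1 := fun n => by
    rw [div_lt_one (by positivity)]; linarith [(Nat.cast_nonneg n : (0 : ℝ) ≤ n)]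
  have hs0 : ∀ n, 0 < s n := fun n => by simp only [hs]; linarith [hlt n]
  have hs1 : ∀ n, s n < 1 := fun n => by simp only [hs]; linarith [hpos n]
  have hstend : Tendsto s atTop (𝓝 1) := by
    have h1 : Tendsto (fun n : ℕ => 1 / ((n : ℝ) + 2)) atTop (𝓝 0) := by
      have := (tendsto_one_div_add_atTop_nhds_zero_nat (𝕜 := ℝ)).comp (tendsto_add_atTop_nat 1)
      refine this.congr fun n => ?_
      simp only [Function.comp]
      push_cast
      ring
    simpa [hs] using h1.const_sub 1
  -- Let `z` be the shrunken image of `x`. The three terms are the smooth estimate at `z` on the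
  -- shrunken sets, the distance from the mollification at `z` to `f x`, and the change of the
  -- affine function between `z` and `x`.
  set err : ℕ → ℝ := fun n => d ^ 2 * (2 * E) / (s n * β) + 2 * L * (3 * (1 - s n) + (1 - s n) * d)
    + 2 * L * ((1 - s n) * d) with herr
  have herrt : Tendsto err atTop (𝓝 (d ^ 2 * (2 * E) / β)) := by
    have h1 : Tendsto (fun n => 1 - s n) atTop (𝓝 0) := by simpa using hstend.const_sub 1
    have h2 : Tendsto (fun n => d ^ 2 * (2 * E) / (s n * β)) atTop (𝓝 (d ^ 2 * (2 * E) / (1 * β))) :=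
      (tendsto_const_nhds).div (hstend.mul_const β) (by simpa using hβ.ne')
    have := (h2.add (((h1.const_mul 3).add (h1.mul_const d)).const_mul (2 * L))).add
      ((h1.mul_const d).const_mul (2 * L))
    simpa using this
  refine exists_affine_limit herrt fun n => ?_
  have hcont : Continuous (AffineMap.homothety m (s n) : Plane → Plane) :=
    AffineMap.homothety_continuous m (s n)
  set Sn := AffineMap.homothety m (s n) '' S with hSn
  set Bn := AffineMap.homothety m (s n) '' B with hBn
  have hSnc : IsCompact Sn := hS.image hcont
  have hBnc : IsCompact Bn := hB.image hcont
  have hSnS : Sn ⊆ interior S := by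
    rintro _ ⟨x, hx, rfl⟩
    exact hshrink x hx (s n) ⟨hs0 n, hs1 n⟩
  obtain ⟨δ, hδ, hδS⟩ := hSnc.exists_cthickening_subset_open isOpen_interior hSnS
  obtain ⟨N, hN⟩ := (tendsto_bump_rOut.eventually (gt_mem_nhds
    (lt_min hδ (sub_pos.2 (hs1 n))))).exists
  have hNδ : (bump N).rOut < δ := hN.trans_le (min_le_left _ _)
  have hNs : (bump N).rOut < 1 - s n := hN.trans_le (min_le_right _ _)
  have hcb : ∀ z ∈ Sn, closedBall z (bump N).rOut ⊆ Ω := fun z hz =>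
    (closedBall_subset_closedBall hNδ.le).trans
      ((closedBall_subset_cthickening hz δ).trans (hδS.trans hSΩ))
  have hhom : ∀ x y : Plane, ∀ t : ℝ, AffineMap.homothety m (s n) y +
      t • (AffineMap.homothety m (s n) x - AffineMap.homothety m (s n) y) =
      AffineMap.homothety m (s n) (y + t • (x - y)) := by
    intro x y t
    simp only [AffineMap.homothety_apply, vsub_eq_sub, vadd_eq_add]
    module
  have hdist : ∀ x y : Plane, dist (AffineMap.homothety m (s n) x) (AffineMap.homothety m (s n) y)
      = s n * dist x y := by
    intro x y
    simp only [AffineMap.homothety_apply, vsub_eq_sub, vadd_eq_add, dist_eq_norm]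
    rw [← Real.norm_of_nonneg (hs0 n).le, ← norm_smul, Real.norm_of_nonneg (hs0 n).le]
    congr 1
    module
  have hvol : volume.real Bn = (s n * β) ^ 2 := by
    rw [hBn, Measure.real, Measure.addHaar_image_homothety, ENNReal.toReal_mul, mul_pow, ← hBβ]
    simp [Measure.real, sq_nonneg]
  obtain ⟨c, l₀, l₁, hl0, hl1, happ⟩ := RTRecovery.exists_affine_approx
    (h.contDiff_mol (bump N)) (S := Sn) (B := Bn) (d := d) (L := L) (E := 2 * E) (β := s n * β)
    hSnc.measurableSet hBnc.measurableSet (image_mono hBS) hBnc.isBounded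
    (by
      rintro _ ⟨x, hx, rfl⟩ _ ⟨y, hy, rfl⟩ t ht
      rw [hhom]
      exact mem_image_of_mem _ (hstar x hx y hy t ht))
    (by
      rintro _ ⟨x, hx, rfl⟩ _ ⟨y, hy, rfl⟩
      rw [hdist]
      have := hd x hx y (hBS hy)
      nlinarith [hs0 n, hs1 n, dist_nonneg (x := x) (y := y)])
    (fun j z hz => h.abs_pd_mol_le (bump N) (hcb z hz) j)
    (mul_pos (hs0 n) hβ) hvol (by positivity)
    (h.lintegral_hessSum_mol_le (bump N) hSnc isOpen_interior hSΩ hNδ hδS hE)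
  refine ⟨c, l₀, l₁, hl0, hl1, ?_⟩
  -- `S` is not assumed convex; the set `K` is a convex piece of it containing the centre `m`, so
  -- `x` and its shrunken image `z` both lie in `interior K`.
  rintro x ⟨hxR, K, hK, hmK, hKS, hxK⟩
  set z := AffineMap.homothety m (s n) x with hz
  have hxS : x ∈ S := hKS (interior_subset hxK)
  have hzS : z ∈ Sn := mem_image_of_mem _ hxS
  have hzK : z ∈ interior K := by
    have := hK.combo_interior_closure_mem_interior hxK (subset_closure hmK) (hs0 n)
      (sub_nonneg.2 (hs1 n).le) (by ring)
    convert this using 1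
    simp only [hz, AffineMap.homothety_apply, vsub_eq_sub, vadd_eq_add]
    module
  have hzx : dist z x = (1 - s n) * dist x m := by
    have e : z - x = (1 - s n) • (m - x) := by
      simp only [hz, AffineMap.homothety_apply, vsub_eq_sub, vadd_eq_add]
      module
    rw [dist_eq_norm, e, norm_smul, Real.norm_of_nonneg (by linarith [hs1 n]), ← dist_eq_norm,
      dist_comm]
  have hzx' : dist z x ≤ (1 - s n) * d := by
    rw [hzx]
    exact mul_le_mul_of_nonneg_left (hd x hxS m hm) (by linarith [hs1 n])
  have e1 := h.abs_mol_sub_le (bump N) hK ((interior_mono hKS).trans hSΩ) hxR hxK hzK (hcb z hzS)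
  have e2 := happ z hzS
  have e3 := abs_affine_sub_le hl0 hl1 x z (c := c)
  have hL := h.nonneg
  have e4 : 2 * L * (3 * (bump N).rOut + dist z x) ≤ 2 * L * (3 * (1 - s n) + (1 - s n) * d) := by
    gcongr
  have e5 : 2 * L * dist z x ≤ 2 * L * ((1 - s n) * d) := by gcongr
  simp only [herr]
  rw [abs_le] at e1 e2 e3 ⊢
  constructor <;> linarith

end IsScalarH2

/-! ### Continuous representatives on convex sets -/

/-- A bound at almost all points of a convex body passes to the continuous representative. -/
lemma abs_contRep_sub_le {q : Plane → Plane} {K : Set Plane} (hK : Convex ℝ K)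
    (hKc : IsCompact K) (hne : (interior K).Nonempty)
    (hex : ∃ g : Plane → Plane, ContinuousOn g K ∧ g =ᵐ[volume.restrict K] q) {i : Fin 2}
    {P : Plane → ℝ} (hP : Continuous P) {A : ℝ}
    (h : ∀ᵐ x, x ∈ interior K → |q x i - P x| ≤ A) :
    ∀ x ∈ K, |contRep K q x i - P x| ≤ A := by
  have hsel : ContinuousOn (contRep K q) K ∧ contRep K q =ᵐ[volume.restrict K] q := by
    unfold contRep
    rw [dif_pos hex]
    exact hex.choose_spec
  set g := contRep K q
  have hcl : closure (interior K) = K := by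
    rw [hK.closure_interior_eq_closure_of_nonempty_interior hne, hKc.isClosed.closure_eq]
  have hgi : ContinuousOn (fun y => |g y i - P y|) K := by
    have h1 : ContinuousOn (fun y => g y i) K :=
      (EuclideanSpace.proj i : Plane →L[ℝ] ℝ).continuous.comp_continuousOn hsel.1
    exact (h1.sub hP.continuousOn).abs
  have hdense : ∀ᵐ x, x ∈ interior K → |g x i - P x| ≤ A := by
    filter_upwards [h, (ae_restrict_iff' hKc.measurableSet).1 hsel.2] with x hx hgx hxK
    rw [hgx (interior_subset hxK)]
    exact hx hxK
  intro x hx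
  -- A violation at `x` would persist on a relatively open part of `K`, which meets `interior K` in
  -- a nonempty open set and hence contains a point where the bound holds.
  by_contra! hlt
  have hnhds : ∀ᶠ y in 𝓝[K] x, A < |g y i - P y| := (hgi x hx).eventually (lt_mem_nhds hlt)
  obtain ⟨U, hU, hxU, hUK⟩ := mem_nhdsWithin.1 hnhds
  have hUne : (U ∩ interior K).Nonempty := by
    have : x ∈ closure (interior K) := by rwa [hcl]
    exact mem_closure_iff.1 this U hU hxU
  obtain ⟨y, hy, hyA⟩ := exists_mem_of_ae hdense (hU.inter isOpen_interior) hUne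
  exact absurd (hUK ⟨hy.1, interior_subset hy.2⟩) (not_lt.2 (hyA hy.2))

lemma ae_mem_interior_of_convex {K : Set Plane} (hK : Convex ℝ K) :
    ∀ᵐ x, x ∈ K → x ∈ interior K := by
  have h0 : ∀ᵐ x, x ∉ frontier K := measure_eq_zero_iff_ae_notMem.1 (hK.addHaar_frontier volume)
  filter_upwards [h0] with x hx hxK
  by_contra hxi
  exact hx ⟨subset_closure hxK, hxi⟩

/-- The Lipschitz extensions of the components agree with `q` at regular points of `interior K`,
which are almost all points of `K` since the frontier of a convex set is null. -/
lemma exists_continuous_rep {Ω : Set Plane} {q : Plane → Plane} {D : Fin 2 → Fin 2 → Plane → ℝ}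
    {H : Fin 2 → Fin 2 → Fin 2 → Plane → ℝ} {L : ℝ}
    (h : ∀ i, IsScalarH2 Ω (fun x => q x i) (D i) (H i) L) {K : Set Plane} (hK : Convex ℝ K)
    (hKm : MeasurableSet K) (hKΩ : interior K ⊆ Ω) :
    ∃ g : Plane → Plane, ContinuousOn g K ∧ g =ᵐ[volume.restrict K] q := by
  choose g hg hgf using fun i => (h i).exists_continuous_extension isOpen_interior hK.interior hKΩ
  refine ⟨fun x => WithLp.toLp 2 fun i => g i x, ?_, ?_⟩
  · exact ((PiLp.continuous_toLp 2 _).comp (continuous_pi hg)).continuousOn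
  · rw [Filter.EventuallyEq, ae_restrict_iff' hKm]
    have hN := fun i => ae_mem_regPts (h i).isOpen.measurableSet (h i).memLp
    filter_upwards [ae_mem_interior_of_convex hK, hN 0, hN 1] with x hx h0 h1 hxK
    have hxi := hx hxK
    ext i
    fin_cases i
    · exact hgf 0 x (h0 (hKΩ hxi)) hxi
    · exact hgf 1 x (h1 (hKΩ hxi)) hxi

open scoped Classical

/-! ### Triangles in the plane -/

/-- Twice the signed area of the triangle `a b c`. -/
def cr (a b c : Plane) : ℝ := (b 0 - a 0) * (c 1 - a 1) - (b 1 - a 1) * (c 0 - a 0)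

lemma cr_rotate (a b c : Plane) : cr b c a = cr a b c := by unfold cr; ring

lemma continuous_cr_left (b c : Plane) : Continuous fun x => cr x b c := by
  unfold cr; fun_prop

lemma continuous_cr_mid (a c : Plane) : Continuous fun x => cr a x c := by
  unfold cr; fun_prop

lemma continuous_cr_right (a b : Plane) : Continuous fun x => cr a b x := by
  unfold cr; fun_prop

lemma combo_apply (a b c : Plane) (u v w : ℝ) (i : Fin 2) :
    (u • a + v • b + w • c) i = u * a i + v * b i + w * c i := by
  simp

lemma cr_combo_left (a b c p q : Plane) {u v w : ℝ} (h : u + v + w = 1) :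
    cr (u • a + v • b + w • c) p q = u * cr a p q + v * cr b p q + w * cr c p q := by
  obtain rfl : u = 1 - v - w := by linarith
  simp only [cr, combo_apply]; ring

lemma cr_combo_mid (a b c p q : Plane) {u v w : ℝ} (h : u + v + w = 1) :
    cr p (u • a + v • b + w • c) q = u * cr p a q + v * cr p b q + w * cr p c q := by
  obtain rfl : u = 1 - v - w := by linarith
  simp only [cr, combo_apply]; ring

lemma cr_combo_right (a b c p q : Plane) {u v w : ℝ} (h : u + v + w = 1) :
    cr p q (u • a + v • b + w • c) = u * cr p q a + v * cr p q b + w * cr p q c := by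
  obtain rfl : u = 1 - v - w := by linarith
  simp only [cr, combo_apply]; ring

lemma cr_self_left (a b : Plane) : cr a a b = 0 := by unfold cr; ring
lemma cr_self_right (a b : Plane) : cr a b b = 0 := by unfold cr; ring
lemma cr_self_outer (a b : Plane) : cr a b a = 0 := by unfold cr; ring

lemma hull_triple (a b c : Plane) : hull {a, b, c} = convexHull ℝ {a, b, c} := by
  simp [hull]

lemma mem_hull_iff {a b c x : Plane} : x ∈ hull {a, b, c} ↔
    ∃ u v w : ℝ, 0 ≤ u ∧ 0 ≤ v ∧ 0 ≤ w ∧ u + v + w = 1 ∧ x = u • a + v • b + w • c := by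
  rw [hull_triple]
  constructor
  · intro hx
    rw [convexHull_insert (by simp), convexHull_pair, convexJoin_singleton_left] at hx
    simp only [mem_iUnion] at hx
    obtain ⟨y, ⟨p, q, hp, hq, hpq, rfl⟩, s, t, hs, ht, hst, rfl⟩ := hx
    refine ⟨s, t * p, t * q, hs, by positivity, by positivity, by rw [add_assoc, ← mul_add, hpq, mul_one, hst], ?_⟩
    module
  · rintro ⟨u, v, w, hu, hv, hw, h, rfl⟩
    have := (convex_convexHull ℝ {a, b, c}).sum_mem (t := Finset.univ) (w := ![u, v, w])
      (z := ![a, b, c]) (by intro i _; fin_cases i <;> simpa) (by simpa [Fin.sum_univ_three] using h)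
      (by intro i _; apply subset_convexHull; fin_cases i <;> simp)
    simpa [Fin.sum_univ_three] using this

/-- Cramer's rule: barycentric coordinates are quotients of signed areas. All later membership
proofs for triangles reduce to signs of such quotients. -/
lemma eq_combo {a b c : Plane} (h : cr a b c ≠ 0) (x : Plane) :
    x = (cr x b c / cr a b c) • a + (cr a x c / cr a b c) • b + (cr a b x / cr a b c) • c := by
  ext i
  rw [combo_apply]
  field_simp
  fin_cases i
  · simp only [cr, Fin.zero_eta]; ring
  · simp only [cr, Fin.mk_one]; ring

lemma sum_cr (a b c x : Plane) : cr x b c + cr a x c + cr a b x = cr a b c := by unfold cr; ring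

lemma mem_hull_of_cr {a b c x : Plane} (h : cr a b c ≠ 0) (h1 : 0 ≤ cr x b c / cr a b c)
    (h2 : 0 ≤ cr a x c / cr a b c) (h3 : 0 ≤ cr a b x / cr a b c) : x ∈ hull {a, b, c} := by
  rw [mem_hull_iff]
  refine ⟨_, _, _, h1, h2, h3, ?_, eq_combo h x⟩
  rw [← add_div, ← add_div, sum_cr, div_self h]

lemma convex_hull (t : Finset Plane) : Convex ℝ (hull t) := convex_convexHull ℝ _

lemma isCompact_hull (t : Finset Plane) : IsCompact (hull t) :=
  t.finite_toSet.isCompact_convexHull ℝ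

lemma measurableSet_hull (t : Finset Plane) : MeasurableSet (hull t) :=
  (isCompact_hull t).measurableSet

lemma subset_hull {t : Finset Plane} {x : Plane} (hx : x ∈ t) : x ∈ hull t :=
  subset_convexHull ℝ _ hx

lemma hull_subset_closedBall {a b c : Plane} {r : ℝ} (hb : dist a b ≤ r) (hc : dist a c ≤ r) :
    hull {a, b, c} ⊆ closedBall a r := by
  rw [hull_triple]
  apply convexHull_min _ (convex_closedBall a r)
  rintro x (rfl | rfl | rfl)
  · exact mem_closedBall_self (dist_nonneg.trans hb)
  · rwa [mem_closedBall, dist_comm]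
  · rwa [mem_closedBall, dist_comm]

lemma norm_sq_plane (x : Plane) : ‖x‖ ^ 2 = x 0 ^ 2 + x 1 ^ 2 := by
  rw [EuclideanSpace.norm_sq_eq, Fin.sum_univ_two]
  simp

lemma dist_sq_plane (x y : Plane) : dist x y ^ 2 = (x 0 - y 0) ^ 2 + (x 1 - y 1) ^ 2 := by
  rw [dist_eq_norm, norm_sq_plane]; rfl

lemma abs_cr_le (a b c : Plane) : |cr a b c| ≤ dist a b * dist a c := by
  apply abs_le_of_sq_le_sq _ (by positivity)
  rw [mul_pow, dist_sq_plane, dist_sq_plane, cr]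
  nlinarith [sq_nonneg ((a 0 - b 0) * (a 0 - c 0) + (a 1 - b 1) * (a 1 - c 1))]

/-- A triangle containing a disc has a large area compared to each of its sides. -/
lemma le_abs_cr_of_closedBall_subset {a b c x : Plane} {r : ℝ} (hr : 0 ≤ r)
    (h : closedBall x r ⊆ hull {a, b, c}) : 2 * r * dist a b ≤ |cr a b c| := by
  rcases eq_or_ne a b with rfl | hab
  · simp
  have hd : 0 < dist a b := dist_pos.2 hab
  -- The unit normal to `ab`. Between the ends `x ± r n` of a diameter `cr a b` varies by `2 * r *
  -- dist a b`, but on the triangle it only takes values between `0` and `cr a b c`.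
  set n : Plane := WithLp.toLp 2 ![-((b 1 - a 1) / dist a b), (b 0 - a 0) / dist a b] with hn
  have hsq := dist_sq_plane a b
  have hn1 : ‖n‖ = 1 := by
    have : ‖n‖ ^ 2 = 1 := by
      rw [norm_sq_plane]
      simp only [hn, PiLp.toLp_apply, Matrix.cons_val_zero, Matrix.cons_val_one, neg_sq, div_pow]
      rw [← add_div, div_eq_one_iff_eq (by positivity), hsq]
      ring
    exact (pow_eq_one_iff_of_nonneg (norm_nonneg n) two_ne_zero).1 this
  have hmem : ∀ s : ℝ, |s| ≤ r → x + s • n ∈ hull {a, b, c} := fun s hs => by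
    apply h
    rw [mem_closedBall, dist_eq_norm, add_sub_cancel_left, norm_smul, hn1, mul_one]
    exact hs
  have hval : ∀ s : ℝ, cr a b (x + s • n) = cr a b x + s * dist a b := by
    intro s
    have e : cr a b (x + s • n) = cr a b x + s * (dist a b ^ 2 / dist a b) := by
      rw [hsq]
      simp only [cr, hn, PiLp.add_apply, PiLp.smul_apply, Matrix.cons_val_zero,
        Matrix.cons_val_one, smul_eq_mul]
      field_simp
      ring
    rw [e, sq, mul_div_assoc, div_self hd.ne', mul_one]
  have hb : ∀ y ∈ hull {a, b, c}, ∃ w : ℝ, 0 ≤ w ∧ w ≤ 1 ∧ cr a b y = w * cr a b c := by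
    intro y hy
    obtain ⟨u, v, w, hu, hv, hw, hs, rfl⟩ := mem_hull_iff.1 hy
    refine ⟨w, hw, by linarith, ?_⟩
    rw [cr_combo_right _ _ _ _ _ hs, cr_self_outer, cr_self_right]
    ring
  obtain ⟨w₁, h1, h1', e1⟩ := hb _ (hmem r (abs_of_nonneg hr).le)
  obtain ⟨w₂, h2, h2', e2⟩ := hb _ (hmem (-r) (by rw [abs_neg, abs_of_nonneg hr]))
  rw [hval] at e1 e2
  have e : 2 * r * dist a b = (w₁ - w₂) * cr a b c := by linarith
  rw [e]
  refine (le_abs_self _).trans ?_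
  rw [abs_mul]
  have : |w₁ - w₂| ≤ 1 := abs_le.2 ⟨by linarith, by linarith⟩
  exact mul_le_of_le_one_left (abs_nonneg _) this

/-! ### Pairs of triangles sharing an edge -/

/-- Two triangles `a b c` and `a b d` on different sides of their common edge `a b`, of size
comparable to the length `ℓ` of this edge. -/
structure IsPatch (k ℓ : ℝ) (a b c d : Plane) : Prop where
  one_le : 1 ≤ k
  pos : 0 < ℓ
  dist_ab : dist a b ≤ ℓ
  dist_ac : dist a c ≤ k * ℓ
  dist_bc : dist b c ≤ k * ℓ
  dist_ad : dist a d ≤ k * ℓ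
  dist_bd : dist b d ≤ k * ℓ
  le_cr : ℓ ^ 2 ≤ k * |cr a b c|
  le_cr' : ℓ ^ 2 ≤ k * |cr a b d|
  neg : cr a b c * cr a b d < 0
  le_vol : ℓ ^ 2 ≤ 4 * k ^ 2 * volume.real (hull {a, b, c})

namespace IsPatch

variable {k ℓ : ℝ} {a b c d : Plane}

lemma ne (h : IsPatch k ℓ a b c d) : cr a b c ≠ 0 := fun h0 => by
  have := h.neg; simp [h0] at this

lemma ne' (h : IsPatch k ℓ a b c d) : cr a b d ≠ 0 := fun h0 => by
  have := h.neg; simp [h0] at this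

lemma div_neg (h : IsPatch k ℓ a b c d) : cr a b d / cr a b c < 0 := by
  have := h.neg
  rw [div_neg_iff]
  rcases lt_or_gt_of_ne h.ne with h1 | h1
  · left; exact ⟨by nlinarith, h1⟩
  · right; exact ⟨by nlinarith, h1⟩

/-- These quantities are the barycentric numerators of one apex relative to the other triangle. The
bound by `k ^ 3` measures how far the patch can be from convex and fixes the shrinking ratio below.
-/
lemma cross_le (h : IsPatch k ℓ a b c d) :
    |cr d b c| ≤ k ^ 3 * |cr a b d| ∧ |cr a d c| ≤ k ^ 3 * |cr a b d| := by
  have h1 := h.le_cr'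
  have hk := h.one_le
  have hℓ := h.pos
  have key : (k * ℓ) * (k * ℓ) ≤ k ^ 3 * |cr a b d| := by
    calc (k * ℓ) * (k * ℓ) = k ^ 2 * ℓ ^ 2 := by ring
      _ ≤ k ^ 2 * (k * |cr a b d|) := by gcongr
      _ = _ := by ring
  constructor
  · refine le_trans ?_ key
    rw [← cr_rotate]
    refine (abs_cr_le b c d).trans ?_
    exact mul_le_mul h.dist_bc h.dist_bd dist_nonneg (by positivity)
  · refine le_trans ?_ key
    exact (abs_cr_le a d c).trans (mul_le_mul h.dist_ad h.dist_ac dist_nonneg (by positivity))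

end IsPatch

/-- The midpoint of a segment. -/
def mid (a b : Plane) : Plane := (1 / 2 : ℝ) • a + (1 / 2 : ℝ) • b

lemma homothety_mid (a b c : Plane) (s u v w : ℝ) :
    AffineMap.homothety (mid a b) s (u • a + v • b + w • c) =
      ((1 - s) / 2 + s * u) • a + ((1 - s) / 2 + s * v) • b + (s * w) • c := by
  simp only [AffineMap.homothety_apply, vsub_eq_sub, vadd_eq_add, mid]
  module

lemma mid_mem_hull (a b c : Plane) : mid a b ∈ hull {a, b, c} := by
  rw [mem_hull_iff]
  exact ⟨1 / 2, 1 / 2, 0, by norm_num, by norm_num, le_rfl, by norm_num, by simp [mid]⟩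

lemma mem_interior_hull {a b c x : Plane} (h : cr a b c ≠ 0) (h1 : 0 < cr x b c / cr a b c)
    (h2 : 0 < cr a x c / cr a b c) (h3 : 0 < cr a b x / cr a b c) :
    x ∈ interior (hull {a, b, c}) := by
  rw [mem_interior]
  refine ⟨{y | 0 < cr y b c / cr a b c} ∩ {y | 0 < cr a y c / cr a b c} ∩
    {y | 0 < cr a b y / cr a b c}, fun y hy => mem_hull_of_cr h hy.1.1.le hy.1.2.le hy.2.le,
    IsOpen.inter (IsOpen.inter ?_ ?_) ?_, ⟨⟨h1, h2⟩, h3⟩⟩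
  · exact isOpen_lt continuous_const ((continuous_cr_left b c).div_const _)
  · exact isOpen_lt continuous_const ((continuous_cr_mid a c).div_const _)
  · exact isOpen_lt continuous_const ((continuous_cr_right a b).div_const _)

namespace IsPatch

variable {k ℓ : ℝ} {a b c d : Plane}

lemma div_neg' (h : IsPatch k ℓ a b c d) : cr a b c / cr a b d < 0 := by
  rw [← inv_div]; exact inv_neg''.2 h.div_neg

/-- Near such a point the coordinates belonging to `a` and `b` are positive for both triangles, and
the sign of `cr a b y` decides in which of them `y` lies. -/
lemma mem_interior_of_edge (h : IsPatch k ℓ a b c d) {u v : ℝ} (hu : 0 < u) (hv : 0 < v)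
    (huv : u + v = 1) :
    u • a + v • b ∈ interior (hull {a, b, c} ∪ hull {a, b, d}) := by
  rw [mem_interior]
  refine ⟨({y | 0 < cr y b c / cr a b c} ∩ {y | 0 < cr a y c / cr a b c}) ∩
    ({y | 0 < cr y b d / cr a b d} ∩ {y | 0 < cr a y d / cr a b d}), ?_, ?_, ?_⟩
  · rintro y ⟨⟨h1, h2⟩, ⟨h3, h4⟩⟩
    by_cases hy : 0 ≤ cr a b y / cr a b c
    · exact Or.inl (mem_hull_of_cr h.ne (le_of_lt h1) (le_of_lt h2) hy)
    · refine Or.inr (mem_hull_of_cr h.ne' (le_of_lt h3) (le_of_lt h4) ?_)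
      have e : cr a b y / cr a b d = (cr a b y / cr a b c) * (cr a b c / cr a b d) := by
        rw [div_mul_div_cancel₀ h.ne]
      rw [e]
      exact (mul_pos_of_neg_of_neg (not_le.1 hy) h.div_neg').le
  · refine IsOpen.inter (IsOpen.inter ?_ ?_) (IsOpen.inter ?_ ?_)
    · exact isOpen_lt continuous_const ((continuous_cr_left b c).div_const _)
    · exact isOpen_lt continuous_const ((continuous_cr_mid a c).div_const _)
    · exact isOpen_lt continuous_const ((continuous_cr_left b d).div_const _)
    · exact isOpen_lt continuous_const ((continuous_cr_mid a d).div_const _)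
  · have e : ∀ p : Plane, u • a + v • b = u • a + v • b + (0 : ℝ) • p := fun p => by simp
    have hs : u + v + 0 = 1 := by linarith
    have key : ∀ p : Plane, cr a b p ≠ 0 → 0 < cr (u • a + v • b) b p / cr a b p ∧
        0 < cr a (u • a + v • b) p / cr a b p := by
      intro p hp
      rw [e p, cr_combo_left _ _ _ _ _ hs, cr_combo_mid _ _ _ _ _ hs, cr_self_left, cr_self_left]
      simp only [mul_zero, add_zero, zero_mul, zero_add]
      rw [mul_div_assoc, mul_div_assoc, div_self hp]
      simpa using ⟨hu, hv⟩
    exact ⟨key c h.ne, key d h.ne'⟩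

lemma homothety_mem_interior_aux (h : IsPatch k ℓ a b c d) {p x : Plane} (hp : cr a b p ≠ 0)
    (hpd : p = c ∨ p = d) (hx : x ∈ hull {a, b, p}) {s : ℝ} (hs : s ∈ Ioo (0 : ℝ) 1) :
    AffineMap.homothety (mid a b) s x ∈ interior (hull {a, b, c} ∪ hull {a, b, d}) := by
  obtain ⟨u, v, w, hu, hv, hw, hsum, rfl⟩ := mem_hull_iff.1 hx
  have hs' := sub_pos.2 hs.2
  have hs0 := hs.1
  have hu' : 0 < (1 - s) / 2 + s * u := by positivity
  have hv' : 0 < (1 - s) / 2 + s * v := by positivity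
  have hsum' : (1 - s) / 2 + s * u + ((1 - s) / 2 + s * v) + s * w = 1 := by
    linear_combination s * hsum
  rw [homothety_mid]
  rcases hw.eq_or_lt with rfl | hw
  · rw [mul_zero, zero_smul, add_zero]
    exact h.mem_interior_of_edge hu' hv' (by linarith)
  · have hsub : hull {a, b, p} ⊆ hull {a, b, c} ∪ hull {a, b, d} := by
      rcases hpd with rfl | rfl
      · exact subset_union_left
      · exact subset_union_right
    apply interior_mono hsub
    have hsw : 0 < s * w := mul_pos hs0 hw
    apply mem_interior_hull hp
    · rw [cr_combo_left _ _ _ _ _ hsum', cr_self_left, ← cr_rotate p b p, cr_self_right]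
      simpa [mul_div_assoc, div_self hp] using hu'
    · rw [cr_combo_mid _ _ _ _ _ hsum', cr_self_left, cr_self_right]
      simpa [mul_div_assoc, div_self hp] using hv'
    · rw [cr_combo_right _ _ _ _ _ hsum', cr_self_outer, cr_self_right]
      simpa [mul_div_assoc, div_self hp] using hsw

lemma homothety_mem_interior (h : IsPatch k ℓ a b c d) {x : Plane}
    (hx : x ∈ hull {a, b, c} ∪ hull {a, b, d}) {s : ℝ} (hs : s ∈ Ioo (0 : ℝ) 1) :
    AffineMap.homothety (mid a b) s x ∈ interior (hull {a, b, c} ∪ hull {a, b, d}) := by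
  rcases hx with hx | hx
  · exact h.homothety_mem_interior_aux h.ne (Or.inl rfl) hx hs
  · exact h.homothety_mem_interior_aux h.ne' (Or.inr rfl) hx hs

/-- A point of the shrunken triangle is so close to the midpoint of `ab` that its coordinate at `c`,
multiplied by `k ^ 3`, is dominated by its coordinates at `a` and at `b`. A segment from it to the
other triangle thus crosses the line `ab` within the edge. -/
lemma star_shaped (h : IsPatch k ℓ a b c d) {s : ℝ} (hs0 : 0 < s) (hs1 : s ≤ 1)
    (hsk : s * k ^ 3 ≤ (1 - s) / 2) {x y : Plane}
    (hx : x ∈ hull {a, b, c} ∪ hull {a, b, d})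
    (hy : y ∈ AffineMap.homothety (mid a b) s '' hull {a, b, c}) {t : ℝ}
    (ht : t ∈ Icc (0 : ℝ) 1) : y + t • (x - y) ∈ hull {a, b, c} ∪ hull {a, b, d} := by
  obtain ⟨y', hy', rfl⟩ := hy
  have hyc : AffineMap.homothety (mid a b) s y' ∈ hull {a, b, c} := by
    have := (convex_hull {a, b, c}) (mid_mem_hull a b c) hy' (sub_nonneg.2 hs1) hs0.le (by ring)
    convert this using 1
    simp only [AffineMap.homothety_apply, vsub_eq_sub, vadd_eq_add]
    module
  rcases hx with hx | hx
  · left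
    exact (convex_hull {a, b, c}).add_smul_sub_mem hyc hx ht
  obtain ⟨p, q, r, hp, hq, hr, hpqr, rfl⟩ := mem_hull_iff.1 hy'
  obtain ⟨u, v, w, hu, hv, hw, huvw, rfl⟩ := mem_hull_iff.1 hx
  rw [homothety_mid]
  have ht0 := ht.1
  have ht1 := sub_nonneg.2 ht.2
  set ya := (1 - s) / 2 + s * p with hya
  set yb := (1 - s) / 2 + s * q with hyb
  set yc := s * r with hyc'
  have hyc0 : 0 ≤ yc := by positivity
  have hys : ya + yb + yc = 1 := by linear_combination s * hpqr
  have hyk : yc * k ^ 3 ≤ (1 - s) / 2 := by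
    have : r ≤ 1 := by linarith
    have hk3 : 0 ≤ k ^ 3 := pow_nonneg (by linarith [h.one_le]) 3
    calc yc * k ^ 3 = r * (s * k ^ 3) := by rw [hyc']; ring
      _ ≤ 1 * (s * k ^ 3) := by gcongr
      _ ≤ _ := by rw [one_mul]; exact hsk
  have hya' : yc * k ^ 3 ≤ ya := hyk.trans (by rw [hya]; linarith [mul_nonneg hs0.le hp])
  have hyb' : yc * k ^ 3 ≤ yb := hyk.trans (by rw [hyb]; linarith [mul_nonneg hs0.le hq])
  have hcross := h.cross_le
  set J := cr a b c with hJ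
  set J' := cr a b d with hJ'
  have hJ0 : J ≠ 0 := h.ne
  have hJ0' : J' ≠ 0 := h.ne'
  set P := ya • a + yb • b + yc • c + t • (u • a + v • b + w • d - (ya • a + yb • b + yc • c)) with hP
  have hP1 : P = (1 - t) • (ya • a + yb • b + yc • c) + t • (u • a + v • b + w • d) + (0 : ℝ) • a := by
    rw [hP]; module
  have hts : (1 - t) + t + 0 = 1 := by ring
  have gP : cr a b P = (1 - t) * (yc * J) + t * (w * J') := by
    rw [hP1, cr_combo_right _ _ _ _ _ hts, cr_combo_right _ _ _ _ _ hys,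
      cr_combo_right _ _ _ _ _ huvw, cr_self_outer, cr_self_right]
    ring
  -- The sign tells on which side of `ab` the point `P` lies, hence which triangle should contain
  -- it; it remains to check its coordinates at `a` and `b`.
  by_cases hside : 0 ≤ cr a b P / J
  · left
    have hδ : J' / J < 0 := h.div_neg
    have e1 : cr a b P / J = (1 - t) * yc + t * w * (J' / J) := by
      rw [gP]; field_simp
    -- On the side of `c`, the possibly negative contribution of `d` is at most `k ^ 3 * t * w * |J'
    -- / J|`. By `hside` this is at most `k ^ 3 * (1 - t) * yc`, which the coordinate `yy` of `y`
    -- absorbs.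
    have hb1 : ∀ r : ℝ, |r| ≤ k ^ 3 * |J'| → ∀ yy, yc * k ^ 3 ≤ yy →
        0 ≤ (1 - t) * yy + t * w * (r / J) := by
      intro r hr yy hyy
      have e2 : |r / J| ≤ k ^ 3 * -(J' / J) := by
        rw [abs_div, ← abs_of_neg hδ, abs_div, ← mul_div_assoc]
        exact div_le_div_of_nonneg_right hr (abs_nonneg _)
      have e3 := (abs_le.1 e2).1
      have e4 : t * w * -(k ^ 3 * -(J' / J)) ≤ t * w * (r / J) :=
        mul_le_mul_of_nonneg_left e3 (by positivity)
      have e5 : (1 - t) * (yc * k ^ 3) ≤ (1 - t) * yy := mul_le_mul_of_nonneg_left hyy ht1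
      have hk3 : 0 ≤ k ^ 3 := pow_nonneg (by linarith [h.one_le]) 3
      have e6 : 0 ≤ k ^ 3 * ((1 - t) * yc + t * w * (J' / J)) :=
        mul_nonneg hk3 (by rw [← e1]; exact hside)
      linarith
    apply mem_hull_of_cr hJ0 _ _ hside
    · have e7 : cr P b c / J = ((1 - t) * ya + t * w * (cr d b c / J)) + t * u := by
        rw [hP1, cr_combo_left _ _ _ _ _ hts, cr_combo_left _ _ _ _ _ hys,
          cr_combo_left _ _ _ _ _ huvw, cr_self_left, ← cr_rotate c b c, cr_self_right, ← hJ]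
        field_simp
        ring
      change 0 ≤ cr P b c / J
      rw [e7]
      exact add_nonneg (hb1 _ hcross.1 _ hya') (by positivity)
    · have e7 : cr a P c / J = ((1 - t) * yb + t * w * (cr a d c / J)) + t * v := by
        rw [hP1, cr_combo_mid _ _ _ _ _ hts, cr_combo_mid _ _ _ _ _ hys,
          cr_combo_mid _ _ _ _ _ huvw, cr_self_left, cr_self_right, ← hJ]
        field_simp
        ring
      change 0 ≤ cr a P c / J
      rw [e7]
      exact add_nonneg (hb1 _ hcross.2 _ hyb') (by positivity)
  · right
    have hδ : J / J' < 0 := h.div_neg'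
    have hb1 : ∀ r : ℝ, |r| ≤ k ^ 3 * |J'| → ∀ yy, yc * k ^ 3 ≤ yy → 0 ≤ yy + yc * (r / J') := by
      intro r hr yy hyy
      have e2 : |r / J'| ≤ k ^ 3 := by
        rw [abs_div, div_le_iff₀ (abs_pos.2 hJ0')]; exact hr
      have e3 := mul_le_mul_of_nonneg_left (abs_le.1 e2).1 hyc0
      linarith
    apply mem_hull_of_cr hJ0'
    · have e7 : cr P b d / J' = (1 - t) * (ya + yc * (cr c b d / J')) + t * u := by
        rw [hP1, cr_combo_left _ _ _ _ _ hts, cr_combo_left _ _ _ _ _ hys,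
          cr_combo_left _ _ _ _ _ huvw, cr_self_left, ← cr_rotate d b d, cr_self_right, ← hJ']
        field_simp
        ring
      change 0 ≤ cr P b d / J'
      rw [e7]
      have hc : |cr c b d| ≤ k ^ 3 * |J'| := by
        have : cr c b d = - cr d b c := by unfold cr; ring
        rw [this, abs_neg]; exact hcross.1
      exact add_nonneg (mul_nonneg ht1 (hb1 _ hc _ hya')) (by positivity)
    · have e7 : cr a P d / J' = (1 - t) * (yb + yc * (cr a c d / J')) + t * v := by
        rw [hP1, cr_combo_mid _ _ _ _ _ hts, cr_combo_mid _ _ _ _ _ hys,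
          cr_combo_mid _ _ _ _ _ huvw, cr_self_left, cr_self_right, ← hJ']
        field_simp
        ring
      change 0 ≤ cr a P d / J'
      rw [e7]
      have hc : |cr a c d| ≤ k ^ 3 * |J'| := by
        have : cr a c d = - cr a d c := by unfold cr; ring
        rw [this, abs_neg]; exact hcross.2
      exact add_nonneg (mul_nonneg ht1 (hb1 _ hc _ hyb')) (by positivity)
    · have e1 : cr a b P / J' = cr a b P / J * (J / J') := by rw [div_mul_div_cancel₀ hJ0]
      change 0 ≤ cr a b P / J'
      rw [e1]
      exact (mul_pos_of_neg_of_neg (not_le.1 hside) hδ).le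

end IsPatch

/-! ### Affine approximation on a pair of triangles -/

/-- The sum of the squares of all second derivatives. -/
def hessSq (H : Fin 2 → Fin 2 → Fin 2 → Plane → ℝ) (x : Plane) : ℝ :=
  ∑ i, ∑ j, ∑ k, H i j k x ^ 2

/-- The constant in the affine approximation on a pair of triangles. -/
def patchConst (k : ℝ) : ℝ := 16 * k ^ 3 * (1 + 2 * k ^ 3)

lemma patchConst_nonneg {k : ℝ} (hk : 0 ≤ k) : 0 ≤ patchConst k := by
  unfold patchConst; positivity

namespace IsPatch

variable {k ℓ : ℝ} {a b c d : Plane}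

lemma dist_le (h : IsPatch k ℓ a b c d) {x y : Plane}
    (hx : x ∈ hull {a, b, c} ∪ hull {a, b, d}) (hy : y ∈ hull {a, b, c} ∪ hull {a, b, d}) :
    dist x y ≤ 2 * k * ℓ := by
  have hab : dist a b ≤ k * ℓ := h.dist_ab.trans (le_mul_of_one_le_left h.pos.le h.one_le)
  have hsub : hull {a, b, c} ∪ hull {a, b, d} ⊆ closedBall a (k * ℓ) :=
    union_subset (hull_subset_closedBall hab h.dist_ac) (hull_subset_closedBall hab h.dist_ad)
  have h1 := mem_closedBall.1 (hsub hx)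
  have h2 := mem_closedBall.1 (hsub hy)
  linarith [dist_triangle_right x y a]

lemma exists_affine_approx (hp : IsPatch k ℓ a b c d) {Ω : Set Plane} {f : Plane → ℝ}
    {D : Fin 2 → Plane → ℝ} {H : Fin 2 → Fin 2 → Plane → ℝ} {L : ℝ} (h : IsScalarH2 Ω f D H L)
    (hΩ : interior (hull {a, b, c} ∪ hull {a, b, d}) ⊆ Ω) {E : ℝ} (hE0 : 0 ≤ E)
    (hE : ∫⁻ x in interior (hull {a, b, c} ∪ hull {a, b, d}),
      ENNReal.ofReal (∑ j, ∑ k, H j k x ^ 2) ≤ ENNReal.ofReal (E ^ 2)) :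
    ∃ c₀ l₀ l₁ : ℝ, |l₀| ≤ L ∧ |l₁| ≤ L ∧ ∀ p, (p = c ∨ p = d) →
      ∀ x ∈ regPts Ω f, x ∈ interior (hull {a, b, p}) →
        |f x - (c₀ + l₀ * x 0 + l₁ * x 1)| ≤ patchConst k * (ℓ * E) := by
  have hk := hp.one_le
  have hℓ := hp.pos
  -- The solution of `s * k ^ 3 = (1 - s) / 2`: the largest ratio admitted by `star_shaped`.
  set s : ℝ := 1 / (1 + 2 * k ^ 3) with hs
  have hk3 : 0 < 1 + 2 * k ^ 3 := by positivity
  have hs0 : 0 < s := by positivity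
  have hs1 : s ≤ 1 := by
    rw [hs, div_le_one hk3]; linarith [pow_nonneg (by linarith : 0 ≤ k) 3]
  have hsk : s * k ^ 3 ≤ (1 - s) / 2 := by
    apply le_of_eq
    rw [hs]; field_simp; ring
  set V := volume.real (hull {a, b, c}) with hV
  have hV0 : 0 < V := by
    by_contra hneg
    have h1 := hp.le_vol
    have : 4 * k ^ 2 * V ≤ 0 := mul_nonpos_of_nonneg_of_nonpos (by positivity) (not_lt.1 hneg)
    nlinarith [pow_pos hℓ 2]
  have hVℓ : ℓ ≤ 2 * k * √V := by
    apply abs_le_of_sq_le_sq' _ (by positivity) |>.2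
    rw [mul_pow, Real.sq_sqrt hV0.le]
    linarith [hp.le_vol]
  set S := hull {a, b, c} ∪ hull {a, b, d} with hS
  set B := AffineMap.homothety (mid a b) s '' hull {a, b, c} with hB
  have hmid : ∀ p, mid a b ∈ hull {a, b, p} := mid_mem_hull a b
  have hBS : B ⊆ S := by
    rintro _ ⟨y, hy, rfl⟩
    left
    have := (convex_hull {a, b, c}) (hmid c) hy (sub_nonneg.2 hs1) hs0.le (by ring)
    convert this using 1
    simp only [AffineMap.homothety_apply, vsub_eq_sub, vadd_eq_add]
    module
  have hBvol : volume.real B = (s * √V) ^ 2 := by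
    rw [hB, Measure.real, Measure.addHaar_image_homothety, ENNReal.toReal_mul, mul_pow,
      Real.sq_sqrt hV0.le, hV]
    simp [Measure.real, sq_nonneg]
  obtain ⟨c₀, l₀, l₁, h0, h1, happ⟩ := h.exists_affine_approx (S := S) (B := B) (m := mid a b)
    ((isCompact_hull _).union (isCompact_hull _)) hΩ
    ((isCompact_hull _).image (AffineMap.homothety_continuous _ _)) hBS
    (fun x hx y hy t ht => hp.star_shaped hs0 hs1 hsk hx hy ht) (Or.inl (hmid c))
    (fun x hx r hr => hp.homothety_mem_interior hx hr) (fun x hx y hy => hp.dist_le hx hy)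
    (β := s * √V) (by positivity) hBvol hE0 hE
  refine ⟨c₀, l₀, l₁, h0, h1, fun p hpcd x hx hxi => ?_⟩
  refine (happ x ⟨hx, hull {a, b, p}, convex_hull _, hmid p, ?_, hxi⟩).trans ?_
  · rcases hpcd with rfl | rfl
    · exact subset_union_left
    · exact subset_union_right
  · rw [div_le_iff₀ (by positivity)]
    -- With diameter `2 * k * ℓ` the general bound is `8 * k ^ 2 * ℓ ^ 2 * E / (s * √V)`. One factor
    -- `ℓ` is traded for `2 * k * √V`, and `1 / s` gives the last factor of `patchConst`.
    have e : patchConst k * (ℓ * E) * (s * √V) = 8 * k ^ 2 * ℓ * E * (2 * k * √V) := by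
      rw [hs, patchConst]; field_simp; ring
    rw [e]
    calc (2 * k * ℓ) ^ 2 * (2 * E) = 8 * k ^ 2 * ℓ * E * ℓ := by ring
      _ ≤ _ := by gcongr

lemma exists_affine_approx_contRep (hp : IsPatch k ℓ a b c d) {Ω : Set Plane} {q : Plane → Plane}
    {D : Fin 2 → Fin 2 → Plane → ℝ} {H : Fin 2 → Fin 2 → Fin 2 → Plane → ℝ} {L : ℝ}
    (h : ∀ i, IsScalarH2 Ω (fun x => q x i) (D i) (H i) L)
    (hΩ : interior (hull {a, b, c} ∪ hull {a, b, d}) ⊆ Ω) {E : ℝ} (hE0 : 0 ≤ E)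
    (hE : ∫⁻ x in interior (hull {a, b, c} ∪ hull {a, b, d}),
      ENNReal.ofReal (hessSq H x) ≤ ENNReal.ofReal (E ^ 2))
    (hne : ∀ p, (p = c ∨ p = d) → (interior (hull {a, b, p})).Nonempty) :
    ∃ (c₀ : Fin 2 → ℝ) (A : Fin 2 → Fin 2 → ℝ), (∀ i j, |A i j| ≤ L) ∧ ∀ p, (p = c ∨ p = d) →
      ∀ x ∈ hull {a, b, p}, ∀ i,
        |contRep (hull {a, b, p}) q x i - (c₀ i + A i 0 * x 0 + A i 1 * x 1)| ≤
          patchConst k * (ℓ * E) := by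
  have hEi : ∀ i, ∫⁻ x in interior (hull {a, b, c} ∪ hull {a, b, d}),
      ENNReal.ofReal (∑ j, ∑ k, H i j k x ^ 2) ≤ ENNReal.ofReal (E ^ 2) := fun i => by
    refine (lintegral_mono fun x => ENNReal.ofReal_le_ofReal ?_).trans hE
    exact Finset.single_le_sum (f := fun i => ∑ j, ∑ k, H i j k x ^ 2)
      (fun i _ => Finset.sum_nonneg fun j _ => Finset.sum_nonneg fun k _ => sq_nonneg _)
      (Finset.mem_univ i)
  choose c₀ l₀ l₁ h0 h1 happ using fun i => hp.exists_affine_approx (h i) hΩ hE0 (hEi i)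
  refine ⟨c₀, fun i => ![l₀ i, l₁ i], fun i j => by fin_cases j <;> simp [h0, h1], ?_⟩
  intro p hpcd x hx i
  have hsub : interior (hull {a, b, p}) ⊆ Ω := by
    refine Subset.trans (interior_mono ?_) hΩ
    rcases hpcd with rfl | rfl
    · exact subset_union_left
    · exact subset_union_right
  refine abs_contRep_sub_le (P := fun x => c₀ i + l₀ i * x 0 + l₁ i * x 1) (convex_hull _)
    (isCompact_hull _) (hne p hpcd)
    (exists_continuous_rep h (convex_hull _) (measurableSet_hull _) hsub) (by fun_prop) ?_ x hx
  filter_upwards [ae_mem_regPts (h i).isOpen.measurableSet (h i).memLp] with y hy hyi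
  exact happ i p hpcd y (hy (hsub hyi)) hyi

end IsPatch

/-! ### The Raviart–Thomas interpolant on a triangle -/

/-- The affine vector field with values `c₀` at the origin and gradient `A`. -/
def affField (c₀ : Fin 2 → ℝ) (A : Fin 2 → Fin 2 → ℝ) (x : Plane) : Plane :=
  WithLp.toLp 2 fun i => c₀ i + A i 0 * x 0 + A i 1 * x 1

lemma affField_apply (c₀ : Fin 2 → ℝ) (A : Fin 2 → Fin 2 → ℝ) (x : Plane) (i : Fin 2) :
    affField c₀ A x i = c₀ i + A i 0 * x 0 + A i 1 * x 1 := rfl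

lemma continuous_affField (c₀ : Fin 2 → ℝ) (A : Fin 2 → Fin 2 → ℝ) :
    Continuous (affField c₀ A) := by
  unfold affField
  exact (PiLp.continuous_toLp 2 _).comp (continuous_pi fun i => by fun_prop)

lemma lineMap_coord (a b : Plane) (s : ℝ) (i : Fin 2) :
    (AffineMap.lineMap a b s : Plane) i = a i + s * (b i - a i) := by
  simp [AffineMap.lineMap_apply]; ring

lemma mid_apply (a b : Plane) (i : Fin 2) : mid a b i = (a i + b i) / 2 := by
  simp [mid]; ring

/-- The midpoint rule, exact because the integrand is affine in the parameter. -/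
lemma edgeFlux_affField (c₀ : Fin 2 → ℝ) (A : Fin 2 → Fin 2 → ℝ) (a b : Plane) :
    edgeFlux (affField c₀ A) a b =
      affField c₀ A (mid a b) 0 * (b 1 - a 1) - affField c₀ A (mid a b) 1 * (b 0 - a 0) := by
  have e : ∀ s : ℝ, affField c₀ A (AffineMap.lineMap a b s) 0 * (b 1 - a 1) -
      affField c₀ A (AffineMap.lineMap a b s) 1 * (b 0 - a 0) =
      (affField c₀ A a 0 * (b 1 - a 1) - affField c₀ A a 1 * (b 0 - a 0)) + s *
      ((A 0 0 * (b 0 - a 0) + A 0 1 * (b 1 - a 1)) * (b 1 - a 1) -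
        (A 1 0 * (b 0 - a 0) + A 1 1 * (b 1 - a 1)) * (b 0 - a 0)) := by
    intro s
    simp only [affField_apply, lineMap_coord]
    ring
  unfold edgeFlux
  simp only [e]
  rw [intervalIntegral.integral_add (by simp) (Continuous.intervalIntegrable (by fun_prop) _ _),
    intervalIntegral.integral_mul_const, integral_id]
  simp only [intervalIntegral.integral_const, affField_apply, mid_apply, smul_eq_mul]
  ring

lemma edgeFlux_swap (v : Plane → Plane) (a b : Plane) : edgeFlux v b a = - edgeFlux v a b := by
  unfold edgeFlux
  have h := intervalIntegral.integral_comp_sub_left (a := 0) (b := 1)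
    (fun s : ℝ => v (AffineMap.lineMap b a s) 0 * (a 1 - b 1) -
      v (AffineMap.lineMap b a s) 1 * (a 0 - b 0)) 1
  simp only [sub_zero, sub_self] at h
  rw [← h, ← intervalIntegral.integral_neg]
  refine intervalIntegral.integral_congr fun s _ => ?_
  simp only [AffineMap.lineMap_apply_one_sub]
  ring

lemma edgeFlux_self (v : Plane → Plane) (a : Plane) : edgeFlux v a a = 0 := by
  unfold edgeFlux; simp

lemma exists_affField_of_mem_RT0 {r : Plane → Plane} (hr : r ∈ RT0) :
    ∃ (c₀ : Fin 2 → ℝ) (κ : ℝ), r = affField c₀ (fun i j => if i = j then κ else 0) := by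
  obtain ⟨α, κ, h⟩ := hr
  refine ⟨fun i => α i, κ, funext fun x => ?_⟩
  rw [h]
  ext i
  fin_cases i <;> simp [affField]

/-- The element of `RT0` with prescribed fluxes. -/
def rtField (a b c : Plane) (F₁ F₂ F₃ : ℝ) (x : Plane) : Plane :=
  (cr a b c)⁻¹ • (F₁ • (x - c) + F₂ • (x - a) + F₃ • (x - b))

lemma rtField_apply (a b c : Plane) (F₁ F₂ F₃ : ℝ) (x : Plane) (i : Fin 2) :
    rtField a b c F₁ F₂ F₃ x i =
      (cr a b c)⁻¹ * (F₁ * (x i - c i) + F₂ * (x i - a i) + F₃ * (x i - b i)) := by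
  simp [rtField, mul_add]

lemma rtField_mem_RT0 (a b c : Plane) (F₁ F₂ F₃ : ℝ) : rtField a b c F₁ F₂ F₃ ∈ RT0 := by
  refine ⟨-((cr a b c)⁻¹ • (F₁ • c + F₂ • a + F₃ • b)), (cr a b c)⁻¹ * (F₁ + F₂ + F₃), fun x => ?_⟩
  unfold rtField
  module

lemma edgeFlux_mem_RT0 {r : Plane → Plane} (hr : r ∈ RT0) (a b : Plane) :
    edgeFlux r a b = r (mid a b) 0 * (b 1 - a 1) - r (mid a b) 1 * (b 0 - a 0) := by
  obtain ⟨c₀, κ, rfl⟩ := exists_affField_of_mem_RT0 hr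
  exact edgeFlux_affField _ _ _ _

/-- The field `x - c` is tangential to the two edges at `c` and has flux `cr a b c` through `ab`, so
the three summands of `rtField` form a basis dual to the fluxes. -/
lemma edgeFlux_rtField {a b c : Plane} (h : cr a b c ≠ 0) (F₁ F₂ F₃ : ℝ) :
    edgeFlux (rtField a b c F₁ F₂ F₃) a b = F₁ ∧ edgeFlux (rtField a b c F₁ F₂ F₃) b c = F₂ ∧
      edgeFlux (rtField a b c F₁ F₂ F₃) c a = F₃ := by
  simp only [edgeFlux_mem_RT0 (rtField_mem_RT0 a b c F₁ F₂ F₃), rtField_apply, mid_apply]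
  refine ⟨?_, ?_, ?_⟩ <;>
  · field_simp
    unfold cr
    ring

lemma eq_rtField {a b c : Plane} (h : cr a b c ≠ 0) {r : Plane → Plane} (hr : r ∈ RT0) :
    r = rtField a b c (edgeFlux r a b) (edgeFlux r b c) (edgeFlux r c a) := by
  obtain ⟨c₀, κ, rfl⟩ := exists_affField_of_mem_RT0 hr
  funext x
  ext i
  rw [rtField_apply]
  simp only [edgeFlux_affField, affField_apply, mid_apply]
  field_simp
  fin_cases i
  · simp only [cr]; simp; ring
  · simp only [cr]; simp; ring

/-- The three fluxes determine an element of `RT0`, so the arbitrary choice in the definition is the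
explicit field. The conditions for reversed and degenerate pairs of vertices follow from
`edgeFlux_swap` and `edgeFlux_self`. -/
lemma rtInterp_eq {a b c : Plane} (h : cr a b c ≠ 0) (q : Plane → Plane) :
    rtInterp q {a, b, c} = rtField a b c (edgeFlux (contRep (hull {a, b, c}) q) a b)
      (edgeFlux (contRep (hull {a, b, c}) q) b c) (edgeFlux (contRep (hull {a, b, c}) q) c a) := by
  set v := contRep (hull {a, b, c}) q with hv
  have hex : ∃ r : Plane → Plane, r ∈ RT0 ∧ ∀ x ∈ ({a, b, c} : Finset Plane),
      ∀ y ∈ ({a, b, c} : Finset Plane), edgeFlux r x y = edgeFlux v x y := by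
    obtain ⟨r, hr, h1, h2, h3⟩ : ∃ r : Plane → Plane, r ∈ RT0 ∧ edgeFlux r a b = edgeFlux v a b ∧
        edgeFlux r b c = edgeFlux v b c ∧ edgeFlux r c a = edgeFlux v c a :=
      ⟨_, rtField_mem_RT0 a b c _ _ _, edgeFlux_rtField h _ _ _⟩
    refine ⟨r, hr, ?_⟩
    intro x hx y hy
    simp only [Finset.mem_insert, Finset.mem_singleton] at hx hy
    rcases hx with rfl | rfl | rfl <;> rcases hy with rfl | rfl | rfl <;>
      first
      | simp only [edgeFlux_self]
      | assumption
      | (rw [edgeFlux_swap r, edgeFlux_swap v, neg_inj]; assumption)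
  have hsp := Classical.epsilon_spec hex
  change rtInterp q {a, b, c} ∈ RT0 ∧ _ at hsp
  have e := hsp.2
  rw [eq_rtField h hsp.1]
  change ∀ x ∈ ({a, b, c} : Finset Plane), ∀ y ∈ ({a, b, c} : Finset Plane),
    edgeFlux (rtInterp q {a, b, c}) x y = edgeFlux v x y at e
  rw [e a (by simp) b (by simp), e b (by simp) c (by simp), e c (by simp) a (by simp)]

lemma abs_edgeFlux_sub_le {v w : Plane → Plane} {K : Set Plane} (hK : Convex ℝ K)
    (hv : ContinuousOn v K) (hw : ContinuousOn w K) {A : ℝ}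
    (h : ∀ x ∈ K, ∀ i, |v x i - w x i| ≤ A) {a b : Plane} (ha : a ∈ K) (hb : b ∈ K) :
    |edgeFlux v a b - edgeFlux w a b| ≤ 2 * A * dist a b := by
  have hmem : ∀ s ∈ Icc (0 : ℝ) 1, (AffineMap.lineMap a b s : Plane) ∈ K := fun s hs =>
    hK.segment_subset ha hb (by rw [segment_eq_image_lineMap]; exact mem_image_of_mem _ hs)
  have hint : ∀ v : Plane → Plane, ContinuousOn v K → IntervalIntegrable (fun s : ℝ =>
      v (AffineMap.lineMap a b s) 0 * (b 1 - a 1) - v (AffineMap.lineMap a b s) 1 * (b 0 - a 0))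
      volume 0 1 := by
    intro v hv
    apply ContinuousOn.intervalIntegrable
    rw [uIcc_of_le zero_le_one]
    have h1 : ContinuousOn (fun s : ℝ => v (AffineMap.lineMap a b s)) (Icc 0 1) :=
      hv.comp (AffineMap.lineMap_continuous.continuousOn) hmem
    have h2 : ∀ i : Fin 2, ContinuousOn (fun s : ℝ => v (AffineMap.lineMap a b s) i) (Icc 0 1) :=
      fun i => (EuclideanSpace.proj i : Plane →L[ℝ] ℝ).continuous.comp_continuousOn h1
    exact ((h2 0).mul continuousOn_const).sub ((h2 1).mul continuousOn_const)
  unfold edgeFlux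
  rw [← intervalIntegral.integral_sub (hint v hv) (hint w hw), ← Real.norm_eq_abs]
  refine (intervalIntegral.norm_integral_le_of_norm_le_const (C := 2 * A * dist a b) ?_).trans_eq
    (by simp)
  intro s hs
  rw [uIoc_of_le zero_le_one] at hs
  have hx := hmem s ⟨hs.1.le, hs.2⟩
  set x : Plane := AffineMap.lineMap a b s
  have hd : ∀ i, |b i - a i| ≤ dist a b := fun i => by
    rw [dist_comm, dist_eq_norm]; exact abs_apply_le_norm (b - a) i
  have e : v x 0 * (b 1 - a 1) - v x 1 * (b 0 - a 0) -
      (w x 0 * (b 1 - a 1) - w x 1 * (b 0 - a 0)) =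
      (v x 0 - w x 0) * (b 1 - a 1) - (v x 1 - w x 1) * (b 0 - a 0) := by ring
  rw [e, Real.norm_eq_abs]
  have hA : 0 ≤ A := (abs_nonneg _).trans (h x hx 0)
  refine (abs_sub _ _).trans ?_
  rw [abs_mul, abs_mul]
  have e0 := mul_le_mul (h x hx 0) (hd 1) (abs_nonneg _) hA
  have e1 := mul_le_mul (h x hx 1) (hd 0) (abs_nonneg _) hA
  linarith

/-! ### The mean of two interpolants at the midpoint of a common edge -/

/-- The determinant of `A u` and `v`. -/
def detForm (A : Fin 2 → Fin 2 → ℝ) (u v : Plane) : ℝ :=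
  (A 0 0 * u 0 + A 0 1 * u 1) * v 1 - (A 1 0 * u 0 + A 1 1 * u 1) * v 0

lemma abs_detForm_le {A : Fin 2 → Fin 2 → ℝ} {L U V : ℝ} {u v : Plane} (hA : ∀ i j, |A i j| ≤ L)
    (hu : ∀ i, |u i| ≤ U) (hv : ∀ i, |v i| ≤ V) : |detForm A u v| ≤ 4 * L * U * V := by
  have hL : 0 ≤ L := (abs_nonneg _).trans (hA 0 0)
  have hU : 0 ≤ U := (abs_nonneg _).trans (hu 0)
  have key : ∀ i j k l, |A i j * u k * v l| ≤ L * U * V := fun i j k l => by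
    rw [abs_mul, abs_mul]
    exact mul_le_mul (mul_le_mul (hA i j) (hu k) (abs_nonneg _) hL) (hv l) (abs_nonneg _)
      (by positivity)
  have e : detForm A u v = A 0 0 * u 0 * v 1 + A 0 1 * u 1 * v 1 - A 1 0 * u 0 * v 0 -
      A 1 1 * u 1 * v 0 := by unfold detForm; ring
  have h1 := abs_le.1 (key 0 0 0 1)
  have h2 := abs_le.1 (key 0 1 1 1)
  have h3 := abs_le.1 (key 1 0 0 0)
  have h4 := abs_le.1 (key 1 1 1 0)
  rw [e, abs_le]
  constructor <;> linarith [h1.1, h1.2, h2.1, h2.2, h3.1, h3.2, h4.1, h4.2]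

/-- The defect of the interpolant of an affine field at the midpoint of an edge. -/
def defect (A : Fin 2 → Fin 2 → ℝ) (a b c : Plane) : ℝ :=
  detForm A (c - mid a b) (c - mid a b) -
    detForm A ((1 / 2 : ℝ) • (b - a)) ((1 / 2 : ℝ) • (b - a))

/-- By the midpoint rule the flux through `ab` fixes the normal component at the midpoint for both
fields, so the error is tangential. What matters is its coefficient: the numerator is even in `c -
mid a b`, the denominator changes sign across the edge. -/
lemma rtField_affField_mid {a b c : Plane} (h : cr a b c ≠ 0) (c₀ : Fin 2 → ℝ)
    (A : Fin 2 → Fin 2 → ℝ) (i : Fin 2) :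
    rtField a b c (edgeFlux (affField c₀ A) a b) (edgeFlux (affField c₀ A) b c)
      (edgeFlux (affField c₀ A) c a) (mid a b) i =
      affField c₀ A (mid a b) i + defect A a b c / cr a b c * ((b i - a i) / 2) := by
  rw [rtField_apply]
  simp only [edgeFlux_affField, affField_apply, mid_apply, defect, detForm, PiLp.sub_apply,
    PiLp.smul_apply, smul_eq_mul]
  field_simp
  fin_cases i
  · simp only [cr, Fin.zero_eta]; ring
  · simp only [cr, Fin.mk_one]; ring

lemma abs_rtField_sub_le {a b c x : Plane} {F₁ F₂ F₃ G₁ G₂ G₃ U V J : ℝ} (hJ : 0 < J)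
    (hcr : J ≤ |cr a b c|) (h1 : |F₁ - G₁| ≤ U) (h2 : |F₂ - G₂| ≤ U) (h3 : |F₃ - G₃| ≤ U)
    {i : Fin 2} (ha : |x i - a i| ≤ V) (hb : |x i - b i| ≤ V) (hc : |x i - c i| ≤ V) :
    |rtField a b c F₁ F₂ F₃ x i - rtField a b c G₁ G₂ G₃ x i| ≤ 3 * U * V / J := by
  have hU : 0 ≤ U := (abs_nonneg _).trans h1
  have hV : 0 ≤ V := (abs_nonneg _).trans ha
  have e : rtField a b c F₁ F₂ F₃ x i - rtField a b c G₁ G₂ G₃ x i =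
      ((F₁ - G₁) * (x i - c i) + (F₂ - G₂) * (x i - a i) + (F₃ - G₃) * (x i - b i)) /
        cr a b c := by
    rw [rtField_apply, rtField_apply]; ring
  have key : ∀ p q : ℝ, |p| ≤ U → |q| ≤ V → |p * q| ≤ U * V := fun p q hp hq => by
    rw [abs_mul]; exact mul_le_mul hp hq (abs_nonneg _) hU
  rw [e, abs_div]
  refine div_le_div₀ (by positivity) ?_ hJ hcr
  have e1 := key _ _ h1 hc
  have e2 := key _ _ h2 ha
  have e3 := key _ _ h3 hb
  refine (abs_add_le _ _).trans ?_
  linarith [abs_add_le ((F₁ - G₁) * (x i - c i)) ((F₂ - G₂) * (x i - a i))]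

/-- The interpolant with the fluxes of `v`. -/
def rtOf (a b c : Plane) (v : Plane → Plane) : Plane → Plane :=
  rtField a b c (edgeFlux v a b) (edgeFlux v b c) (edgeFlux v c a)

lemma coord_dist_le (x y : Plane) (i : Fin 2) : |x i - y i| ≤ dist x y := by
  rw [dist_eq_norm]; exact abs_apply_le_norm (x - y) i

/-- Sup norm stability: fluxes differ by at most `2 * K * (k * ℓ)`, each basis field is at most `k *
ℓ` divided by `|cr a b c| ≥ ℓ ^ 2 / k`, and there are three of them. -/
lemma abs_rtOf_mid_sub_le {a b c : Plane} {k ℓ : ℝ} (hk : 0 < k) (hℓ : 0 < ℓ)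
    (hab : dist a b ≤ k * ℓ) (hac : dist a c ≤ k * ℓ) (hbc : dist b c ≤ k * ℓ)
    (hcr : ℓ ^ 2 ≤ k * |cr a b c|) {v w : Plane → Plane} (hv : ContinuousOn v (hull {a, b, c}))
    (hw : Continuous w) {K : ℝ} (h : ∀ x ∈ hull {a, b, c}, ∀ i, |v x i - w x i| ≤ K)
    (i : Fin 2) : |rtOf a b c v (mid a b) i - rtOf a b c w (mid a b) i| ≤ 6 * k ^ 3 * K := by
  have ha : a ∈ hull {a, b, c} := subset_hull (by simp)
  have hb : b ∈ hull {a, b, c} := subset_hull (by simp)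
  have hc : c ∈ hull {a, b, c} := subset_hull (by simp)
  have hK : 0 ≤ K := (abs_nonneg _).trans (h a ha 0)
  have hF : ∀ x ∈ hull {a, b, c}, ∀ y ∈ hull {a, b, c}, dist x y ≤ k * ℓ →
      |edgeFlux v x y - edgeFlux w x y| ≤ 2 * K * (k * ℓ) := fun x hx y hy hxy =>
    (abs_edgeFlux_sub_le (convex_hull _) hv hw.continuousOn h hx hy).trans (by gcongr)
  have ca := abs_le.1 ((coord_dist_le a b i).trans hab)
  have cb := abs_le.1 ((coord_dist_le a c i).trans hac)
  have cc := abs_le.1 ((coord_dist_le b c i).trans hbc)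
  have hJ : ℓ ^ 2 / k ≤ |cr a b c| := by rw [div_le_iff₀ hk]; linarith
  refine (abs_rtField_sub_le (J := ℓ ^ 2 / k) (U := 2 * K * (k * ℓ)) (V := k * ℓ) (by positivity) hJ
    (hF a ha b hb hab) (hF b hb c hc hbc) (hF c hc a ha (by rwa [dist_comm])) ?_ ?_ ?_).trans_eq ?_
  · rw [mid_apply, abs_le]; constructor <;> linarith
  · rw [mid_apply, abs_le]; constructor <;> linarith
  · rw [mid_apply, abs_le]; constructor <;> linarith
  · field_simp; ring

/-- From `N / J + N' / J' = (N (J + J') + (N' - N) J) / (J J')`: the sum is small when `N'` is close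
to `N` and `J'` close to `-J`. -/
lemma abs_div_add_div_le {N N' J J' n s t j k ℓ : ℝ} (hℓ : 0 < ℓ) (hk : 0 < k)
    (hJ : ℓ ^ 2 ≤ k * |J|) (hJ' : ℓ ^ 2 ≤ k * |J'|) (hN : |N| ≤ n) (hs : |J + J'| ≤ s)
    (ht : |N' - N| ≤ t) (hj : |J| ≤ j) :
    |N / J + N' / J'| ≤ (n * s + t * j) * (k ^ 2 / ℓ ^ 4) := by
  have hJ0 : 0 < |J| := by
    by_contra hneg
    nlinarith [pow_pos hℓ 2]
  have hJ0' : 0 < |J'| := by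
    by_contra hneg
    nlinarith [pow_pos hℓ 2]
  have h1 := abs_pos.1 hJ0
  have h2 := abs_pos.1 hJ0'
  have hn : 0 ≤ n := (abs_nonneg _).trans hN
  have hs0 : 0 ≤ s := (abs_nonneg _).trans hs
  have ht0 : 0 ≤ t := (abs_nonneg _).trans ht
  have hj0 : 0 ≤ j := (abs_nonneg _).trans hj
  have e : N / J + N' / J' = (N * (J + J') + (N' - N) * J) / (J * J') := by
    field_simp; ring
  rw [e, abs_div, div_le_iff₀ (abs_pos.2 (mul_ne_zero h1 h2)), abs_mul]
  have hnum : |N * (J + J') + (N' - N) * J| ≤ n * s + t * j := by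
    refine (abs_add_le _ _).trans ?_
    rw [abs_mul, abs_mul]
    exact add_le_add (mul_le_mul hN hs (abs_nonneg _) hn) (mul_le_mul ht hj (abs_nonneg _) ht0)
  have hden : 1 ≤ k ^ 2 / ℓ ^ 4 * (|J| * |J'|) := by
    rw [div_mul_eq_mul_div, one_le_div (by positivity)]
    calc ℓ ^ 4 = ℓ ^ 2 * ℓ ^ 2 := by ring
      _ ≤ (k * |J|) * (k * |J'|) := mul_le_mul hJ hJ' (by positivity) (by positivity)
      _ = _ := by ring
  calc _ ≤ (n * s + t * j) * 1 := by rw [mul_one]; exact hnum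
    _ ≤ (n * s + t * j) * (k ^ 2 / ℓ ^ 4 * (|J| * |J'|)) := by gcongr
    _ = _ := by ring

namespace IsPatch

variable {k ℓ : ℝ} {a b c d : Plane}

/-- The superconvergence. Both the sum of the signed areas and the difference of the two defects are
linear in `δ = c + d - a - b`, which vanishes for a parallelogram. -/
lemma abs_defect_sum_le (hp : IsPatch k ℓ a b c d) {A : Fin 2 → Fin 2 → ℝ} {L Δ : ℝ}
    (hA : ∀ i j, |A i j| ≤ L) (hΔ : ∀ i, |c i + d i - a i - b i| ≤ Δ) (i : Fin 2) :
    |(defect A a b c / cr a b c + defect A a b d / cr a b d) * ((b i - a i) / 2)| ≤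
      12 * k ^ 5 * L * Δ := by
  have hk := hp.one_le
  have hℓ := hp.pos
  have hk0 : 0 < k := by linarith
  have hL : 0 ≤ L := (abs_nonneg _).trans (hA 0 0)
  have hΔ0 : 0 ≤ Δ := (abs_nonneg _).trans (hΔ 0)
  have cab : ∀ i, |a i - b i| ≤ ℓ := fun i => (coord_dist_le a b i).trans hp.dist_ab
  have hw : ∀ p, dist a p ≤ k * ℓ → dist b p ≤ k * ℓ → ∀ i, |(p - mid a b) i| ≤ k * ℓ := by
    intro p h1 h2 i
    have e1 := abs_le.1 ((coord_dist_le a p i).trans h1)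
    have e2 := abs_le.1 ((coord_dist_le b p i).trans h2)
    rw [PiLp.sub_apply, mid_apply, abs_le]
    constructor <;> linarith
  have hwc := hw c hp.dist_ac hp.dist_bc
  have hwd := hw d hp.dist_ad hp.dist_bd
  have hf : ∀ i, |((1 / 2 : ℝ) • (b - a)) i| ≤ k * ℓ := fun i => by
    have e1 := abs_le.1 (cab i)
    have e2 : ℓ ≤ k * ℓ := le_mul_of_one_le_left hℓ.le hk
    simp only [PiLp.smul_apply, PiLp.sub_apply, smul_eq_mul]
    rw [abs_le]
    constructor <;> linarith
  set δ : Plane := c + d - a - b with hδ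
  have hδi : ∀ i, |δ i| ≤ Δ := hΔ
  have hN : |defect A a b c| ≤ 8 * L * (k * ℓ) ^ 2 := by
    refine (abs_sub _ _).trans ?_
    have e1 := abs_detForm_le hA hwc hwc
    have e2 := abs_detForm_le hA hf hf
    linarith
  have hs : |cr a b c + cr a b d| ≤ 2 * ℓ * Δ := by
    have e : cr a b c + cr a b d = (b 0 - a 0) * (c 1 + d 1 - a 1 - b 1) -
      (b 1 - a 1) * (c 0 + d 0 - a 0 - b 0) := by unfold cr; ring
    rw [e]
    refine (abs_sub _ _).trans ?_
    rw [abs_mul, abs_mul, abs_sub_comm (b 0), abs_sub_comm (b 1)]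
    have e1 := mul_le_mul (cab 0) (hΔ 1) (abs_nonneg _) hℓ.le
    have e2 := mul_le_mul (cab 1) (hΔ 0) (abs_nonneg _) hℓ.le
    linarith
  have ht : |defect A a b d - defect A a b c| ≤ 8 * L * (k * ℓ) * Δ := by
    -- As `δ` is the sum of `c - mid a b` and `d - mid a b`, this is the polarisation `Q(v, v) -
    -- Q(u, u) = Q(u + v, v) - Q(u, u + v)`.
    have e : defect A a b d - defect A a b c =
        detForm A δ (d - mid a b) - detForm A (c - mid a b) δ := by
      simp only [defect, detForm, hδ, PiLp.sub_apply, PiLp.add_apply, mid_apply, PiLp.smul_apply,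
        smul_eq_mul]
      ring
    rw [e]
    refine (abs_sub _ _).trans ?_
    have e1 := abs_detForm_le hA hδi hwd
    have e2 := abs_detForm_le hA hwc hδi
    linarith
  have hj : |cr a b c| ≤ k * ℓ ^ 2 := by
    refine (abs_cr_le a b c).trans ?_
    calc dist a b * dist a c ≤ ℓ * (k * ℓ) :=
          mul_le_mul hp.dist_ab hp.dist_ac dist_nonneg hℓ.le
      _ = _ := by ring
  have hsum := abs_div_add_div_le hℓ hk0 hp.le_cr hp.le_cr' hN hs ht hj
  have hfi : |(b i - a i) / 2| ≤ ℓ / 2 := by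
    rw [abs_div, abs_two, abs_sub_comm]; linarith [cab i]
  rw [abs_mul]
  calc _ ≤ ((8 * L * (k * ℓ) ^ 2 * (2 * ℓ * Δ) + 8 * L * (k * ℓ) * Δ * (k * ℓ ^ 2)) *
        (k ^ 2 / ℓ ^ 4)) * (ℓ / 2) := mul_le_mul hsum hfi (abs_nonneg _) (by positivity)
    _ = 12 * k ^ 4 * L * Δ := by field_simp; ring
    _ ≤ 12 * k ^ 5 * L * Δ := by
        gcongr
        norm_num

/-- The mean of the interpolants at the midpoint of the common edge is close to the value of an
affine field close to the interpolated functions. -/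
lemma abs_mean_sub_le (hp : IsPatch k ℓ a b c d) {v v' : Plane → Plane} {c₀ : Fin 2 → ℝ}
    {A : Fin 2 → Fin 2 → ℝ} {L Δ K : ℝ} (hA : ∀ i j, |A i j| ≤ L)
    (hΔ : ∀ i, |c i + d i - a i - b i| ≤ Δ) (hv : ContinuousOn v (hull {a, b, c}))
    (hv' : ContinuousOn v' (hull {a, b, d}))
    (h : ∀ x ∈ hull {a, b, c}, ∀ i, |v x i - affField c₀ A x i| ≤ K)
    (h' : ∀ x ∈ hull {a, b, d}, ∀ i, |v' x i - affField c₀ A x i| ≤ K) (i : Fin 2) :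
    |(rtOf a b c v (mid a b) i + rtOf a b d v' (mid a b) i) / 2 - affField c₀ A (mid a b) i| ≤
      6 * k ^ 5 * (K + L * Δ) := by
  have hk := hp.one_le
  have hk0 : 0 < k := by linarith
  have hab : dist a b ≤ k * ℓ := hp.dist_ab.trans (le_mul_of_one_le_left hp.pos.le hk)
  have hK : 0 ≤ K := (abs_nonneg _).trans (h a (subset_hull (by simp)) 0)
  have e1 := abs_le.1 (abs_rtOf_mid_sub_le hk0 hp.pos hab hp.dist_ac hp.dist_bc hp.le_cr hv
    (continuous_affField c₀ A) h i)
  have e2 := abs_le.1 (abs_rtOf_mid_sub_le hk0 hp.pos hab hp.dist_ad hp.dist_bd hp.le_cr' hv'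
    (continuous_affField c₀ A) h' i)
  have e3 := abs_le.1 (hp.abs_defect_sum_le hA hΔ i)
  have f1 : rtOf a b c (affField c₀ A) (mid a b) i = _ := rtField_affField_mid hp.ne c₀ A i
  have f2 : rtOf a b d (affField c₀ A) (mid a b) i = _ := rtField_affField_mid hp.ne' c₀ A i
  have hkk : 6 * k ^ 3 * K ≤ 6 * k ^ 5 * K := by
    gcongr
    norm_num
  rw [add_mul] at e3
  rw [f1] at e1
  rw [f2] at e2
  rw [abs_le]
  constructor <;> linarith [e1.1, e1.2, e2.1, e2.2, e3.1, e3.2]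

/-- If opposite sides of the union of the two triangles have almost the same lengths, then it is
almost a parallelogram. -/
lemma abs_diag_le (hp : IsPatch k ℓ a b c d) {ε : ℝ} (h1 : |dist a c - dist b d| ≤ ε)
    (h2 : |dist b c - dist a d| ≤ ε) (i : Fin 2) : |c i + d i - a i - b i| ≤ 2 * k ^ 3 * ε := by
  have hk := hp.one_le
  have hk0 : 0 < k := by linarith
  have hℓ := hp.pos
  have hε : 0 ≤ ε := (abs_nonneg _).trans h1
  have hsq : ∀ x y z w : Plane, |dist x y - dist z w| ≤ ε → dist x y ≤ k * ℓ → dist z w ≤ k * ℓ →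
      |dist x y ^ 2 - dist z w ^ 2| ≤ ε * (2 * (k * ℓ)) := by
    intro x y z w hd hx hz
    have e : dist x y ^ 2 - dist z w ^ 2 = (dist x y - dist z w) * (dist x y + dist z w) := by ring
    rw [e, abs_mul, abs_of_nonneg (add_nonneg dist_nonneg dist_nonneg)]
    exact mul_le_mul hd (by linarith) (by positivity) hε
  have s1 := hsq a c b d h1 hp.dist_ac hp.dist_bd
  have s2 := hsq b c a d h2 hp.dist_bc hp.dist_ad
  rw [dist_sq_plane, dist_sq_plane] at s1 s2
  -- A difference of squared lengths of opposite sides factors as `δ · P`, respectively `δ · Q`,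
  -- where `P` and `Q` are sums of side vectors. Both products are small, and Cramer's rule recovers
  -- `δ`.
  set δ : Fin 2 → ℝ := fun i => c i + d i - a i - b i with hδ
  set P : Fin 2 → ℝ := fun i => (c i - a i) + (b i - d i) with hP
  set Q : Fin 2 → ℝ := fun i => (c i - b i) + (a i - d i) with hQ
  have t1 : |δ 0 * P 0 + δ 1 * P 1| ≤ ε * (2 * (k * ℓ)) := by
    convert s1 using 2; simp only [hδ, hP]; ring
  have t2 : |δ 0 * Q 0 + δ 1 * Q 1| ≤ ε * (2 * (k * ℓ)) := by
    convert s2 using 2; simp only [hδ, hQ]; ring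
  have hPb : ∀ i, |P i| ≤ 2 * (k * ℓ) := fun i => by
    have e1 := abs_le.1 ((coord_dist_le a c i).trans hp.dist_ac)
    have e2 := abs_le.1 ((coord_dist_le b d i).trans hp.dist_bd)
    simp only [hP, abs_le]
    constructor <;> linarith
  have hQb : ∀ i, |Q i| ≤ 2 * (k * ℓ) := fun i => by
    have e1 := abs_le.1 ((coord_dist_le b c i).trans hp.dist_bc)
    have e2 := abs_le.1 ((coord_dist_le a d i).trans hp.dist_ad)
    simp only [hQ, abs_le]
    constructor <;> linarith
  -- The two signed areas have opposite signs, so they add up and the system for `δ` is well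
  -- conditioned.
  have hdet : P 0 * Q 1 - P 1 * Q 0 = 2 * (cr a b c - cr a b d) := by
    simp only [hP, hQ, cr]; ring
  have habs : |cr a b c - cr a b d| = |cr a b c| + |cr a b d| := by
    rcases mul_neg_iff.1 hp.neg with ⟨h3, h4⟩ | ⟨h3, h4⟩
    · rw [abs_of_pos h3, abs_of_neg h4, abs_of_pos (by linarith)]; ring
    · rw [abs_of_neg h3, abs_of_pos h4, abs_of_neg (by linarith)]; ring
  have hlow : 4 * ℓ ^ 2 ≤ k * |P 0 * Q 1 - P 1 * Q 0| := by
    rw [hdet, abs_mul, abs_two, habs]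
    linarith [hp.le_cr, hp.le_cr']
  have key : |δ i| * |P 0 * Q 1 - P 1 * Q 0| ≤ 8 * k ^ 2 * ℓ ^ 2 * ε := by
    have hmul : ∀ x y : ℝ, |x| ≤ ε * (2 * (k * ℓ)) → |y| ≤ 2 * (k * ℓ) →
        |x * y| ≤ ε * (2 * (k * ℓ)) * (2 * (k * ℓ)) := fun x y hx hy => by
      rw [abs_mul]; exact mul_le_mul hx hy (abs_nonneg _) (by positivity)
    rw [← abs_mul]
    fin_cases i
    · have e : δ 0 * (P 0 * Q 1 - P 1 * Q 0) =
        (δ 0 * P 0 + δ 1 * P 1) * Q 1 - (δ 0 * Q 0 + δ 1 * Q 1) * P 1 := by ring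
      change |δ 0 * (P 0 * Q 1 - P 1 * Q 0)| ≤ _
      rw [e]
      refine (abs_sub _ _).trans ?_
      linarith [hmul _ _ t1 (hQb 1), hmul _ _ t2 (hPb 1)]
    · have e : δ 1 * (P 0 * Q 1 - P 1 * Q 0) =
        (δ 0 * Q 0 + δ 1 * Q 1) * P 0 - (δ 0 * P 0 + δ 1 * P 1) * Q 0 := by ring
      change |δ 1 * (P 0 * Q 1 - P 1 * Q 0)| ≤ _
      rw [e]
      refine (abs_sub _ _).trans ?_
      linarith [hmul _ _ t1 (hQb 0), hmul _ _ t2 (hPb 0)]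
  change |δ i| ≤ _
  have h5 : |δ i| * (4 * ℓ ^ 2) ≤ (2 * k ^ 3 * ε) * (4 * ℓ ^ 2) := by
    calc |δ i| * (4 * ℓ ^ 2) ≤ |δ i| * (k * |P 0 * Q 1 - P 1 * Q 0|) := by gcongr
      _ = k * (|δ i| * |P 0 * Q 1 - P 1 * Q 0|) := by ring
      _ ≤ k * (8 * k ^ 2 * ℓ ^ 2 * ε) := by gcongr
      _ = _ := by ring
  exact le_of_mul_le_mul_right h5 (by positivity)

lemma abs_diag_le_trivial (hp : IsPatch k ℓ a b c d) (i : Fin 2) :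
    |c i + d i - a i - b i| ≤ 2 * k * ℓ := by
  have e1 := abs_le.1 ((coord_dist_le a c i).trans hp.dist_ac)
  have e2 := abs_le.1 ((coord_dist_le b d i).trans hp.dist_bd)
  rw [abs_le]
  constructor <;> linarith

end IsPatch

/-! ### Affine functions determined by the values at the midpoints -/

lemma edgeMid_pair {a b : Plane} (hab : a ≠ b) : edgeMid {a, b} = mid a b := by
  rw [edgeMid, Finset.sum_pair hab, smul_add, mid]

lemma exists_affineMap_vertices {a b c : Plane} (h : cr a b c ≠ 0) (U V W : Plane) :
    ∃ g : Plane →ᵃ[ℝ] Plane, g a = U ∧ g b = V ∧ g c = W := by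
  let p : Fin 2 → (Plane →ₗ[ℝ] ℝ) := fun i => (EuclideanSpace.proj i : Plane →L[ℝ] ℝ)
  have hp : ∀ i x, p i x = x i := fun i x => rfl
  let lb : Plane →ₗ[ℝ] ℝ := (cr a b c)⁻¹ • ((c 1 - a 1) • p 0 - (c 0 - a 0) • p 1)
  let lc : Plane →ₗ[ℝ] ℝ := (cr a b c)⁻¹ • ((b 0 - a 0) • p 1 - (b 1 - a 1) • p 0)
  let g : Plane →ₗ[ℝ] Plane := lb.smulRight (V - U) + lc.smulRight (W - U)
  have hg : ∀ x, g x = lb x • (V - U) + lc x • (W - U) := fun x => rfl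
  have hlb : ∀ x, lb x = (cr a b c)⁻¹ * ((c 1 - a 1) * x 0 - (c 0 - a 0) * x 1) := fun x => rfl
  have hlc : ∀ x, lc x = (cr a b c)⁻¹ * ((b 0 - a 0) * x 1 - (b 1 - a 1) * x 0) := fun x => rfl
  refine ⟨g.toAffineMap + AffineMap.const ℝ Plane (U - g a), ?_, ?_, ?_⟩
  · simp
  · have e1 : lb b - lb a = 1 := by
      rw [hlb, hlb]; field_simp; unfold cr; ring
    have e2 : lc b - lc a = 0 := by
      rw [hlc, hlc]; field_simp; ring
    simp only [AffineMap.coe_add, LinearMap.coe_toAffineMap, AffineMap.coe_const, Pi.add_apply,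
      Function.const_apply, hg]
    rw [eq_add_of_sub_eq e1, eq_add_of_sub_eq e2]
    module
  · have e1 : lb c - lb a = 0 := by
      rw [hlb, hlb]; field_simp; ring
    have e2 : lc c - lc a = 1 := by
      rw [hlc, hlc]; field_simp; unfold cr; ring
    simp only [AffineMap.coe_add, LinearMap.coe_toAffineMap, AffineMap.coe_const, Pi.add_apply,
      Function.const_apply, hg]
    rw [eq_add_of_sub_eq e1, eq_add_of_sub_eq e2]
    module

lemma affineMap_mid (g : Plane →ᵃ[ℝ] Plane) (a b : Plane) :
    g (mid a b) = (1 / 2 : ℝ) • g a + (1 / 2 : ℝ) • g b := by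
  have e : mid a b = AffineMap.lineMap a b (1 / 2 : ℝ) := by
    rw [AffineMap.lineMap_apply, mid, vsub_eq_sub, vadd_eq_add]; module
  rw [e, AffineMap.apply_lineMap, AffineMap.lineMap_apply, vsub_eq_sub, vadd_eq_add]
  module

/-- The value at a vertex is the sum of the values at the midpoints of its two edges minus the value
at the third midpoint. -/
lemma exists_affineMap_mids {a b c : Plane} (h : cr a b c ≠ 0) (U V W : Plane) :
    ∃ g : Plane →ᵃ[ℝ] Plane, g (mid a b) = U ∧ g (mid b c) = V ∧ g (mid a c) = W := by
  obtain ⟨g, ha, hb, hc⟩ := exists_affineMap_vertices h (U + W - V) (U + V - W) (V + W - U)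
  refine ⟨g, ?_, ?_, ?_⟩ <;>
  · simp only [affineMap_mid, ha, hb, hc]
    module

lemma affineMap_combo (g : Plane →ᵃ[ℝ] Plane) (a b c : Plane) {u v w : ℝ} (h : u + v + w = 1) :
    g (u • a + v • b + w • c) = u • g a + v • g b + w • g c := by
  obtain rfl : u = 1 - v - w := by linarith
  have e : ∀ x, g x = g.linear x + g 0 := fun x => by
    have := g.map_vadd 0 x
    simpa using this
  simp only [e (_ + _), e a, e b, e c, map_add, map_smul]
  module

/-- An affine map which is close to an affine field at the midpoints of the edges is close to it on
the whole triangle. -/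
lemma abs_affineMap_sub_le {a b c : Plane} (g : Plane →ᵃ[ℝ] Plane) (c₀ : Fin 2 → ℝ)
    (A : Fin 2 → Fin 2 → ℝ) {i : Fin 2} {Y : ℝ}
    (h1 : |g (mid a b) i - affField c₀ A (mid a b) i| ≤ Y)
    (h2 : |g (mid b c) i - affField c₀ A (mid b c) i| ≤ Y)
    (h3 : |g (mid a c) i - affField c₀ A (mid a c) i| ≤ Y) {x : Plane}
    (hx : x ∈ hull {a, b, c}) : |g x i - affField c₀ A x i| ≤ 3 * Y := by
  obtain ⟨u, v, w, hu, hv, hw, hs, rfl⟩ := mem_hull_iff.1 hx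
  have haff : affField c₀ A (u • a + v • b + w • c) i = u * affField c₀ A a i +
      v * affField c₀ A b i + w * affField c₀ A c i := by
    obtain rfl : u = 1 - v - w := by linarith
    simp only [affField_apply, combo_apply]; ring
  have hm : ∀ p q, affField c₀ A (mid p q) i = (affField c₀ A p i + affField c₀ A q i) / 2 := by
    intro p q
    simp only [affField_apply, mid_apply]; ring
  have hg : ∀ p q, g (mid p q) i = (g p i + g q i) / 2 := by
    intro p q
    rw [affineMap_mid]; simp; ring
  rw [affineMap_combo g a b c hs, haff, combo_apply]
  rw [hm, hg, abs_le] at h1 h2 h3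
  -- Each vertex error is a combination of the three midpoint errors with coefficients `±1`, whence
  -- the factor `3`; convexity does the rest.
  have ea : |g a i - affField c₀ A a i| ≤ 3 * Y := abs_le.2 ⟨by linarith, by linarith⟩
  have eb : |g b i - affField c₀ A b i| ≤ 3 * Y := abs_le.2 ⟨by linarith, by linarith⟩
  have ec : |g c i - affField c₀ A c i| ≤ 3 * Y := abs_le.2 ⟨by linarith, by linarith⟩
  have e : u * g a i + v * g b i + w * g c i - (u * affField c₀ A a i + v * affField c₀ A b i +
      w * affField c₀ A c i) = u * (g a i - affField c₀ A a i) + v * (g b i - affField c₀ A b i) +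
      w * (g c i - affField c₀ A c i) := by ring
  rw [e]
  have key : ∀ s r : ℝ, 0 ≤ s → |r| ≤ 3 * Y → |s * r| ≤ s * (3 * Y) := fun s r hs hr => by
    rw [abs_mul, abs_of_nonneg hs]; exact mul_le_mul_of_nonneg_left hr hs
  calc _ ≤ |u * (g a i - affField c₀ A a i)| + |v * (g b i - affField c₀ A b i)| +
        |w * (g c i - affField c₀ A c i)| := abs_add_three _ _ _
    _ ≤ u * (3 * Y) + v * (3 * Y) + w * (3 * Y) :=
        add_le_add (add_le_add (key _ _ hu ea) (key _ _ hv eb)) (key _ _ hw ec)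
    _ = 3 * Y := by rw [← add_mul, ← add_mul, hs, one_mul]

/-! ### Elements and edges of a triangulation -/

lemma triple_rotate (a b c : Plane) : ({a, b, c} : Finset Plane) = {b, c, a} := by
  ext x; simp only [Finset.mem_insert, Finset.mem_singleton]; tauto

lemma triple_swap (a b c : Plane) : ({a, b, c} : Finset Plane) = {b, a, c} := by
  ext x; simp only [Finset.mem_insert, Finset.mem_singleton]; tauto

lemma triple_ne {a b c : Plane} (h : ({a, b, c} : Finset Plane).card = 3) :
    a ≠ b ∧ a ≠ c ∧ b ≠ c := by
  refine ⟨?_, ?_, ?_⟩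
  · rintro rfl
    have := Finset.card_le_two (a := a) (b := c)
    simp at h
    omega
  · rintro rfl
    have := Finset.card_le_two (a := b) (b := a)
    rw [triple_swap, Finset.pair_eq_singleton] at h
    omega
  · rintro rfl
    have := Finset.card_le_two (a := a) (b := b)
    rw [Finset.pair_eq_singleton] at h
    omega

lemma exists_eq_triple {e t : Finset Plane} (he : e.card = 2) (ht : t.card = 3) (het : e ⊆ t) :
    ∃ a b c, e = {a, b} ∧ t = {a, b, c} := by
  obtain ⟨a, b, hab, rfl⟩ := Finset.card_eq_two.1 he
  have h1 : (t \ {a, b}).card = 1 := by rw [Finset.card_sdiff_of_subset het, ht, he]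
  obtain ⟨c, hc⟩ := Finset.card_eq_one.1 h1
  refine ⟨a, b, c, rfl, ?_⟩
  rw [← Finset.sdiff_union_of_subset het, hc]
  ext x; simp only [Finset.mem_union, Finset.mem_insert, Finset.mem_singleton]; tauto

lemma hull_mono {s t : Finset Plane} (h : s ⊆ t) : hull s ⊆ hull t :=
  convexHull_mono (by exact_mod_cast h)

lemma not_closedBall_subset_hull_pair {a b : Plane} (hab : a ≠ b) {x : Plane} {r : ℝ}
    (hr : 0 < r) : ¬ closedBall x r ⊆ hull {a, b} := by
  intro h
  have e : ({a, b} : Finset Plane) = {a, b, b} := by simp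
  rw [e] at h
  have := le_abs_cr_of_closedBall_subset hr.le h
  rw [cr_self_right, abs_zero] at this
  have : 0 < 2 * r * dist a b := mul_pos (by linarith) (dist_pos.2 hab)
  linarith

namespace Triangulation

variable {Ω : Set Plane} (T : Triangulation Ω)

lemma mem_elems {t : Finset Plane} : t ∈ T.elems ↔ t ∈ T.faces ∧ t.card = 3 := by
  simp [elems]

lemma mem_star {t e : Finset Plane} : t ∈ T.star e ↔ t ∈ T.elems ∧ e ⊆ t := by
  simp [star]

lemma hull_subset_closure {t : Finset Plane} (ht : t ∈ T.elems) : hull t ⊆ closure Ω := by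
  rw [← T.cover]
  exact T.toSimplicialComplex.convexHull_subset_space (T.mem_elems.1 ht).1

lemma interior_hull_subset (hΩ : interior (closure Ω) = Ω) {t : Finset Plane}
    (ht : t ∈ T.elems) : interior (hull t) ⊆ Ω := by
  conv_rhs => rw [← hΩ]
  exact interior_mono (T.hull_subset_closure ht)

variable {T} {γ : ℝ}

lemma hull_inter_subset {s t : Finset Plane} (hs : s ∈ T.elems) (ht : t ∈ T.elems) :
    hull s ∩ hull t ⊆ hull (s ∩ t) := by
  have := T.inter_subset_convexHull (T.mem_elems.1 hs).1 (T.mem_elems.1 ht).1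
  simpa [hull] using this

lemma triple_ne_of_mem {a b c : Plane} (h : {a, b, c} ∈ T.elems) : a ≠ b ∧ a ≠ c ∧ b ≠ c :=
  triple_ne (T.mem_elems.1 h).2

lemma dist_le_diam {t : Finset Plane} {x y : Plane} (hx : x ∈ t) (hy : y ∈ t) :
    dist x y ≤ diam (hull t) :=
  dist_le_diam_of_mem (isCompact_hull t).isBounded (subset_hull hx) (subset_hull hy)

lemma diam_pos {t : Finset Plane} (ht : t ∈ T.elems) : 0 < diam (hull t) := by
  have h3 : 1 < t.card := by rw [(T.mem_elems.1 ht).2]; norm_num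
  obtain ⟨x, hx, y, hy, hxy⟩ := Finset.one_lt_card.1 h3
  exact (dist_pos.2 hxy).trans_le (dist_le_diam hx hy)

lemma le_abs_cr (hγ : 0 < γ) (hT : T.ShapeRegular γ) {a b c : Plane} (h : {a, b, c} ∈ T.elems) :
    2 * (diam (hull {a, b, c}) / γ) * dist a b ≤ |cr a b c| := by
  obtain ⟨x, hx⟩ := hT _ h
  exact le_abs_cr_of_closedBall_subset (div_nonneg diam_nonneg hγ.le) hx

lemma cr_ne_zero (hγ : 0 < γ) (hT : T.ShapeRegular γ) {a b c : Plane} (h : {a, b, c} ∈ T.elems) :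
    cr a b c ≠ 0 := by
  intro h0
  have h1 := le_abs_cr hγ hT h
  have h2 := diam_pos h
  have h3 := dist_pos.2 (triple_ne_of_mem h).1
  rw [h0, abs_zero] at h1
  have : 0 < 2 * (diam (hull {a, b, c}) / γ) * dist a b := by positivity
  linarith

/-- Bounding `|cr a b c|` from below by the inscribed disc along the side `ac` and from above by
`dist a b * dist a c`, then cancelling `dist a c`. -/
lemma diam_le_dist (hγ : 0 < γ) (hT : T.ShapeRegular γ) {a b c : Plane}
    (h : {a, b, c} ∈ T.elems) : 2 * diam (hull {a, b, c}) ≤ γ * dist a b := by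
  have e : ({a, b, c} : Finset Plane) = {c, a, b} := (triple_rotate c a b).symm
  have h' := h
  rw [e] at h'
  have h1 := le_abs_cr hγ hT h'
  have h3 := dist_pos.2 (triple_ne_of_mem h').1
  have h4 := abs_cr_le a b c
  rw [← e, ← cr_rotate, dist_comm c a] at h1
  rw [dist_comm] at h3
  have h5 : 2 * (diam (hull {a, b, c}) / γ) * dist a c ≤ dist a b * dist a c := h1.trans h4
  have h6 := le_of_mul_le_mul_right h5 h3
  rw [← mul_div_assoc, div_le_iff₀ hγ] at h6
  linarith

lemma interior_hull_nonempty (hγ : 0 < γ) (hT : T.ShapeRegular γ) {t : Finset Plane}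
    (ht : t ∈ T.elems) : (interior (hull t)).Nonempty := by
  obtain ⟨x, hx⟩ := hT t ht
  exact ⟨x, interior_mono hx (ball_subset_interior_closedBall
    (mem_ball_self (div_pos (diam_pos ht) hγ)))⟩

lemma volume_hull_ne_top (t : Finset Plane) : volume (hull t) ≠ ⊤ :=
  (isCompact_hull t).measure_lt_top.ne

lemma volume_real_closedBall (x : Plane) {r : ℝ} (hr : 0 ≤ r) :
    volume.real (closedBall x r) = Real.pi * r ^ 2 := by
  rw [Measure.real, EuclideanSpace.volume_closedBall_fin_two]
  simp [ENNReal.toReal_ofReal hr, ENNReal.toReal_ofReal Real.pi_pos.le]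
  ring

lemma le_area (hγ : 0 < γ) (hT : T.ShapeRegular γ) {t : Finset Plane} (ht : t ∈ T.elems) :
    3 * diam (hull t) ^ 2 ≤ γ ^ 2 * area t := by
  obtain ⟨x, hx⟩ := hT t ht
  have h1 := measureReal_mono hx (volume_hull_ne_top t)
  rw [volume_real_closedBall x (div_nonneg diam_nonneg hγ.le)] at h1
  have h2 : 3 * (diam (hull t) / γ) ^ 2 ≤ area t :=
    (mul_le_mul_of_nonneg_right Real.pi_gt_three.le (sq_nonneg _)).trans h1
  calc 3 * diam (hull t) ^ 2 = γ ^ 2 * (3 * (diam (hull t) / γ) ^ 2) := by field_simp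
    _ ≤ _ := by gcongr

lemma area_le {t : Finset Plane} (ht : t ∈ T.elems) : area t ≤ 4 * diam (hull t) ^ 2 := by
  have h3 : 1 < t.card := by rw [(T.mem_elems.1 ht).2]; norm_num
  obtain ⟨x, hx, y, hy, hxy⟩ := Finset.one_lt_card.1 h3
  have hsub : hull t ⊆ closedBall x (diam (hull t)) := fun z hz =>
    dist_le_diam_of_mem (isCompact_hull t).isBounded hz (subset_hull hx)
  have h1 := measureReal_mono (μ := volume) hsub (isCompact_closedBall _ _).measure_lt_top.ne
  rw [volume_real_closedBall x diam_nonneg] at h1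
  exact h1.trans (mul_le_mul_of_nonneg_right Real.pi_le_four (sq_nonneg _))

lemma area_nonneg (t : Finset Plane) : 0 ≤ area t := measureReal_nonneg

/-- Two elements with a common edge lie on different sides of it. -/
lemma cr_mul_cr_neg (hγ : 0 < γ) (hT : T.ShapeRegular γ) {a b c d : Plane}
    (hc : {a, b, c} ∈ T.elems) (hd : {a, b, d} ∈ T.elems) (hcd : c ≠ d) :
    cr a b c * cr a b d < 0 := by
  have hc0 := cr_ne_zero hγ hT hc
  have hd0 := cr_ne_zero hγ hT hd
  obtain ⟨hab, hac, hbc⟩ := triple_ne_of_mem hc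
  obtain ⟨-, had, hbd⟩ := triple_ne_of_mem hd
  by_contra hneg
  have hpos : 0 < cr a b d / cr a b c := by
    have : 0 < cr a b c * cr a b d := lt_of_le_of_ne (not_lt.1 hneg) (mul_ne_zero hc0 hd0).symm
    rw [div_eq_mul_inv, ← div_eq_mul_inv, div_pos_iff]
    rcases mul_pos_iff.1 this with h | h
    · exact Or.inl ⟨h.2, h.1⟩
    · exact Or.inr ⟨h.2, h.1⟩
  set p := cr d b c / cr a b c with hp
  set q := cr a d c / cr a b c with hq
  -- Chosen so that `(1 - ε) / 2 = ε * (|p| + |q|)`. If `c` and `d` were on the same side, the point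
  -- `z`, at weight `ε` from the midpoint of `ab` towards `d`, would lie in both triangles;
  -- conformity would then force it onto the line `ab`.
  set ε : ℝ := 1 / (1 + 2 * (|p| + |q|)) with hε
  have hden : 0 < 1 + 2 * (|p| + |q|) := by positivity
  have hε0 : 0 < ε := by positivity
  have hεe : ε * (1 + 2 * (|p| + |q|)) = 1 := by rw [hε]; field_simp
  have hε1 : ε ≤ 1 := by
    rw [hε, div_le_one hden]; linarith [abs_nonneg p, abs_nonneg q]
  set z : Plane := ((1 - ε) / 2) • a + ((1 - ε) / 2) • b + ε • d with hz
  have hsum : (1 - ε) / 2 + (1 - ε) / 2 + ε = 1 := by ring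
  have h12 : 0 ≤ (1 - ε) / 2 := by linarith
  have hzd : z ∈ hull {a, b, d} := mem_hull_iff.2 ⟨_, _, _, h12, h12, hε0.le, hsum, rfl⟩
  have hsmall : ∀ r : ℝ, |r| ≤ |p| + |q| → 0 ≤ (1 - ε) / 2 + ε * r := by
    intro r hr
    have h1 : ε * -(|p| + |q|) ≤ ε * r := mul_le_mul_of_nonneg_left
      (by linarith [(abs_le.1 hr).1]) hε0.le
    linarith
  have hzc : z ∈ hull {a, b, c} := by
    apply mem_hull_of_cr hc0
    · have e : cr z b c / cr a b c = (1 - ε) / 2 + ε * p := by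
        rw [hz, cr_combo_left _ _ _ _ _ hsum, cr_self_left, hp]; field_simp; ring
      rw [e]
      exact hsmall p (by linarith [abs_nonneg q])
    · have e : cr a z c / cr a b c = (1 - ε) / 2 + ε * q := by
        rw [hz, cr_combo_mid _ _ _ _ _ hsum, cr_self_left, hq]; field_simp; ring
      rw [e]
      exact hsmall q (by linarith [abs_nonneg p])
    · have e : cr a b z / cr a b c = ε * (cr a b d / cr a b c) := by
        rw [hz, cr_combo_right _ _ _ _ _ hsum, cr_self_outer, cr_self_right]; ring
      rw [e]
      positivity
  have hinter : ({a, b, c} ∩ {a, b, d} : Finset Plane) = {a, b, b} := by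
    ext x
    simp only [Finset.mem_inter, Finset.mem_insert, Finset.mem_singleton]
    constructor
    · rintro ⟨h1, h2⟩
      rcases h1 with h | h | rfl
      · exact Or.inl h
      · exact Or.inr (Or.inl h)
      · rcases h2 with h | h | h
        · exact Or.inl h
        · exact Or.inr (Or.inl h)
        · exact absurd h hcd
    · tauto
  have hzab := hull_inter_subset hc hd ⟨hzc, hzd⟩
  rw [hinter] at hzab
  obtain ⟨u, v, w, -, -, -, hs, hzz⟩ := mem_hull_iff.1 hzab
  have e1 : cr a b z = 0 := by
    rw [hzz, cr_combo_right _ _ _ _ _ hs, cr_self_outer, cr_self_right]; ring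
  rw [hz, cr_combo_right _ _ _ _ _ hsum, cr_self_outer, cr_self_right] at e1
  have : ε * cr a b d = 0 := by linarith
  exact (mul_ne_zero hε0.ne' hd0) this

/-- Shape regularity in the form used by the local analysis. Taking `γ + 1` for the constant secures
`1 ≤ k` from `0 < γ` alone. -/
lemma isPatch (hγ : 0 < γ) (hT : T.ShapeRegular γ) {a b c d : Plane}
    (hc : {a, b, c} ∈ T.elems) (hd : {a, b, d} ∈ T.elems) (hcd : c ≠ d) :
    IsPatch (γ + 1) (dist a b) a b c d := by
  have hℓ := dist_pos.2 (triple_ne_of_mem hc).1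
  have hside : ∀ {p}, {a, b, p} ∈ T.elems → dist a p ≤ (γ + 1) * dist a b ∧
      dist b p ≤ (γ + 1) * dist a b ∧ dist a b ^ 2 ≤ (γ + 1) * |cr a b p| ∧
      dist a b ^ 2 ≤ 4 * (γ + 1) ^ 2 * area {a, b, p} := by
    intro p hp
    have h1 := diam_le_dist hγ hT hp
    have h2 : dist a p ≤ diam (hull {a, b, p}) := dist_le_diam (by simp) (by simp)
    have h3 : dist b p ≤ diam (hull {a, b, p}) := dist_le_diam (by simp) (by simp)
    have h4 : dist a b ≤ diam (hull {a, b, p}) := dist_le_diam (by simp) (by simp)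
    have h5 := le_abs_cr hγ hT hp
    have h6 := le_area hγ hT hp
    have h7 : 0 ≤ γ * dist a b := by positivity
    refine ⟨by linarith, by linarith, ?_, ?_⟩
    · have h8 : dist a b / γ ≤ diam (hull {a, b, p}) / γ := by gcongr
      have h9 : 2 * (dist a b / γ) * dist a b ≤ |cr a b p| :=
        (mul_le_mul_of_nonneg_right (by linarith) hℓ.le).trans h5
      have h10 : γ * (2 * (dist a b / γ) * dist a b) ≤ γ * |cr a b p| := by gcongr
      have h11 : γ * (2 * (dist a b / γ) * dist a b) = 2 * dist a b ^ 2 := by field_simp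
      have := sq_nonneg (dist a b)
      linarith [abs_nonneg (cr a b p)]
    · have h8 : dist a b ^ 2 ≤ diam (hull {a, b, p}) ^ 2 := by gcongr
      have h9 : γ ^ 2 * area {a, b, p} ≤ (γ + 1) ^ 2 * area {a, b, p} :=
        mul_le_mul_of_nonneg_right (by gcongr; linarith) (area_nonneg _)
      have := sq_nonneg (diam (hull {a, b, p}))
      have := mul_nonneg (sq_nonneg (γ + 1)) (area_nonneg {a, b, p})
      linarith
  obtain ⟨c1, c2, c3, c4⟩ := hside hc
  obtain ⟨d1, d2, d3, d4⟩ := hside hd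
  exact ⟨by linarith, hℓ, le_rfl, c1, c2, d1, d2, c3, d3, cr_mul_cr_neg hγ hT hc hd hcd, c4⟩

/-- Elements at a common edge lie pairwise on opposite sides of it, and three nonzero signs cannot
be pairwise opposite. -/
lemma star_card_le_two (hγ : 0 < γ) (hT : T.ShapeRegular γ) {e : Finset Plane} (he : e.card = 2) :
    (T.star e).card ≤ 2 := by
  by_contra! h
  obtain ⟨t₁, h1, t₂, h2, t₃, h3, h12, h13, h23⟩ := Finset.two_lt_card.1 h
  rw [mem_star] at h1 h2 h3
  obtain ⟨a, b, c, rfl, rfl⟩ := exists_eq_triple he (T.mem_elems.1 h1.1).2 h1.2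
  have key : ∀ t ∈ T.elems, ({a, b} : Finset Plane) ⊆ t → ∃ p, t = {a, b, p} := by
    intro t ht het
    have hsd : (t \ {a, b}).card = 1 := by
      rw [Finset.card_sdiff_of_subset het, (T.mem_elems.1 ht).2, he]
    obtain ⟨p, hp⟩ := Finset.card_eq_one.1 hsd
    refine ⟨p, ?_⟩
    rw [← Finset.sdiff_union_of_subset het, hp]
    ext x; simp only [Finset.mem_union, Finset.mem_insert, Finset.mem_singleton]; tauto
  obtain ⟨p, rfl⟩ := key t₂ h2.1 h2.2
  obtain ⟨r, rfl⟩ := key t₃ h3.1 h3.2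
  have n1 := cr_mul_cr_neg hγ hT h1.1 h2.1 (fun h => h12 (by rw [h]))
  have n2 := cr_mul_cr_neg hγ hT h1.1 h3.1 (fun h => h13 (by rw [h]))
  have n3 := cr_mul_cr_neg hγ hT h2.1 h3.1 (fun h => h23 (by rw [h]))
  have := mul_pos_of_neg_of_neg n1 n2
  have h4 : 0 ≤ cr a b c ^ 2 := sq_nonneg _
  nlinarith

lemma star_eq_pair (hγ : 0 < γ) (hT : T.ShapeRegular γ) {a b c d : Plane}
    (hc : {a, b, c} ∈ T.elems) (hd : {a, b, d} ∈ T.elems) (hcd : c ≠ d) :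
    T.star {a, b} = {{a, b, c}, {a, b, d}} ∧ ({a, b, c} : Finset Plane) ≠ {a, b, d} := by
  have hsub : ∀ p : Plane, ({a, b} : Finset Plane) ⊆ {a, b, p} := fun p x hx => by
    simp only [Finset.mem_insert, Finset.mem_singleton] at hx ⊢; tauto
  have hne : ({a, b, c} : Finset Plane) ≠ {a, b, d} := by
    intro h
    obtain ⟨-, hac, hbc⟩ := triple_ne_of_mem hc
    have : c ∈ ({a, b, d} : Finset Plane) := by rw [← h]; simp
    simp only [Finset.mem_insert, Finset.mem_singleton] at this
    rcases this with h | h | h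
    · exact hac h.symm
    · exact hbc h.symm
    · exact hcd h
  refine ⟨(Finset.eq_of_subset_of_card_le ?_ ?_).symm, hne⟩
  · intro t ht
    simp only [Finset.mem_insert, Finset.mem_singleton] at ht
    rw [mem_star]
    rcases ht with rfl | rfl
    · exact ⟨hc, hsub c⟩
    · exact ⟨hd, hsub d⟩
  · rw [Finset.card_pair hne]
    exact star_card_le_two hγ hT (Finset.card_pair (triple_ne_of_mem hc).1)

lemma isInteriorEdge_of_ne (hγ : 0 < γ) (hT : T.ShapeRegular γ) {a b c d : Plane}
    (hc : {a, b, c} ∈ T.elems) (hd : {a, b, d} ∈ T.elems) (hcd : c ≠ d) :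
    T.IsInteriorEdge {a, b} := by
  obtain ⟨h1, h2⟩ := star_eq_pair hγ hT hc hd hcd
  exact ⟨Finset.card_pair (triple_ne_of_mem hc).1, by rw [h1, Finset.card_pair h2]⟩

lemma isInteriorEdge_or_isBoundaryEdge (hγ : 0 < γ) (hT : T.ShapeRegular γ) {e t : Finset Plane}
    (ht : t ∈ T.elems) (he : e.card = 2) (het : e ⊆ t) :
    T.IsInteriorEdge e ∨ T.IsBoundaryEdge e := by
  have h1 := star_card_le_two hγ hT he
  have h2 : 0 < (T.star e).card := Finset.card_pos.2 ⟨t, T.mem_star.2 ⟨ht, het⟩⟩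
  have h3 : (T.star e).card = 1 ∨ (T.star e).card = 2 := by omega
  rcases h3 with h3 | h3
  · exact Or.inr ⟨he, h3⟩
  · exact Or.inl ⟨he, h3⟩

/-- The second element at an interior edge of an element. -/
lemma exists_other {a b c : Plane} (hc : {a, b, c} ∈ T.elems) (he : T.IsInteriorEdge {a, b}) :
    ∃ d, {a, b, d} ∈ T.elems ∧ c ≠ d := by
  have hcs : ({a, b, c} : Finset Plane) ∈ T.star {a, b} := by
    rw [mem_star]
    refine ⟨hc, fun x hx => ?_⟩
    simp only [Finset.mem_insert, Finset.mem_singleton] at hx ⊢; tauto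
  have h1 : 1 < (T.star {a, b}).card := by rw [he.2]; norm_num
  obtain ⟨t, ht, htc⟩ := Finset.exists_mem_ne h1 {a, b, c}
  rw [mem_star] at ht
  have hsd : (t \ {a, b}).card = 1 := by
    rw [Finset.card_sdiff_of_subset ht.2, (T.mem_elems.1 ht.1).2, he.1]
  obtain ⟨d, hd⟩ := Finset.card_eq_one.1 hsd
  have htd : t = {a, b, d} := by
    rw [← Finset.sdiff_union_of_subset ht.2, hd]
    ext x; simp only [Finset.mem_union, Finset.mem_insert, Finset.mem_singleton]; tauto
  subst htd
  exact ⟨d, ht.1, fun h => htc (by rw [h])⟩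

/-- A common interior point would put a disc into the hull of the common vertices, of which there
are at most two. -/
lemma disjoint_interior {s t : Finset Plane} (hs : s ∈ T.elems) (ht : t ∈ T.elems) (hst : s ≠ t) :
    Disjoint (interior (hull s)) (interior (hull t)) := by
  rw [Set.disjoint_left]
  intro x hxs hxt
  have hopen : IsOpen (interior (hull s) ∩ interior (hull t)) := isOpen_interior.inter isOpen_interior
  obtain ⟨r, hr, hball⟩ := Metric.nhds_basis_closedBall.mem_iff.1 (hopen.mem_nhds ⟨hxs, hxt⟩)
  have hsub : closedBall x r ⊆ hull (s ∩ t) := fun y hy =>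
    hull_inter_subset hs ht ⟨interior_subset (hball hy).1, interior_subset (hball hy).2⟩
  have hnot : ¬ s ⊆ t := fun h => hst (Finset.eq_of_subset_of_card_le h
    (by rw [(T.mem_elems.1 hs).2, (T.mem_elems.1 ht).2]))
  obtain ⟨c, hcs, hct⟩ := Finset.not_subset.1 hnot
  have he : (s.erase c).card = 2 := by
    rw [Finset.card_erase_of_mem hcs, (T.mem_elems.1 hs).2]
  obtain ⟨a, b, hab, hsab⟩ := Finset.card_eq_two.1 he
  apply not_closedBall_subset_hull_pair hab hr (x := x)
  refine hsub.trans (hull_mono fun y hy => ?_)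
  rw [Finset.mem_inter] at hy
  rw [← hsab, Finset.mem_erase]
  exact ⟨fun h => hct (h ▸ hy.2), hy.1⟩

lemma ae_exists_mem_interior : ∀ᵐ x, x ∈ Ω → ∃ t ∈ T.elems, x ∈ interior (hull t) := by
  have h : ∀ᵐ x, ∀ t ∈ T.elems, x ∈ hull t → x ∈ interior (hull t) := by
    exact (ae_ball_iff T.elems.countable_toSet).2 fun t _ =>
      ae_mem_interior_of_convex (convex_hull t)
  filter_upwards [h] with x hx hxΩ
  have hx' : x ∈ T.space := by rw [T.cover]; exact subset_closure hxΩ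
  obtain ⟨s, hs, hxs⟩ := T.toSimplicialComplex.mem_space_iff.1 hx'
  obtain ⟨t, ht, hst, hcard⟩ := T.pure s hs
  have hte : t ∈ T.elems := T.mem_elems.2 ⟨ht, hcard⟩
  exact ⟨t, hte, hx t hte (hull_mono hst hxs)⟩

/-- The element chosen in the definition of `recover` is unique because interiors of distinct
elements are disjoint. -/
lemma recover_eq {ext : Finset Plane → Finset Plane × Finset Plane}
    {p : Finset Plane → Plane → Plane} {t : Finset Plane} (ht : t ∈ T.elems) {x : Plane}
    (hx : x ∈ interior (hull t)) : T.recover ext p x = T.recoverOn ext p t x := by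
  have hex : ∃ t ∈ T.elems, x ∈ interior (hull t) := ⟨t, ht, hx⟩
  have h2 : hex.choose = t := by
    by_contra hne
    exact Set.disjoint_left.1 (disjoint_interior hex.choose_spec.1 ht hne) hex.choose_spec.2 hx
  unfold recover
  rw [dif_pos hex, h2]

lemma volume_closure_ne_top (T : Triangulation Ω) : volume (closure Ω) ≠ ⊤ := by
  rw [← T.cover]
  have : IsCompact T.space := by
    unfold Geometry.SimplicialComplex.space
    exact T.finite_faces.isCompact_biUnion fun s _ => isCompact_hull s
  exact this.measure_lt_top.ne

lemma volume_real_interior_hull (t : Finset Plane) :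
    volume.real (interior (hull t)) = area t := by
  unfold area
  apply measureReal_congr
  apply Filter.EventuallyLE.antisymm
  · exact Filter.Eventually.of_forall fun x hx => interior_subset hx
  · exact ae_mem_interior_of_convex (convex_hull t)

lemma sum_area_le (T : Triangulation Ω) : ∑ t ∈ T.elems, area t ≤ volume.real (closure Ω) := by
  calc ∑ t ∈ T.elems, area t = ∑ t ∈ T.elems, volume.real (interior (hull t)) := by
        simp only [volume_real_interior_hull]
    _ = volume.real (⋃ t ∈ T.elems, interior (hull t)) := by
        rw [measureReal_biUnion_finset (fun s hs t ht hst => disjoint_interior hs ht hst)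
          (fun t _ => isOpen_interior.measurableSet)
          (fun t _ => ((measure_mono interior_subset).trans_lt
            (isCompact_hull t).measure_lt_top).ne)]
    _ ≤ _ := by
        apply measureReal_mono _ T.volume_closure_ne_top
        exact iUnion₂_subset fun t ht => interior_subset.trans (T.hull_subset_closure ht)

end Triangulation

/-! ### The error of the recovered function on an element -/

lemma contRep_spec {q : Plane → Plane} {K : Set Plane}
    (hex : ∃ g : Plane → Plane, ContinuousOn g K ∧ g =ᵐ[volume.restrict K] q) :
    ContinuousOn (contRep K q) K ∧ contRep K q =ᵐ[volume.restrict K] q := by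
  unfold contRep
  rw [dif_pos hex]
  exact hex.choose_spec

/-- The integral of the squares of the second derivatives over an element. -/
def elemHess (H : Fin 2 → Fin 2 → Fin 2 → Plane → ℝ) (t : Finset Plane) : ℝ :=
  ∫ x in interior (hull t), hessSq H x

lemma hessSq_nonneg (H : Fin 2 → Fin 2 → Fin 2 → Plane → ℝ) (x : Plane) : 0 ≤ hessSq H x :=
  Finset.sum_nonneg fun _ _ => Finset.sum_nonneg fun _ _ => Finset.sum_nonneg fun _ _ => sq_nonneg _

lemma elemHess_nonneg (H : Fin 2 → Fin 2 → Fin 2 → Plane → ℝ) (t : Finset Plane) :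
    0 ≤ elemHess H t :=
  integral_nonneg fun x => hessSq_nonneg H x

lemma integrableOn_hessSq {Ω : Set Plane} {q : Plane → Plane} {D : Fin 2 → Fin 2 → Plane → ℝ}
    {H : Fin 2 → Fin 2 → Fin 2 → Plane → ℝ} {L : ℝ}
    (h : ∀ i, IsScalarH2 Ω (fun x => q x i) (D i) (H i) L) : IntegrableOn (hessSq H) Ω volume := by
  unfold hessSq
  exact integrable_finsetSum _ fun i _ => integrable_finsetSum _ fun j _ =>
    integrable_finsetSum _ fun k _ => ((h i).second_memLp j k).integrable_sq

/-- The length of an edge. -/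
def edgeLen (e : Finset Plane) : ℝ := diam (e : Set Plane)

lemma edgeLen_pair (a b : Plane) : edgeLen {a, b} = dist a b := by
  simp [edgeLen, diam_pair]

lemma edgeLen_nonneg (e : Finset Plane) : 0 ≤ edgeLen e := diam_nonneg

/-- The constant in the estimate of the error at the midpoint of an edge. -/
def edgeConst (k : ℝ) : ℝ := 6 * k ^ 5 * (patchConst k + 1)

lemma one_le_edgeConst {k : ℝ} (hk : 1 ≤ k) : 1 ≤ edgeConst k := by
  have h1 : 1 ≤ k ^ 5 := one_le_pow₀ hk
  have h2 := patchConst_nonneg (by linarith : 0 ≤ k)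
  unfold edgeConst
  nlinarith

lemma patchConst_le_edgeConst {k : ℝ} (hk : 1 ≤ k) : patchConst k ≤ edgeConst k := by
  have h1 : 1 ≤ k ^ 5 := one_le_pow₀ hk
  have h2 := patchConst_nonneg (by linarith : 0 ≤ k)
  unfold edgeConst
  nlinarith

namespace Triangulation

variable {Ω : Set Plane} (T : Triangulation Ω)

/-- The `L²` norm of the second derivatives over the elements at an edge. -/
def edgeHess (H : Fin 2 → Fin 2 → Fin 2 → Plane → ℝ) (e : Finset Plane) : ℝ :=
  √(∑ t ∈ T.star e, elemHess H t)

/-- The bound for the error at the midpoint of an interior edge. -/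
def edgeBound (H : Fin 2 → Fin 2 → Fin 2 → Plane → ℝ) (L : ℝ) (Δ : Finset Plane → ℝ)
    (e : Finset Plane) : ℝ :=
  edgeLen e * T.edgeHess H e + L * Δ e

/-- The elements which are equal to `t` or have an edge in common with `t`. -/
def neighbours (t : Finset Plane) : Finset (Finset Plane) :=
  T.elems.filter fun s => 2 ≤ (t ∩ s).card

/-- The interior edges of an element. -/
def innerEdges (t : Finset Plane) : Finset (Finset Plane) :=
  (t.powersetCard 2).filter fun e => T.IsInteriorEdge e

lemma mem_innerEdges {t e : Finset Plane} : e ∈ T.innerEdges t ↔ e ⊆ t ∧ T.IsInteriorEdge e := by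
  simp only [innerEdges, Finset.mem_filter, Finset.mem_powersetCard]
  constructor
  · rintro ⟨⟨h1, -⟩, h2⟩; exact ⟨h1, h2⟩
  · rintro ⟨h1, h2⟩; exact ⟨⟨h1, h2.1⟩, h2⟩

/-- The bound for the error on an element. -/
def elemBound (X : Finset Plane → ℝ) (t : Finset Plane) : ℝ :=
  ∑ s ∈ T.neighbours t, ∑ e ∈ T.innerEdges s, X e

/-- The number `Δ e` bounds the deviation of the two elements at the interior edge `e` from a
parallelogram. -/
def BoundsDiag (Δ : Finset Plane → ℝ) : Prop :=
  ∀ a b c d : Plane, {a, b, c} ∈ T.elems → {a, b, d} ∈ T.elems → c ≠ d →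
    ∀ i, |c i + d i - a i - b i| ≤ Δ {a, b}

variable {T} {γ L : ℝ} {q : Plane → Plane} {D : Fin 2 → Fin 2 → Plane → ℝ}
  {H : Fin 2 → Fin 2 → Fin 2 → Plane → ℝ} {Δ : Finset Plane → ℝ}

lemma le_elemBound {X : Finset Plane → ℝ} (hX : ∀ e, 0 ≤ X e) {s t e : Finset Plane}
    (hs : s ∈ T.elems) (hts : 2 ≤ (t ∩ s).card) (hes : e ⊆ s) (he : T.IsInteriorEdge e) :
    X e ≤ T.elemBound X t := by
  have h1 : X e ≤ ∑ e ∈ T.innerEdges s, X e :=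
    Finset.single_le_sum (fun e _ => hX e) (T.mem_innerEdges.2 ⟨hes, he⟩)
  refine h1.trans ?_
  exact Finset.single_le_sum (f := fun s => ∑ e ∈ T.innerEdges s, X e)
    (fun s _ => Finset.sum_nonneg fun e _ => hX e) (Finset.mem_filter.2 ⟨hs, hts⟩)

lemma edgeBound_nonneg (hL : 0 ≤ L) (hΔ : ∀ e, 0 ≤ Δ e) (e : Finset Plane) :
    0 ≤ T.edgeBound H L Δ e :=
  add_nonneg (mul_nonneg (edgeLen_nonneg e) (Real.sqrt_nonneg _)) (mul_nonneg hL (hΔ e))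

/-- The interior of the union also contains points of the common edge, but these form a null set. -/
lemma lintegral_interior_union_le {s t : Finset Plane}
    (hs : IntegrableOn (hessSq H) (interior (hull s)) volume)
    (ht : IntegrableOn (hessSq H) (interior (hull t)) volume) :
    ∫⁻ x in interior (hull s ∪ hull t), ENNReal.ofReal (hessSq H x) ≤
      ENNReal.ofReal (elemHess H s + elemHess H t) := by
  have hsub : interior (hull s ∪ hull t) ≤ᵐ[volume]
      (interior (hull s) ∪ interior (hull t) : Set Plane) := by
    filter_upwards [ae_mem_interior_of_convex (convex_hull s),
      ae_mem_interior_of_convex (convex_hull t)] with x h1 h2 hx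
    rcases interior_subset hx with hx | hx
    · exact Or.inl (h1 hx)
    · exact Or.inr (h2 hx)
  refine (lintegral_mono_set' hsub).trans ((lintegral_union_le _ _ _).trans_eq ?_)
  rw [ENNReal.ofReal_add (elemHess_nonneg H s) (elemHess_nonneg H t), elemHess, elemHess,
    ofReal_integral_eq_lintegral_ofReal hs (Eventually.of_forall fun x => hessSq_nonneg H x),
    ofReal_integral_eq_lintegral_ofReal ht (Eventually.of_forall fun x => hessSq_nonneg H x)]

/-- Approximation by an affine field on the two elements at an interior edge. -/
lemma exists_affField_approx (hΩ : interior (closure Ω) = Ω) (hγ : 0 < γ) (hT : T.ShapeRegular γ)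
    (h : ∀ i, IsScalarH2 Ω (fun x => q x i) (D i) (H i) L) (hΔ0 : ∀ e, 0 ≤ Δ e)
    (hΔ : T.BoundsDiag Δ) {a b c d : Plane} (hc : {a, b, c} ∈ T.elems) (hd : {a, b, d} ∈ T.elems)
    (hcd : c ≠ d) :
    ∃ (c₀ : Fin 2 → ℝ) (A : Fin 2 → Fin 2 → ℝ), (∀ i j, |A i j| ≤ L) ∧
      (∀ p, (p = c ∨ p = d) → ∀ x ∈ hull {a, b, p}, ∀ i,
        |contRep (hull {a, b, p}) q x i - affField c₀ A x i| ≤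
          edgeConst (γ + 1) * T.edgeBound H L Δ {a, b}) ∧
      ∀ i, |T.avg (rtInterp q) {a, b} i - affField c₀ A (mid a b) i| ≤
          edgeConst (γ + 1) * T.edgeBound H L Δ {a, b} := by
  have hp := isPatch hγ hT hc hd hcd
  have hk := hp.one_le
  have hL := (h 0).nonneg
  obtain ⟨hstar, hne⟩ := star_eq_pair hγ hT hc hd hcd
  have hab := (triple_ne_of_mem hc).1
  have hmem : ∀ p, (p = c ∨ p = d) → {a, b, p} ∈ T.elems := by
    rintro p (rfl | rfl) <;> assumption
  have hint : ∀ p, (p = c ∨ p = d) →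
      IntegrableOn (hessSq H) (interior (hull {a, b, p})) volume := fun p hpp =>
    (integrableOn_hessSq h).mono_set (T.interior_hull_subset hΩ (hmem p hpp))
  have hE2 : T.edgeHess H {a, b} ^ 2 = elemHess H {a, b, c} + elemHess H {a, b, d} := by
    rw [edgeHess, Real.sq_sqrt (Finset.sum_nonneg fun t _ => elemHess_nonneg H t), hstar,
      Finset.sum_pair hne]
  have hE := lintegral_interior_union_le (hint c (Or.inl rfl)) (hint d (Or.inr rfl))
  rw [← hE2] at hE
  have hSΩ : interior (hull {a, b, c} ∪ hull {a, b, d}) ⊆ Ω := by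
    conv_rhs => rw [← hΩ]
    exact interior_mono (union_subset (T.hull_subset_closure hc) (T.hull_subset_closure hd))
  obtain ⟨c₀, A, hA, happ⟩ := hp.exists_affine_approx_contRep h hSΩ (Real.sqrt_nonneg _) hE
    (fun p hpp => interior_hull_nonempty hγ hT (hmem p hpp))
  have hE0 : 0 ≤ T.edgeHess H {a, b} := Real.sqrt_nonneg _
  change ∀ p, (p = c ∨ p = d) → ∀ x ∈ hull {a, b, p}, ∀ i,
    |contRep (hull {a, b, p}) q x i - affField c₀ A x i| ≤
      patchConst (γ + 1) * (dist a b * T.edgeHess H {a, b}) at happ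
  have hXdef : T.edgeBound H L Δ {a, b} = dist a b * T.edgeHess H {a, b} + L * Δ {a, b} := by
    rw [edgeBound, edgeLen_pair]
  have hLΔ : 0 ≤ L * Δ {a, b} := mul_nonneg hL (hΔ0 _)
  have hℓE : 0 ≤ dist a b * T.edgeHess H {a, b} := mul_nonneg dist_nonneg hE0
  have hP0 := patchConst_nonneg (by linarith : 0 ≤ γ + 1)
  refine ⟨c₀, A, hA, fun p hpp x hx i => (happ p hpp x hx i).trans ?_, fun i => ?_⟩
  · rw [hXdef]
    exact mul_le_mul (patchConst_le_edgeConst hk) (by linarith) hℓE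
      (hP0.trans (patchConst_le_edgeConst hk))
  · have hcont : ∀ p, (p = c ∨ p = d) →
        ContinuousOn (contRep (hull {a, b, p}) q) (hull {a, b, p}) := fun p hpp =>
      (contRep_spec (exists_continuous_rep h (convex_hull _) (measurableSet_hull _)
        (T.interior_hull_subset hΩ (hmem p hpp)))).1
    have hmean := hp.abs_mean_sub_le hA (hΔ a b c d hc hd hcd) (hcont c (Or.inl rfl))
      (hcont d (Or.inr rfl)) (happ c (Or.inl rfl)) (happ d (Or.inr rfl)) i
    have havg : T.avg (rtInterp q) {a, b} i =
        (rtOf a b c (contRep (hull {a, b, c}) q) (mid a b) i +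
          rtOf a b d (contRep (hull {a, b, d}) q) (mid a b) i) / 2 := by
      rw [avg, hstar, Finset.sum_pair hne, edgeMid_pair hab, rtInterp_eq hp.ne, rtInterp_eq hp.ne',
        PiLp.smul_apply, PiLp.add_apply, smul_eq_mul]
      simp only [rtOf]
      ring
    rw [havg]
    refine hmean.trans ?_
    rw [hXdef, edgeConst, mul_assoc (6 * (γ + 1) ^ 5)]
    refine mul_le_mul_of_nonneg_left ?_ (by positivity)
    -- With `K = patchConst * ℓ * E` this is `patchConst * ℓ * E + L * Δ ≤ (patchConst + 1) * (ℓ * E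
    -- + L * Δ)`, the origin of the second factor of `edgeConst`.
    nlinarith

/-- Every element belongs to a patch: if one of its edges is on the boundary, the extrapolation
stencil of that edge supplies an interior one. -/
lemma exists_innerEdge (hγ : 0 < γ) (hT : T.ShapeRegular γ)
    {ext : Finset Plane → Finset Plane × Finset Plane} (hext : T.IsBoundaryChoice ext)
    {t : Finset Plane} (ht : t ∈ T.elems) :
    ∃ a b c, t = {a, b, c} ∧ T.IsInteriorEdge {a, b} := by
  obtain ⟨a, b, c, hab, hac, hbc, rfl⟩ := Finset.card_eq_three.1 (T.mem_elems.1 ht).2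
  have hsub : ({a, b} : Finset Plane) ⊆ {a, b, c} := fun x hx => by
    simp only [Finset.mem_insert, Finset.mem_singleton] at hx ⊢; tauto
  rcases isInteriorEdge_or_isBoundaryEdge hγ hT ht (Finset.card_pair hab) hsub with hi | hb
  · exact ⟨a, b, c, rfl, hi⟩
  · obtain ⟨a', b', c', d', he, hda, h1, h2, -, -⟩ := hext _ hb
    have h1' : {b', c', a'} ∈ T.elems := by rw [← triple_rotate]; exact h1
    refine ⟨b', c', a', ?_, isInteriorEdge_of_ne hγ hT h1' h2 hda.symm⟩
    rw [← triple_rotate a' b' c']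
    obtain ⟨s, hs⟩ := Finset.card_eq_one.1 hb.2
    have m1 : ({a, b, c} : Finset Plane) ∈ T.star {a, b} := T.mem_star.2 ⟨ht, hsub⟩
    have m2 : ({a', b', c'} : Finset Plane) ∈ T.star {a, b} := by
      refine T.mem_star.2 ⟨h1, ?_⟩
      rw [he]
      intro x hx
      simp only [Finset.mem_insert, Finset.mem_singleton] at hx ⊢; tauto
    rw [hs, Finset.mem_singleton] at m1 m2
    rw [m1, m2]

lemma two_le_card_inter_of_subset {e s t : Finset Plane} (he : e.card = 2) (hs : e ⊆ s)
    (ht : e ⊆ t) : 2 ≤ (t ∩ s).card :=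
  he.symm.le.trans (Finset.card_le_card (Finset.subset_inter ht hs))

/-- The error of the recovered values at the midpoints of the edges. -/
lemma abs_recoveredValue_sub_le (hΩ : interior (closure Ω) = Ω) (hγ : 0 < γ)
    (hT : T.ShapeRegular γ) {ext : Finset Plane → Finset Plane × Finset Plane}
    (hext : T.IsBoundaryChoice ext)
    (h : ∀ i, IsScalarH2 Ω (fun x => q x i) (D i) (H i) L) (hΔ0 : ∀ e, 0 ≤ Δ e)
    (hΔ : T.BoundsDiag Δ) {t e : Finset Plane} (ht : t ∈ T.elems) (he : e.card = 2) (het : e ⊆ t)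
    (i : Fin 2) :
    |T.recoveredValue ext (rtInterp q) e i - contRep (hull t) q (edgeMid e) i| ≤
      7 * edgeConst (γ + 1) * T.elemBound (T.edgeBound H L Δ) t := by
  have hL := (h 0).nonneg
  set X := T.edgeBound H L Δ with hX
  have hX0 : ∀ e, 0 ≤ X e := edgeBound_nonneg hL hΔ0
  set C := edgeConst (γ + 1) with hC
  have hC1 : 1 ≤ C := one_le_edgeConst (by linarith)
  by_cases hi : T.IsInteriorEdge e
  · obtain ⟨a, b, c, rfl, rfl⟩ := exists_eq_triple he (T.mem_elems.1 ht).2 het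
    obtain ⟨d, hd, hcd⟩ := exists_other ht hi
    obtain ⟨c₀, A, -, h1, h2⟩ := exists_affField_approx hΩ hγ hT h hΔ0 hΔ ht hd hcd
    have hab := (triple_ne_of_mem ht).1
    have e1 := abs_le.1 (h1 c (Or.inl rfl) _ (mid_mem_hull a b c) i)
    have e2 := abs_le.1 (h2 i)
    have e3 : C * X {a, b} ≤ C * T.elemBound X {a, b, c} := by
      refine mul_le_mul_of_nonneg_left ?_ (by linarith)
      exact le_elemBound hX0 ht (two_le_card_inter_of_subset he het het) het hi
    have e4 : 0 ≤ C * X {a, b} := mul_nonneg (by linarith) (hX0 _)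
    rw [edgeMid_pair hab, recoveredValue, if_pos hi, abs_le]
    constructor <;> linarith [e1.1, e1.2, e2.1, e2.2]
  · have hb : T.IsBoundaryEdge e :=
      (isInteriorEdge_or_isBoundaryEdge hγ hT ht he het).resolve_left hi
    obtain ⟨a, b, c, d, rfl, hda, hac, hbd, hcd, hexte⟩ := hext _ hb
    have hts : t = {a, b, c} := by
      obtain ⟨s, hs⟩ := Finset.card_eq_one.1 hb.2
      have m1 : t ∈ T.star {a, b} := T.mem_star.2 ⟨ht, het⟩
      have m2 : ({a, b, c} : Finset Plane) ∈ T.star {a, b} := by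
        refine T.mem_star.2 ⟨hac, fun x hx => ?_⟩
        simp only [Finset.mem_insert, Finset.mem_singleton] at hx ⊢; tauto
      rw [hs, Finset.mem_singleton] at m1 m2
      rw [m1, m2]
    subst hts
    have hbca : {b, c, a} ∈ T.elems := by rw [← triple_rotate]; exact hac
    have hcdb : {c, d, b} ∈ T.elems := by rw [← triple_rotate]; exact hbd
    have hbci := isInteriorEdge_of_ne hγ hT hbca hbd hda.symm
    obtain ⟨c₀, A, hA, h1, h2⟩ := exists_affField_approx hΩ hγ hT h hΔ0 hΔ hbca hbd hda.symm
    obtain ⟨f, hf, hbf⟩ := exists_other hcdb hcd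
    -- The patches at `bc` and at `cd` have different affine fields. They are compared through `q`
    -- itself at the midpoint of `cd`, since the element `bcd` belongs to both.
    obtain ⟨c₁, A₁, -, h3, h4⟩ := exists_affField_approx hΩ hγ hT h hΔ0 hΔ hcdb hf hbf
    have h1a := h1 a (Or.inl rfl)
    rw [← triple_rotate] at h1a
    have h1d := h1 d (Or.inr rfl)
    have h3b := h3 b (Or.inl rfl)
    rw [← triple_rotate] at h3b
    have hmcd : mid c d ∈ hull {b, c, d} := by
      rw [triple_rotate]; exact mid_mem_hull c d b
    have hδ := hΔ b c a d hbca hbd hda.symm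
    have e1 := abs_le.1 (h1a _ (mid_mem_hull a b c) i)
    have e2 := abs_le.1 (h2 i)
    have e3 := abs_le.1 (h1d _ hmcd i)
    have e4 := abs_le.1 (h3b _ hmcd i)
    have e5 := abs_le.1 (h4 i)
    have e6 : |2 * affField c₀ A (mid b c) i - affField c₀ A (mid c d) i -
        affField c₀ A (mid a b) i| ≤ L * Δ {b, c} := by
      -- In an exact parallelogram the three midpoints are equally spaced on a line and
      -- extrapolation reproduces affine fields; the defect is half the gradient applied to the
      -- deviation at the interior edge `bc`.
      have e : 2 * affField c₀ A (mid b c) i - affField c₀ A (mid c d) i -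
          affField c₀ A (mid a b) i = -(A i 0 * (a 0 + d 0 - b 0 - c 0) +
            A i 1 * (a 1 + d 1 - b 1 - c 1)) / 2 := by
        simp only [affField_apply, mid_apply]; ring
      rw [e, abs_div, abs_neg, abs_two, div_le_iff₀ two_pos]
      refine (abs_add_le _ _).trans ?_
      rw [abs_mul, abs_mul]
      have f0 := mul_le_mul (hA i 0) (hδ 0) (abs_nonneg _) hL
      have f1 := mul_le_mul (hA i 1) (hδ 1) (abs_nonneg _) hL
      linarith
    have e6' := abs_le.1 e6
    have hsub : ({b, c} : Finset Plane) ⊆ {b, c, d} := fun x hx => by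
      simp only [Finset.mem_insert, Finset.mem_singleton] at hx ⊢; tauto
    have hsub' : ({c, d} : Finset Plane) ⊆ {b, c, d} := fun x hx => by
      simp only [Finset.mem_insert, Finset.mem_singleton] at hx ⊢; tauto
    have hsub'' : ({b, c} : Finset Plane) ⊆ {a, b, c} := fun x hx => by
      simp only [Finset.mem_insert, Finset.mem_singleton] at hx ⊢; tauto
    have hcard := two_le_card_inter_of_subset hbci.1 hsub hsub''
    have g1 : X {b, c} ≤ T.elemBound X {a, b, c} := le_elemBound hX0 hbd hcard hsub hbci
    have g2 : X {c, d} ≤ T.elemBound X {a, b, c} := le_elemBound hX0 hbd hcard hsub' hcd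
    have g1' : C * X {b, c} ≤ C * T.elemBound X {a, b, c} :=
      mul_le_mul_of_nonneg_left g1 (by linarith)
    have g2' : C * X {c, d} ≤ C * T.elemBound X {a, b, c} :=
      mul_le_mul_of_nonneg_left g2 (by linarith)
    have g3 : L * Δ {b, c} ≤ C * X {b, c} := by
      have : L * Δ {b, c} ≤ X {b, c} := by
        rw [hX, edgeBound]
        exact le_add_of_nonneg_left (mul_nonneg (edgeLen_nonneg _) (Real.sqrt_nonneg _))
      exact this.trans (le_mul_of_one_le_left (hX0 _) hC1)
    have hab := (triple_ne_of_mem hac).1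
    have hval : T.recoveredValue ext (rtInterp q) {a, b} i =
        2 * T.avg (rtInterp q) {b, c} i - T.avg (rtInterp q) {c, d} i := by
      rw [recoveredValue, if_neg hi, hexte, PiLp.sub_apply, PiLp.smul_apply, smul_eq_mul]
    rw [edgeMid_pair hab, hval, abs_le]
    -- The factor `7` counts `e2` twice, because of the weight `2` in the extrapolation, and `e1`,
    -- `e3`, `e4`, `e5`, `e6` once each.
    constructor <;> linarith [e1.1, e1.2, e2.1, e2.2, e3.1, e3.2, e4.1, e4.2, e5.1, e5.2, e6'.1,
      e6'.2]

lemma recoverOn_spec (hγ : 0 < γ) (hT : T.ShapeRegular γ)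
    (ext : Finset Plane → Finset Plane × Finset Plane) (p : Finset Plane → Plane → Plane)
    {t : Finset Plane} (ht : t ∈ T.elems) {e : Finset Plane} (het : e ⊆ t) (he : e.card = 2) :
    T.recoverOn ext p t (edgeMid e) = T.recoveredValue ext p e := by
  have hex : ∃ g : Plane →ᵃ[ℝ] Plane,
      ∀ e ⊆ t, e.card = 2 → g (edgeMid e) = T.recoveredValue ext p e := by
    obtain ⟨a, b, c, hab, hac, hbc, rfl⟩ := Finset.card_eq_three.1 (T.mem_elems.1 ht).2
    obtain ⟨g, h1, h2, h3⟩ := exists_affineMap_mids (cr_ne_zero hγ hT ht)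
      (T.recoveredValue ext p {a, b}) (T.recoveredValue ext p {b, c})
      (T.recoveredValue ext p {a, c})
    refine ⟨g, fun e het he => ?_⟩
    have hcases : e = {a, b} ∨ e = {b, c} ∨ e = {a, c} := by
      obtain ⟨x, y, hxy, rfl⟩ := Finset.card_eq_two.1 he
      have hx : x ∈ ({a, b, c} : Finset Plane) := het (by simp)
      have hy : y ∈ ({a, b, c} : Finset Plane) := het (by simp)
      simp only [Finset.mem_insert, Finset.mem_singleton] at hx hy
      rcases hx with rfl | rfl | rfl <;> rcases hy with rfl | rfl | rfl <;>
        simp_all [Finset.pair_comm]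
    rcases hcases with rfl | rfl | rfl
    · rw [edgeMid_pair hab, h1]
    · rw [edgeMid_pair hbc, h2]
    · rw [edgeMid_pair hac, h3]
  exact Classical.epsilon_spec hex e het he

/-- The error of the recovered function on an element. -/
lemma ae_abs_sub_recover_le (hΩ : interior (closure Ω) = Ω) (hγ : 0 < γ)
    (hT : T.ShapeRegular γ) {ext : Finset Plane → Finset Plane × Finset Plane}
    (hext : T.IsBoundaryChoice ext)
    (h : ∀ i, IsScalarH2 Ω (fun x => q x i) (D i) (H i) L) (hΔ0 : ∀ e, 0 ≤ Δ e)
    (hΔ : T.BoundsDiag Δ) {t : Finset Plane} (ht : t ∈ T.elems) :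
    ∀ᵐ x, x ∈ interior (hull t) → ∀ i, |q x i - T.recover ext (rtInterp q) x i| ≤
      25 * edgeConst (γ + 1) * T.elemBound (T.edgeBound H L Δ) t := by
  have hL := (h 0).nonneg
  set X := T.edgeBound H L Δ with hX
  have hX0 : ∀ e, 0 ≤ X e := edgeBound_nonneg hL hΔ0
  set C := edgeConst (γ + 1) with hC
  have hC1 : 1 ≤ C := one_le_edgeConst (by linarith)
  have hrep := (contRep_spec (exists_continuous_rep h (convex_hull t) (measurableSet_hull _)
        (T.interior_hull_subset hΩ ht))).2
  filter_upwards [(ae_restrict_iff' (measurableSet_hull t)).1 hrep] with x hqx hx i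
  have hxt := interior_subset hx
  rw [recover_eq ht hx, ← hqx hxt]
  have hmid := fun e (het : e ⊆ t) (he : e.card = 2) =>
    abs_recoveredValue_sub_le hΩ hγ hT hext h hΔ0 hΔ ht he het i
  have hspec := fun e (het : e ⊆ t) (he : e.card = 2) =>
    recoverOn_spec hγ hT ext (rtInterp q) ht het he
  obtain ⟨a, b, c, rfl, hi⟩ := exists_innerEdge hγ hT hext ht
  obtain ⟨d, hd, hcd⟩ := exists_other ht hi
  obtain ⟨c₀, A, -, happ, -⟩ := exists_affField_approx hΩ hγ hT h hΔ0 hΔ ht hd hcd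
  have happ' := happ c (Or.inl rfl)
  obtain ⟨hab, hac, hbc⟩ := triple_ne_of_mem ht
  have s1 : ({a, b} : Finset Plane) ⊆ {a, b, c} := fun x hx => by
    simp only [Finset.mem_insert, Finset.mem_singleton] at hx ⊢; tauto
  have s2 : ({b, c} : Finset Plane) ⊆ {a, b, c} := fun x hx => by
    simp only [Finset.mem_insert, Finset.mem_singleton] at hx ⊢; tauto
  have s3 : ({a, c} : Finset Plane) ⊆ {a, b, c} := fun x hx => by
    simp only [Finset.mem_insert, Finset.mem_singleton] at hx ⊢; tauto
  have hXZ : C * X {a, b} ≤ C * T.elemBound X {a, b, c} := by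
    refine mul_le_mul_of_nonneg_left ?_ (by linarith)
    exact le_elemBound hX0 ht (two_le_card_inter_of_subset hi.1 s1 s1) s1 hi
  have key : ∀ p r : Plane, p ≠ r → ({p, r} : Finset Plane) ⊆ {a, b, c} →
      mid p r ∈ hull {a, b, c} →
      |T.recoverOn ext (rtInterp q) {a, b, c} (mid p r) i - affField c₀ A (mid p r) i| ≤
        8 * C * T.elemBound X {a, b, c} := by
    intro p r hpr hsub hm
    have f1 := abs_le.1 (hmid _ hsub (Finset.card_pair hpr))
    have f2 := hspec _ hsub (Finset.card_pair hpr)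
    have f3 := abs_le.1 (happ' _ hm i)
    rw [edgeMid_pair hpr] at f1 f2
    rw [f2, abs_le]
    constructor <;> linarith [f1.1, f1.2, f3.1, f3.2]
  have m2 : mid b c ∈ hull {a, b, c} := by rw [triple_rotate]; exact mid_mem_hull b c a
  have m3 : mid a c ∈ hull {a, b, c} := by
    rw [triple_swap, triple_rotate]; exact mid_mem_hull a c b
  -- The recovered values are within `7 + 1` units of one affine field at all three midpoints, hence
  -- within `3 * 8` on the element; passing from that field to `q` makes `25`.
  have hfin := abs_le.1 (abs_affineMap_sub_le (T.recoverOn ext (rtInterp q) {a, b, c}) c₀ A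
    (key a b hab s1 (mid_mem_hull a b c)) (key b c hbc s2 m2) (key a c hac s3 m3) hxt)
  have f4 := abs_le.1 (happ' x hxt i)
  rw [abs_le]
  constructor <;> linarith [hfin.1, hfin.2, f4.1, f4.2]

end Triangulation

/-! ### Summation over the elements -/

namespace Triangulation

variable {Ω : Set Plane} {T : Triangulation Ω} {γ : ℝ}

lemma mem_neighbours {s t : Finset Plane} :
    s ∈ T.neighbours t ↔ s ∈ T.elems ∧ 2 ≤ (t ∩ s).card := by
  simp [neighbours]

lemma exists_common_edge {s t : Finset Plane} (h : 2 ≤ (t ∩ s).card) :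
    ∃ e, e.card = 2 ∧ e ⊆ s ∧ e ⊆ t := by
  obtain ⟨e, he, hc⟩ := Finset.exists_subset_card_eq h
  exact ⟨e, hc, he.trans Finset.inter_subset_right, he.trans Finset.inter_subset_left⟩

/-- Three edges with at most two elements at each. -/
lemma card_neighbours_le (hγ : 0 < γ) (hT : T.ShapeRegular γ) {t : Finset Plane}
    (ht : t ∈ T.elems) : (T.neighbours t).card ≤ 6 := by
  have hsub : T.neighbours t ⊆ (t.powersetCard 2).biUnion fun e => T.star e := by
    intro s hs
    rw [mem_neighbours] at hs
    obtain ⟨e, he, hes, het⟩ := exists_common_edge hs.2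
    rw [Finset.mem_biUnion]
    exact ⟨e, Finset.mem_powersetCard.2 ⟨het, he⟩, T.mem_star.2 ⟨hs.1, hes⟩⟩
  refine (Finset.card_le_card hsub).trans ?_
  refine (Finset.card_biUnion_le_card_mul _ _ 2 fun e he => ?_).trans_eq ?_
  · exact star_card_le_two hγ hT (Finset.mem_powersetCard.1 he).2
  · rw [Finset.card_powersetCard, (T.mem_elems.1 ht).2]; rfl

lemma card_innerEdges_le {t : Finset Plane} (ht : t ∈ T.elems) :
    (T.innerEdges t).card ≤ 3 := by
  refine (Finset.card_filter_le _ _).trans_eq ?_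
  rw [Finset.card_powersetCard, (T.mem_elems.1 ht).2]; rfl

lemma sum_neighbours_comm (y : Finset Plane → Finset Plane → ℝ) :
    ∑ t ∈ T.elems, ∑ s ∈ T.neighbours t, y t s = ∑ s ∈ T.elems, ∑ t ∈ T.neighbours s, y t s := by
  refine Finset.sum_comm' fun t s => ?_
  rw [mem_neighbours, mem_neighbours, Finset.inter_comm]
  tauto

/-- Finite overlap: being neighbours is symmetric, so after interchanging the sums each element is
counted at most six times. -/
lemma sum_neighbours_le (hγ : 0 < γ) (hT : T.ShapeRegular γ) {y : Finset Plane → ℝ}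
    (hy : ∀ t, 0 ≤ y t) :
    ∑ t ∈ T.elems, ∑ s ∈ T.neighbours t, y s ≤ 6 * ∑ s ∈ T.elems, y s := by
  rw [sum_neighbours_comm (T := T) fun _ s => y s, Finset.mul_sum]
  refine Finset.sum_le_sum fun s hs => ?_
  rw [Finset.sum_const, nsmul_eq_mul]
  refine mul_le_mul_of_nonneg_right ?_ (hy s)
  exact_mod_cast card_neighbours_le hγ hT hs

/-- Both areas are comparable to the squared length of the common edge. -/
lemma area_le_of_mem_neighbours (hγ : 0 < γ) (hT : T.ShapeRegular γ) {s t : Finset Plane}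
    (ht : t ∈ T.elems) (hs : s ∈ T.neighbours t) : area t ≤ γ ^ 4 * area s := by
  rw [mem_neighbours] at hs
  obtain ⟨e, he, hes, het⟩ := exists_common_edge hs.2
  obtain ⟨a, b, c, rfl, rfl⟩ := exists_eq_triple he (T.mem_elems.1 ht).2 het
  have h1 := area_le ht
  have h2 := diam_le_dist hγ hT ht
  have h3 : dist a b ≤ diam (hull s) := dist_le_diam (hes (by simp)) (hes (by simp))
  have h4 := le_area hγ hT hs.1
  have h5 : 2 * diam (hull {a, b, c}) ≤ γ * diam (hull s) := h2.trans (by gcongr)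
  have h6 : (2 * diam (hull {a, b, c})) ^ 2 ≤ (γ * diam (hull s)) ^ 2 :=
    pow_le_pow_left₀ (mul_nonneg zero_le_two diam_nonneg) h5 2
  have h7 : γ ^ 2 * diam (hull s) ^ 2 ≤ γ ^ 2 * (γ ^ 2 * area s) := by
    have := sq_nonneg (diam (hull s))
    exact mul_le_mul_of_nonneg_left (by linarith) (sq_nonneg γ)
  calc area {a, b, c} ≤ (2 * diam (hull {a, b, c})) ^ 2 := by linarith
    _ ≤ γ ^ 2 * diam (hull s) ^ 2 := by rw [← mul_pow]; exact h6
    _ ≤ _ := h7.trans_eq (by ring)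

lemma elemBound_sq_le (hγ : 0 < γ) (hT : T.ShapeRegular γ) (X : Finset Plane → ℝ)
    {t : Finset Plane} (ht : t ∈ T.elems) :
    T.elemBound X t ^ 2 ≤ 18 * ∑ s ∈ T.neighbours t, ∑ e ∈ T.innerEdges s, X e ^ 2 := by
  have h1 : (((T.neighbours t).card : ℕ) : ℝ) ≤ 6 := by exact_mod_cast card_neighbours_le hγ hT ht
  refine sq_sum_le_card_mul_sum_sq.trans ?_
  calc ((T.neighbours t).card : ℝ) * ∑ s ∈ T.neighbours t, (∑ e ∈ T.innerEdges s, X e) ^ 2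
      ≤ 6 * ∑ s ∈ T.neighbours t, (3 * ∑ e ∈ T.innerEdges s, X e ^ 2) := by
        refine mul_le_mul h1 (Finset.sum_le_sum fun s hs => ?_)
          (Finset.sum_nonneg fun _ _ => sq_nonneg _) (by norm_num)
        refine sq_sum_le_card_mul_sum_sq.trans ?_
        refine mul_le_mul_of_nonneg_right ?_ (Finset.sum_nonneg fun _ _ => sq_nonneg _)
        exact_mod_cast card_innerEdges_le (mem_neighbours.1 hs).1
    _ = _ := by rw [← Finset.mul_sum]; ring

lemma sum_area_elemBound_le (hγ : 0 < γ) (hT : T.ShapeRegular γ) (X : Finset Plane → ℝ) :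
    ∑ t ∈ T.elems, area t * T.elemBound X t ^ 2 ≤
      108 * γ ^ 4 * ∑ s ∈ T.elems, area s * ∑ e ∈ T.innerEdges s, X e ^ 2 := by
  calc ∑ t ∈ T.elems, area t * T.elemBound X t ^ 2
      ≤ ∑ t ∈ T.elems, ∑ s ∈ T.neighbours t,
          18 * γ ^ 4 * (area s * ∑ e ∈ T.innerEdges s, X e ^ 2) := by
        refine Finset.sum_le_sum fun t ht => ?_
        refine (mul_le_mul_of_nonneg_left (elemBound_sq_le hγ hT X ht) (area_nonneg t)).trans ?_
        rw [mul_left_comm, Finset.mul_sum, Finset.mul_sum]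
        refine Finset.sum_le_sum fun s hs => ?_
        have h1 := area_le_of_mem_neighbours hγ hT ht hs
        have h2 : 0 ≤ ∑ e ∈ T.innerEdges s, X e ^ 2 := Finset.sum_nonneg fun _ _ => sq_nonneg _
        have h3 := mul_le_mul_of_nonneg_right h1 h2
        calc _ ≤ 18 * (γ ^ 4 * area s * ∑ e ∈ T.innerEdges s, X e ^ 2) := by linarith
          _ = _ := by ring
    _ ≤ 6 * ∑ s ∈ T.elems, 18 * γ ^ 4 * (area s * ∑ e ∈ T.innerEdges s, X e ^ 2) :=
        sum_neighbours_le hγ hT fun s => mul_nonneg (by positivity)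
          (mul_nonneg (area_nonneg s) (Finset.sum_nonneg fun _ _ => sq_nonneg _))
    _ = _ := by rw [← Finset.mul_sum]; ring

lemma diam_le_meshSize {h : ℝ} (hh : T.IsMeshSize h) {t : Finset Plane} (ht : t ∈ T.elems) :
    diam (hull t) ≤ h :=
  hh.2 ⟨t, ht, rfl⟩

lemma edgeLen_le_meshSize {h : ℝ} (hh : T.IsMeshSize h) {t e : Finset Plane} (ht : t ∈ T.elems)
    (het : e ⊆ t) : edgeLen e ≤ h := by
  refine le_trans ?_ (diam_le_meshSize hh ht)
  exact diam_mono (fun x hx => subset_hull (het hx)) (isCompact_hull t).isBounded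

lemma sum_elemHess_le (hΩ : interior (closure Ω) = Ω) {H : Fin 2 → Fin 2 → Fin 2 → Plane → ℝ}
    (hH : IntegrableOn (hessSq H) Ω volume) :
    ∑ t ∈ T.elems, elemHess H t ≤ ∫ x in Ω, hessSq H x := by
  have hint : ∀ t ∈ T.elems, IntegrableOn (hessSq H) (interior (hull t)) volume := fun t ht =>
    hH.mono_set (T.interior_hull_subset hΩ ht)
  unfold elemHess
  rw [← integral_biUnion_finset T.elems (fun t _ => isOpen_interior.measurableSet)
    (fun s hs t ht hst => disjoint_interior hs ht hst) hint]
  refine setIntegral_mono_set hH (Eventually.of_forall fun x => hessSq_nonneg H x)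
    (Eventually.of_forall fun x hx => ?_)
  obtain ⟨t, ht, hxt⟩ := mem_iUnion₂.1 hx
  exact T.interior_hull_subset hΩ ht hxt

lemma star_subset_neighbours {t e : Finset Plane} (he : e ∈ T.innerEdges t) :
    T.star e ⊆ T.neighbours t := by
  intro s hs
  rw [mem_star] at hs
  rw [mem_innerEdges] at he
  exact mem_neighbours.2 ⟨hs.1, two_le_card_inter_of_subset he.2.1 hs.2 he.1⟩

lemma sum_area_edgeHess_le (hγ : 0 < γ) (hT : T.ShapeRegular γ) {h : ℝ} (hh : T.IsMeshSize h)
    (H : Fin 2 → Fin 2 → Fin 2 → Plane → ℝ) :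
    ∑ s ∈ T.elems, area s * ∑ e ∈ T.innerEdges s, (edgeLen e * T.edgeHess H e) ^ 2 ≤
      72 * h ^ 4 * ∑ t ∈ T.elems, elemHess H t := by
  have hE0 : ∀ t, 0 ≤ elemHess H t := elemHess_nonneg H
  calc ∑ s ∈ T.elems, area s * ∑ e ∈ T.innerEdges s, (edgeLen e * T.edgeHess H e) ^ 2
      ≤ ∑ s ∈ T.elems, ∑ t ∈ T.neighbours s, 12 * h ^ 4 * elemHess H t := by
        refine Finset.sum_le_sum fun s hs => ?_
        have hd := diam_le_meshSize hh hs
        have hd0 : 0 ≤ diam (hull s) := diam_nonneg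
        have ha : area s ≤ 4 * h ^ 2 := (area_le hs).trans (by gcongr)
        have hN : 0 ≤ ∑ t ∈ T.neighbours s, elemHess H t := Finset.sum_nonneg fun t _ => hE0 t
        have hsum : ∑ e ∈ T.innerEdges s, (edgeLen e * T.edgeHess H e) ^ 2 ≤
            3 * (h ^ 2 * ∑ t ∈ T.neighbours s, elemHess H t) := by
          have hle : ∀ e ∈ T.innerEdges s, (edgeLen e * T.edgeHess H e) ^ 2 ≤
              h ^ 2 * ∑ t ∈ T.neighbours s, elemHess H t := by
            intro e he
            have h1 := edgeLen_le_meshSize hh hs (T.mem_innerEdges.1 he).1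
            have h2 : edgeLen e ^ 2 ≤ h ^ 2 := pow_le_pow_left₀ (edgeLen_nonneg e) h1 2
            have h3 : T.edgeHess H e ^ 2 ≤ ∑ t ∈ T.neighbours s, elemHess H t := by
              rw [edgeHess, Real.sq_sqrt (Finset.sum_nonneg fun t _ => hE0 t)]
              exact Finset.sum_le_sum_of_subset_of_nonneg (star_subset_neighbours he)
                fun t _ _ => hE0 t
            rw [mul_pow]
            exact mul_le_mul h2 h3 (sq_nonneg _) (sq_nonneg _)
          refine (Finset.sum_le_card_nsmul _ _ _ hle).trans ?_
          rw [nsmul_eq_mul]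
          refine mul_le_mul_of_nonneg_right ?_ (mul_nonneg (sq_nonneg h) hN)
          exact_mod_cast card_innerEdges_le hs
        rw [← Finset.mul_sum]
        calc _ ≤ 4 * h ^ 2 * (3 * (h ^ 2 * ∑ t ∈ T.neighbours s, elemHess H t)) :=
              mul_le_mul ha hsum (Finset.sum_nonneg fun _ _ => sq_nonneg _) (by positivity)
          _ = _ := by ring
    _ ≤ 6 * ∑ t ∈ T.elems, 12 * h ^ 4 * elemHess H t :=
        sum_neighbours_le hγ hT fun t => mul_nonneg (by positivity) (hE0 t)
    _ = _ := by rw [← Finset.mul_sum]; ring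

/-- Good edges, at most three per element, cost the total area. For exceptional edges the order of
summation is reversed, so that only the area of their patches appears. -/
lemma sum_area_diag_le {E₂ : Finset (Finset Plane)} {d₁ d₂ : ℝ} :
    ∑ s ∈ T.elems, area s * ∑ e ∈ T.innerEdges s, (if e ∈ E₂ then d₂ else d₁) ^ 2 ≤
      3 * d₁ ^ 2 * volume.real (closure Ω) + d₂ ^ 2 * ∑ e ∈ E₂, ∑ t ∈ T.star e, area t := by
  have h1 : ∀ e, (if e ∈ E₂ then d₂ else d₁) ^ 2 ≤ d₁ ^ 2 + if e ∈ E₂ then d₂ ^ 2 else 0 := by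
    intro e
    split_ifs
    · linarith [sq_nonneg d₁]
    · simp
  have h2 : ∑ s ∈ T.elems, area s * ∑ _e ∈ T.innerEdges s, d₁ ^ 2 ≤
      3 * d₁ ^ 2 * volume.real (closure Ω) := by
    calc ∑ s ∈ T.elems, area s * ∑ _e ∈ T.innerEdges s, d₁ ^ 2
        ≤ ∑ s ∈ T.elems, area s * (3 * d₁ ^ 2) := by
          refine Finset.sum_le_sum fun s hs => mul_le_mul_of_nonneg_left ?_ (area_nonneg s)
          rw [Finset.sum_const, nsmul_eq_mul]
          refine mul_le_mul_of_nonneg_right ?_ (sq_nonneg _)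
          exact_mod_cast card_innerEdges_le hs
      _ = (3 * d₁ ^ 2) * ∑ s ∈ T.elems, area s := by rw [← Finset.sum_mul, mul_comm]
      _ ≤ _ := mul_le_mul_of_nonneg_left T.sum_area_le (by positivity)
  have h3 : ∑ s ∈ T.elems, area s * ∑ e ∈ T.innerEdges s, (if e ∈ E₂ then d₂ ^ 2 else 0) ≤
      d₂ ^ 2 * ∑ e ∈ E₂, ∑ t ∈ T.star e, area t := by
    calc ∑ s ∈ T.elems, area s * ∑ e ∈ T.innerEdges s, (if e ∈ E₂ then d₂ ^ 2 else 0)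
        ≤ ∑ s ∈ T.elems, ∑ e ∈ E₂.filter (fun e => e ⊆ s), d₂ ^ 2 * area s := by
          refine Finset.sum_le_sum fun s hs => ?_
          rw [← Finset.mul_sum, mul_comm, ← Finset.sum_filter, Finset.sum_mul,
            ← Finset.sum_mul, Finset.sum_const, nsmul_eq_mul, Finset.sum_const, nsmul_eq_mul]
          have hc : ((T.innerEdges s).filter fun e => e ∈ E₂).card ≤
              (E₂.filter fun e => e ⊆ s).card := by
            refine Finset.card_le_card fun e he => ?_
            rw [Finset.mem_filter] at he ⊢
            exact ⟨he.2, (T.mem_innerEdges.1 he.1).1⟩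
          have hc' : ((((T.innerEdges s).filter fun e => e ∈ E₂).card : ℕ) : ℝ) ≤
              ((E₂.filter fun e => e ⊆ s).card : ℝ) := by exact_mod_cast hc
          have := mul_le_mul_of_nonneg_right hc' (mul_nonneg (sq_nonneg d₂) (area_nonneg s))
          linarith
      _ = ∑ e ∈ E₂, ∑ s ∈ T.star e, d₂ ^ 2 * area s := by
          refine Finset.sum_comm' fun s e => ?_
          rw [mem_star, Finset.mem_filter]
          tauto
      _ = _ := by simp only [Finset.mul_sum]
  calc ∑ s ∈ T.elems, area s * ∑ e ∈ T.innerEdges s, (if e ∈ E₂ then d₂ else d₁) ^ 2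
      ≤ ∑ s ∈ T.elems, (area s * ∑ _e ∈ T.innerEdges s, d₁ ^ 2 +
          area s * ∑ e ∈ T.innerEdges s, (if e ∈ E₂ then d₂ ^ 2 else 0)) := by
        refine Finset.sum_le_sum fun s _ => ?_
        rw [← mul_add, ← Finset.sum_add_distrib]
        exact mul_le_mul_of_nonneg_left (Finset.sum_le_sum fun e _ => h1 e) (area_nonneg s)
    _ ≤ _ := by
        rw [Finset.sum_add_distrib]
        exact add_le_add h2 h3

lemma sum_area_edgeBound_le (hγ : 0 < γ) (hT : T.ShapeRegular γ) {h : ℝ} (hh : T.IsMeshSize h)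
    (H : Fin 2 → Fin 2 → Fin 2 → Plane → ℝ) (L : ℝ) {E₂ : Finset (Finset Plane)} {d₁ d₂ : ℝ} :
    ∑ s ∈ T.elems, area s * ∑ e ∈ T.innerEdges s,
        T.edgeBound H L (fun e => if e ∈ E₂ then d₂ else d₁) e ^ 2 ≤
      144 * h ^ 4 * ∑ t ∈ T.elems, elemHess H t +
      2 * L ^ 2 * (3 * d₁ ^ 2 * volume.real (closure Ω) +
        d₂ ^ 2 * ∑ e ∈ E₂, ∑ t ∈ T.star e, area t) := by
  have h1 := sum_area_edgeHess_le hγ hT hh H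
  have h2 := mul_le_mul_of_nonneg_left (sum_area_diag_le (T := T) (E₂ := E₂) (d₁ := d₁) (d₂ := d₂))
    (by positivity : 0 ≤ 2 * L ^ 2)
  calc _ ≤ ∑ s ∈ T.elems,
        (2 * (area s * ∑ e ∈ T.innerEdges s, (edgeLen e * T.edgeHess H e) ^ 2) +
        2 * L ^ 2 * (area s * ∑ e ∈ T.innerEdges s, (if e ∈ E₂ then d₂ else d₁) ^ 2)) := by
        refine Finset.sum_le_sum fun s _ => ?_
        have e1 : ∀ x y : ℝ, 2 * (area s * x) + 2 * L ^ 2 * (area s * y) =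
            area s * (2 * x + 2 * L ^ 2 * y) := fun x y => by ring
        rw [e1]
        refine mul_le_mul_of_nonneg_left ?_ (area_nonneg s)
        rw [Finset.mul_sum, Finset.mul_sum, ← Finset.sum_add_distrib]
        refine Finset.sum_le_sum fun e _ => ?_
        simp only [edgeBound]
        generalize edgeLen e * T.edgeHess H e = x
        generalize (if e ∈ E₂ then d₂ else d₁) = y
        -- This is `(x + L y)² ≤ 2 x² + 2 L² y²`.
        nlinarith [sq_nonneg (x - L * y)]
    _ ≤ _ := by
        rw [Finset.sum_add_distrib, ← Finset.mul_sum, ← Finset.mul_sum]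
        linarith

/-- The square of the `L²` norm of the error, in terms of bounds on the elements. -/
lemma lintegral_sub_recover_le {q : Plane → Plane} {ext : Finset Plane → Finset Plane × Finset Plane}
    {B : Finset Plane → ℝ}
    (hB : ∀ t ∈ T.elems, ∀ᵐ x, x ∈ interior (hull t) → ∀ i,
      |q x i - T.recover ext (rtInterp q) x i| ≤ B t) :
    ∫⁻ x in Ω, ‖q x - T.recover ext (rtInterp q) x‖ₑ ^ 2 ≤
      ENNReal.ofReal (2 * ∑ t ∈ T.elems, area t * B t ^ 2) := by
  set F : Plane → ℝ≥0∞ := fun x => ‖q x - T.recover ext (rtInterp q) x‖ₑ ^ 2 with hF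
  have hcov : Ω ≤ᵐ[volume] (⋃ t ∈ T.elems, interior (hull t) : Set Plane) := by
    filter_upwards [ae_exists_mem_interior (T := T)] with x hx hxΩ
    obtain ⟨t, ht, hxt⟩ := hx hxΩ
    exact mem_iUnion₂.2 ⟨t, ht, hxt⟩
  have hnn : ∀ t ∈ T.elems, 0 ≤ area t * B t ^ 2 := fun t _ =>
    mul_nonneg (area_nonneg t) (sq_nonneg _)
  calc ∫⁻ x in Ω, F x ≤ ∫⁻ x in ⋃ t ∈ T.elems, interior (hull t), F x := lintegral_mono_set' hcov
    _ = ∑ t ∈ T.elems, ∫⁻ x in interior (hull t), F x :=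
        lintegral_biUnion_finset (fun s hs t ht hst => disjoint_interior hs ht hst)
          (fun t _ => isOpen_interior.measurableSet) F
    _ ≤ ∑ t ∈ T.elems, ENNReal.ofReal (2 * (area t * B t ^ 2)) := by
        refine Finset.sum_le_sum fun t ht => ?_
        have hae : ∀ᵐ x, x ∈ interior (hull t) → F x ≤ ENNReal.ofReal (2 * B t ^ 2) := by
          filter_upwards [hB t ht] with x hx hxt
          have hi := hx hxt
          simp only [hF]
          rw [← ofReal_norm, ← ENNReal.ofReal_pow (norm_nonneg _)]
          apply ENNReal.ofReal_le_ofReal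
          rw [norm_sq_plane]
          have h0 := sq_le_sq' (abs_le.1 (hi 0)).1 (abs_le.1 (hi 0)).2
          have h1 := sq_le_sq' (abs_le.1 (hi 1)).1 (abs_le.1 (hi 1)).2
          simp only [PiLp.sub_apply]
          linarith
        refine (setLIntegral_mono_ae measurable_const.aemeasurable hae).trans_eq ?_
        rw [setLIntegral_const, ← ofReal_measureReal (((measure_mono interior_subset).trans_lt
          (isCompact_hull t).measure_lt_top).ne), volume_real_interior_hull,
          ← ENNReal.ofReal_mul (by positivity)]
        congr 1
        ring
    _ = _ := by
        rw [← ENNReal.ofReal_sum_of_nonneg fun t ht => mul_nonneg zero_le_two (hnn t ht),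
          Finset.mul_sum]

end Triangulation

/-! ### Exponents and norms -/

lemma rho_le_one (α σ : ℝ≥0∞) : rho α σ ≤ 1 := by
  unfold rho
  exact (ENNReal.toReal_mono ENNReal.one_ne_top (min_le_left _ _)).trans_eq ENNReal.toReal_one

lemma rho_le_left {α : ℝ≥0∞} (σ : ℝ≥0∞) (hα : α ≠ ⊤) : rho α σ ≤ α.toReal :=
  ENNReal.toReal_mono hα ((min_le_right _ _).trans (min_le_left _ _))

lemma two_mul_rho_le (α : ℝ≥0∞) {σ : ℝ≥0∞} (hσ : σ ≠ ⊤) : 2 * rho α σ ≤ σ.toReal := by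
  have h1 : rho α σ ≤ (σ / 2).toReal :=
    ENNReal.toReal_mono (ENNReal.div_ne_top hσ two_ne_zero)
      ((min_le_right _ _).trans (min_le_right _ _))
  rw [ENNReal.toReal_div, ENNReal.toReal_ofNat] at h1
  linarith

lemma hpow_nonneg {h : ℝ} (hh : 0 < h) (s : ℝ≥0∞) : 0 ≤ hpow h s := by
  unfold hpow
  split_ifs
  · exact le_rfl
  · positivity

lemma hpow_one_add_le {h : ℝ} (h0 : 0 < h) (h1 : h < 1) (α σ : ℝ≥0∞) :
    hpow h (1 + α) ≤ h ^ (1 + rho α σ) := by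
  unfold hpow
  split_ifs with hs
  · positivity
  · have hα : α ≠ ⊤ := fun h => hs (by simp [h])
    apply Real.rpow_le_rpow_of_exponent_ge h0 h1.le
    rw [ENNReal.toReal_add ENNReal.one_ne_top hα, ENNReal.toReal_one]
    linarith [rho_le_left σ hα]

/-- The contribution of the exceptional edges: the squared deviation is only `h ^ 2`, but the small
area `h ^ σ` of their patches compensates since `2 ρ ≤ σ`. -/
lemma sq_mul_hpow_le {h : ℝ} (h0 : 0 < h) (h1 : h < 1) (α σ : ℝ≥0∞) :
    h ^ 2 * hpow h σ ≤ (h ^ (1 + rho α σ)) ^ 2 := by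
  unfold hpow
  split_ifs with hs
  · rw [mul_zero]; positivity
  · rw [← Real.rpow_natCast h 2, ← Real.rpow_natCast (h ^ (1 + rho α σ)) 2,
      ← Real.rpow_mul h0.le, ← Real.rpow_add h0]
    apply Real.rpow_le_rpow_of_exponent_ge h0 h1.le
    push_cast
    linarith [two_mul_rho_le α hs]

lemma sq_le_rpow {h : ℝ} (h0 : 0 < h) (h1 : h < 1) (α σ : ℝ≥0∞) :
    h ^ 2 ≤ h ^ (1 + rho α σ) := by
  rw [← Real.rpow_natCast h 2]
  apply Real.rpow_le_rpow_of_exponent_ge h0 h1.le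
  push_cast
  linarith [rho_le_one α σ]

namespace IsH2W1Infty

variable {Ω : Set Plane} {q : Plane → Plane} {D : Fin 2 → Fin 2 → Plane → ℝ}
  {H : Fin 2 → Fin 2 → Fin 2 → Plane → ℝ}

lemma ae_abs_le_gradSupNorm (h : IsH2W1Infty Ω q D H) (i j : Fin 2) :
    ∀ᵐ x ∂(volume.restrict Ω), |D i j x| ≤ gradSupNorm Ω D := by
  -- Finiteness is essential, as `toReal` sends `⊤` to `0`.
  have hfin : (⨆ i, ⨆ j, eLpNorm (D i j) ⊤ (volume.restrict Ω)) ≠ ⊤ := by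
    have hle : (⨆ i, ⨆ j, eLpNorm (D i j) ⊤ (volume.restrict Ω)) ≤
        ∑ i, ∑ j, eLpNorm (D i j) ⊤ (volume.restrict Ω) := by
      refine iSup_le fun i => iSup_le fun j => ?_
      refine le_trans ?_ (Finset.single_le_sum
        (f := fun i => ∑ j, eLpNorm (D i j) ⊤ (volume.restrict Ω)) (fun _ _ => zero_le)
        (Finset.mem_univ i))
      exact Finset.single_le_sum (f := fun j => eLpNorm (D i j) ⊤ (volume.restrict Ω))
        (fun _ _ => zero_le) (Finset.mem_univ j)
    refine ne_top_of_le_ne_top ?_ hle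
    exact ENNReal.sum_ne_top.2 fun i _ => ENNReal.sum_ne_top.2 fun j _ =>
      (h.first_memLp_top i j).2.ne
  filter_upwards [ae_le_eLpNormEssSup (f := D i j) (μ := volume.restrict Ω)] with x hx
  rw [← eLpNorm_exponent_top] at hx
  have h1 := hx.trans (le_iSup₂ (f := fun i j => eLpNorm (D i j) ⊤ (volume.restrict Ω)) i j)
  have h2 := ENNReal.toReal_mono hfin h1
  rwa [toReal_enorm, Real.norm_eq_abs] at h2

lemma isScalarH2 (h : IsH2W1Infty Ω q D H) (hΩ : IsOpen Ω) (i : Fin 2) :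
    IsScalarH2 Ω (fun x => q x i) (D i) (H i) (gradSupNorm Ω D) where
  isOpen := hΩ
  nonneg := ENNReal.toReal_nonneg
  weak_first := h.weak_first i
  weak_second := h.weak_second i
  memLp := h.memLp_two i
  first_memLp := h.first_memLp_two i
  second_memLp := h.second_memLp_two i
  bound := h.ae_abs_le_gradSupNorm i

lemma integral_hessSq_le (h : IsH2W1Infty Ω q D H) :
    ∫ x in Ω, hessSq H x ≤ gradH1Norm Ω D H ^ 2 := by
  have hsq : ∀ i j k, Integrable (fun x => H i j k x ^ 2) (volume.restrict Ω) := fun i j k =>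
    (h.second_memLp_two i j k).integrable_sq
  have h1 : 0 ≤ ∑ i, ∑ j, ∫ x in Ω, D i j x ^ 2 :=
    Finset.sum_nonneg fun i _ => Finset.sum_nonneg fun j _ => integral_nonneg fun x => sq_nonneg _
  have h2 : ∫ x in Ω, hessSq H x = ∑ i, ∑ j, ∑ k, ∫ x in Ω, H i j k x ^ 2 := by
    unfold hessSq
    rw [integral_finsetSum _ fun i _ => integrable_finsetSum _ fun j _ =>
      integrable_finsetSum _ fun k _ => hsq i j k]
    refine Finset.sum_congr rfl fun i _ => ?_
    rw [integral_finsetSum _ fun j _ => integrable_finsetSum _ fun k _ => hsq i j k]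
    refine Finset.sum_congr rfl fun j _ => ?_
    rw [integral_finsetSum _ fun k _ => hsq i j k]
  have h3 : 0 ≤ ∫ x in Ω, hessSq H x := integral_nonneg fun x => hessSq_nonneg H x
  rw [gradH1Norm, Real.sq_sqrt (by rw [← h2]; linarith), h2]
  linarith

end IsH2W1Infty

lemma eLpNorm_two_le_of_lintegral_sq_le {μ : Measure Plane} {f : Plane → Plane} {r : ℝ}
    (hr : 0 ≤ r) (h : ∫⁻ x, ‖f x‖ₑ ^ 2 ∂μ ≤ ENNReal.ofReal (r ^ 2)) :
    eLpNorm f 2 μ ≤ ENNReal.ofReal r := by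
  rw [eLpNorm_eq_lintegral_rpow_enorm_toReal two_ne_zero ENNReal.ofNat_ne_top]
  simp only [ENNReal.toReal_ofNat, ENNReal.rpow_ofNat]
  have e : ENNReal.ofReal r = (ENNReal.ofReal (r ^ 2)) ^ (1 / 2 : ℝ) := by
    rw [ENNReal.ofReal_rpow_of_nonneg (by positivity) (by norm_num), ← Real.sqrt_eq_rpow,
      Real.sqrt_sq hr]
  rw [e]
  exact ENNReal.rpow_le_rpow h (by norm_num)

/-- Bounds for the deviation from parallelograms under the `(α, σ)`-condition. -/
lemma Triangulation.AlphaSigma.exists_boundsDiag {Ω : Set Plane} {T : Triangulation Ω} {γ h M : ℝ}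
    {α σ : ℝ≥0∞} {κ : ℕ} (hγ : 0 < γ) (hT : T.ShapeRegular γ) (h0 : 0 < h)
    (hh : T.IsMeshSize h) (hα : T.AlphaSigma h α σ M κ) :
    ∃ E₂ : Finset (Finset Plane), ∑ e ∈ E₂, ∑ t ∈ T.star e, area t ≤ |M| * hpow h σ ∧
      T.BoundsDiag fun e => if e ∈ E₂ then 2 * (γ + 1) * h
        else 2 * (γ + 1) ^ 3 * (|M| * hpow h (1 + α)) := by
  obtain ⟨⟨E₂, -, hE1, hE2⟩, -⟩ := hα
  -- `M` has no prescribed sign, so `|M|` keeps the bounds nonnegative.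
  refine ⟨E₂, hE2.trans (mul_le_mul_of_nonneg_right (le_abs_self M) (hpow_nonneg h0 σ)), ?_⟩
  intro a b c d hc hd hcd i
  beta_reduce
  have hp := Triangulation.isPatch hγ hT hc hd hcd
  by_cases he : ({a, b} : Finset Plane) ∈ E₂
  · rw [if_pos he]
    refine (hp.abs_diag_le_trivial i).trans ?_
    have : dist a b ≤ h := (Triangulation.dist_le_diam (by simp) (by simp)).trans
      (Triangulation.diam_le_meshSize hh hc)
    gcongr
  · rw [if_neg he]
    obtain ⟨h1, h2⟩ := hE1 _ (Triangulation.isInteriorEdge_of_ne hγ hT hc hd hcd) he a b c d rfl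
      hcd hc hd
    refine (hp.abs_diag_le h1 h2 i).trans ?_
    have : M * hpow h (1 + α) ≤ |M| * hpow h (1 + α) :=
      mul_le_mul_of_nonneg_right (le_abs_self M) (hpow_nonneg h0 _)
    gcongr

end

end RTRecovery

/-! ### The theorem: collecting the constants -/

open RTRecovery in
theorem theorem5p2 (Ω : Set Plane) (hΩ : interior (closure Ω) = Ω)
    (α σ : ENNReal) (γ M : ℝ) (hγ : 0 < γ) (κ : ℕ) :
    ∃ C : ℝ, ∀ (h : ℝ) (T : Triangulation Ω), 0 < h → h < 1 → T.IsMeshSize h →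
      T.ShapeRegular γ → T.AlphaSigma h α σ M κ →
      ∀ ext : Finset Plane → Finset Plane × Finset Plane, T.IsBoundaryChoice ext →
      ∀ (q : Plane → Plane) (D : Fin 2 → Fin 2 → Plane → ℝ)
        (H : Fin 2 → Fin 2 → Fin 2 → Plane → ℝ), IsH2W1Infty Ω q D H →
        MeasureTheory.eLpNorm (fun x => q x - T.recover ext (rtInterp q) x) 2
            (MeasureTheory.volume.restrict Ω) ≤
          ENNReal.ofReal (C * h ^ (1 + rho α σ) * (gradH1Norm Ω D H + gradSupNorm Ω D)) := by
  set k := γ + 1 with hk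
  set V := volume.real (closure Ω) with hV
  -- `135000 = 2 * 25² * 108`: two components of the field, the squared element constant, and the
  -- overlap count. In `K₁` the terms belong to the second derivatives, the good edges and the
  -- exceptional edges.
  set K₀ : ℝ := 135000 * (edgeConst k) ^ 2 * γ ^ 4 with hK₀
  set K₁ : ℝ := 144 + 24 * k ^ 6 * M ^ 2 * V + 8 * k ^ 2 * |M| with hK₁
  have hV0 : 0 ≤ V := measureReal_nonneg
  have hk0 : 0 < k := by linarith
  have hK₀0 : 0 ≤ K₀ := by positivity
  have hK₁0 : 0 ≤ K₁ := by positivity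
  refine ⟨√(K₀ * K₁), fun h T h0 h1 hh hT hα ext hext q D H hq => ?_⟩
  have hΩo : IsOpen Ω := by rw [← hΩ]; exact isOpen_interior
  have hsc := hq.isScalarH2 hΩo
  set L := gradSupNorm Ω D with hL
  set G := gradH1Norm Ω D H with hG
  have hL0 : 0 ≤ L := (hsc 0).nonneg
  have hG0 : 0 ≤ G := Real.sqrt_nonneg _
  set r := h ^ (1 + rho α σ) with hr
  have hr0 : 0 ≤ r := by positivity
  obtain ⟨E₂, hE₂, hdiag⟩ := hα.exists_boundsDiag hγ hT h0 hh
  set d₁ := 2 * (γ + 1) ^ 3 * (|M| * hpow h (1 + α)) with hd₁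
  set d₂ := 2 * (γ + 1) * h with hd₂
  have hp0 := hpow_nonneg h0 (1 + α)
  have hΔ0 : ∀ e, 0 ≤ (fun e => if e ∈ E₂ then d₂ else d₁) e := by
    intro e
    dsimp only
    split_ifs <;> positivity
  have hfin := Triangulation.lintegral_sub_recover_le fun t ht =>
    Triangulation.ae_abs_sub_recover_le hΩ hγ hT hext hsc hΔ0 hdiag ht
  apply eLpNorm_two_le_of_lintegral_sq_le (by positivity)
  refine hfin.trans (ENNReal.ofReal_le_ofReal ?_)
  set X := T.edgeBound H L fun e => if e ∈ E₂ then d₂ else d₁ with hX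
  have s1 := Triangulation.sum_area_elemBound_le hγ hT X
  have s2 := Triangulation.sum_area_edgeBound_le hγ hT hh H L (E₂ := E₂) (d₁ := d₁) (d₂ := d₂)
  have s3 := (Triangulation.sum_elemHess_le (T := T) hΩ
    (integrableOn_hessSq hsc)).trans hq.integral_hessSq_le
  have hh4 : h ^ 4 ≤ r ^ 2 := by
    calc h ^ 4 = (h ^ 2) ^ 2 := by ring
      _ ≤ r ^ 2 := pow_le_pow_left₀ (sq_nonneg h) (sq_le_rpow h0 h1 α σ) 2
  have hd1 : d₁ ^ 2 ≤ 4 * k ^ 6 * M ^ 2 * r ^ 2 := by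
    have e : d₁ ^ 2 = 4 * k ^ 6 * M ^ 2 * hpow h (1 + α) ^ 2 := by
      rw [hd₁, mul_pow, mul_pow |M|, sq_abs]; ring
    rw [e]
    have := pow_le_pow_left₀ hp0 (hpow_one_add_le h0 h1 α σ) 2
    gcongr
  have hd2 : d₂ ^ 2 * ∑ e ∈ E₂, ∑ t ∈ T.star e, area t ≤ 4 * k ^ 2 * |M| * r ^ 2 := by
    calc d₂ ^ 2 * ∑ e ∈ E₂, ∑ t ∈ T.star e, area t ≤ d₂ ^ 2 * (|M| * hpow h σ) := by gcongr
      _ = 4 * k ^ 2 * |M| * (h ^ 2 * hpow h σ) := by rw [hd₂]; ring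
      _ ≤ _ := mul_le_mul_of_nonneg_left (sq_mul_hpow_le h0 h1 α σ) (by positivity)
  have s4 : 144 * h ^ 4 * ∑ t ∈ T.elems, elemHess H t +
      2 * L ^ 2 * (3 * d₁ ^ 2 * V + d₂ ^ 2 * ∑ e ∈ E₂, ∑ t ∈ T.star e, area t) ≤
      K₁ * r ^ 2 * (G + L) ^ 2 := by
    have t1 : 144 * h ^ 4 * ∑ t ∈ T.elems, elemHess H t ≤ 144 * r ^ 2 * G ^ 2 :=
      mul_le_mul (by linarith) s3 (Finset.sum_nonneg fun t _ => elemHess_nonneg H t)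
        (by positivity)
    have t2 : 3 * d₁ ^ 2 * V + d₂ ^ 2 * ∑ e ∈ E₂, ∑ t ∈ T.star e, area t ≤
        3 * (4 * k ^ 6 * M ^ 2 * r ^ 2) * V + 4 * k ^ 2 * |M| * r ^ 2 := by
      gcongr
    have t3 := mul_le_mul_of_nonneg_left t2 (by positivity : 0 ≤ 2 * L ^ 2)
    have t4 : 144 * r ^ 2 * G ^ 2 ≤ 144 * r ^ 2 * (G + L) ^ 2 := by
      gcongr; linarith
    have t5 : (24 * k ^ 6 * M ^ 2 * V + 8 * k ^ 2 * |M|) * r ^ 2 * L ^ 2 ≤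
        (24 * k ^ 6 * M ^ 2 * V + 8 * k ^ 2 * |M|) * r ^ 2 * (G + L) ^ 2 := by
      gcongr; linarith
    calc _ ≤ 144 * r ^ 2 * G ^ 2 +
          (24 * k ^ 6 * M ^ 2 * V + 8 * k ^ 2 * |M|) * r ^ 2 * L ^ 2 := by linarith
      _ ≤ 144 * r ^ 2 * (G + L) ^ 2 +
          (24 * k ^ 6 * M ^ 2 * V + 8 * k ^ 2 * |M|) * r ^ 2 * (G + L) ^ 2 := add_le_add t4 t5
      _ = _ := by rw [hK₁]; ring
  have s5 : ∑ s ∈ T.elems, area s * ∑ e ∈ T.innerEdges s, X e ^ 2 ≤ K₁ * r ^ 2 * (G + L) ^ 2 :=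
    s2.trans s4
  calc 2 * ∑ t ∈ T.elems, area t * (25 * edgeConst (γ + 1) * T.elemBound X t) ^ 2
      = 1250 * edgeConst k ^ 2 * ∑ t ∈ T.elems, area t * T.elemBound X t ^ 2 := by
        rw [Finset.mul_sum, Finset.mul_sum]
        refine Finset.sum_congr rfl fun t _ => ?_
        ring
    _ ≤ 1250 * edgeConst k ^ 2 *
        (108 * γ ^ 4 * ∑ s ∈ T.elems, area s * ∑ e ∈ T.innerEdges s, X e ^ 2) := by gcongr
    _ ≤ 1250 * edgeConst k ^ 2 * (108 * γ ^ 4 * (K₁ * r ^ 2 * (G + L) ^ 2)) := by gcongr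
    _ = (√(K₀ * K₁) * r * (G + L)) ^ 2 := by
        rw [mul_pow, mul_pow, Real.sq_sqrt (mul_nonneg hK₀0 hK₁0), hK₀]
        ring
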